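/- A \emph{map of genus $g$} is a proper embedding of a graph (loops and multiple edges allowed) in the compact connected oriented surface of genus $g$ without boundary, all of whose faces are homeomorphic to discs; a \emph{rooted map} is a map with a distinguished arc (an edge with an orientation), the origin of the root arc being the root vertex. Maps are considered up to orientation-preserving homeomorphisms of the surface (carrying roots and labels, if any). A \emph{$1$-tree} is a map of genus $1$ with exactly one face; it is \emph{reduced} if it has no vertex of degree one. A rooted map is \emph{embedded} if its vertices carry integer labels that differ by at most one along every edge, the root vertex having label $1$. Let $R_1(t)=\sum_n r_n t^n$, where $r_n$ is the number of embedded rooted reduced $1$-trees with $n$ edges, and let $\widehat R_1(t)$ be the formal power series with zero constant term such that $t\,\frac{d}{dt}\widehat R_1(t)=R_1(t)$. Then \[ \widehat R_1(t)=\frac{t^2(1+3t)}{2(1-3t)^2(1+t)} . \] Let $Q_1(z)=\sum_n q_n z^n$, where $q_n$ is the number of rooted bipartite quadrangulations of genus $1$ with $n$ faces, that is, rooted maps of genus $1$ with $n$ faces, all of degree $4$ (an edge incident to a face on both sides counts twice), whose vertices can be coloured in two colours so that adjacent vertices have different colours. Let $T=T(z)$ be the unique formal power series with $T=1+3zT^2$.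 Then \[ Q_1(z)=\frac{(T-1)^2\,T}{3(2-T)^2(2+T)} . \] -/

import Mathlib

open scoped PowerSeries

namespace TorusMaps

/-- A map on a compact connected oriented surface without boundary with `n` edges, in its
combinatorial description. Its `2 n` arcs (edges with an orientation) are numbered by `Fin (2 * n)`;
`σ` sends an arc to the next arc around its origin in counterclockwise direction, and `α` reverses
each arc. A connected pair `(σ, α)` describes a graph embedded with simply connected faces.
Loops and multiple edges are allowed. -/
structure CMap (n : ℕ) where
  σ : Equiv.Perm (Fin (2 * n))
  α : Equiv.Perm (Fin (2 * n))
  α_invol : ∀ d, α (α d) = d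
  α_ne : ∀ d, α d ≠ d
  connected : ∀ d e, ∃ g ∈ Subgroup.closure {σ, α}, g d = e

namespace CMap

variable {n : ℕ}

/-- The face permutation: it sends an arc to the next arc on the border of the face on its right. -/
def φ (M : CMap n) : Equiv.Perm (Fin (2 * n)) := M.σ * M.α

/-- The vertices are the cycles (fixed points included) of `σ`. -/
def Vertex (M : CMap n) : Type := Quotient (Equiv.Perm.SameCycle.setoid M.σ)

/-- The faces are the cycles (fixed points included) of `φ`. -/
def Face (M : CMap n) : Type := Quotient (Equiv.Perm.SameCycle.setoid M.φ)

/-- Genus `g`, read off from the Euler characteristic `v - n + f = 2 - 2 g`. -/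
def HasGenus (M : CMap n) (g : ℕ) : Prop :=
  (Nat.card M.Vertex : ℤ) - n + Nat.card M.Face = 2 - 2 * g

/-- Degree of the vertex from which the arc `d` originates (a loop counts twice). -/
noncomputable def vertexDegree (M : CMap n) (d : Fin (2 * n)) : ℕ :=
  Nat.card {e // M.σ.SameCycle d e}

/-- Degree of the face on the right of the arc `d` (an edge with this face on both sides
counts twice). -/
noncomputable def faceDegree (M : CMap n) (d : Fin (2 * n)) : ℕ :=
  Nat.card {e // M.φ.SameCycle d e}

/-- All faces have degree 4. -/
def IsQuadrangulation (M : CMap n) : Prop := ∀ d, M.faceDegree d = 4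

/-- The vertices can be coloured in two colours so that adjacent vertices get different colours;
`c d` is the colour of the origin of the arc `d`. -/
def IsBipartite (M : CMap n) : Prop :=
  ∃ c : Fin (2 * n) → Bool, (∀ d, c (M.σ d) = c d) ∧ ∀ d, c (M.α d) ≠ c d

/-- A `g`-tree is a map of genus `g` with one face. -/
def IsTree (M : CMap n) (g : ℕ) : Prop := M.HasGenus g ∧ Nat.card M.Face = 1

/-- No vertex has degree one. -/
def IsReduced (M : CMap n) : Prop := ∀ d, M.vertexDegree d ≠ 1

end CMap

/-- A map with a distinguished arc. -/
structure RootedMap (n : ℕ) extends CMap n where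
  root : Fin (2 * n)

/-- An embedded rooted map: integer labels on vertices (`label d` is the label of the origin of the
arc `d`) that differ at most by one along every edge, the root vertex having label 1. -/
structure EmbeddedMap (n : ℕ) extends RootedMap n where
  label : Fin (2 * n) → ℤ
  label_vertex : ∀ d, label (σ d) = label d
  label_edge : ∀ d, |label (α d) - label d| ≤ 1
  label_root : label root = 1

/-- `π` is an orientation preserving isomorphism of rooted maps. -/
def IsRootedIso {n : ℕ} (M N : RootedMap n) (π : Equiv.Perm (Fin (2 * n))) : Prop :=
  (∀ d, π (M.σ d) = N.σ (π d)) ∧ (∀ d, π (M.α d) = N.α (π d)) ∧ π M.root = N.root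

theorem IsRootedIso.refl {n : ℕ} (M : RootedMap n) : IsRootedIso M M 1 := by
  simp [IsRootedIso]

theorem IsRootedIso.symm {n : ℕ} {M N : RootedMap n} {π : Equiv.Perm (Fin (2 * n))}
    (h : IsRootedIso M N π) : IsRootedIso N M π⁻¹ := by
  obtain ⟨h1, h2, h3⟩ := h
  refine ⟨fun d => ?_, fun d => ?_, ?_⟩
  · rw [Equiv.Perm.inv_eq_iff_eq, h1]; simp
  · rw [Equiv.Perm.inv_eq_iff_eq, h2]; simp
  · rw [Equiv.Perm.inv_eq_iff_eq, h3]

theorem IsRootedIso.trans {n : ℕ} {M N P : RootedMap n} {π ρ : Equiv.Perm (Fin (2 * n))}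
    (h : IsRootedIso M N π) (k : IsRootedIso N P ρ) : IsRootedIso M P (ρ * π) := by
  obtain ⟨h1, h2, h3⟩ := h
  obtain ⟨k1, k2, k3⟩ := k
  refine ⟨fun d => ?_, fun d => ?_, ?_⟩ <;> simp [*]

/-- Two rooted maps are the same if an orientation preserving isomorphism carries one onto the
other, roots included. -/
def rootedSetoid (n : ℕ) : Setoid (RootedMap n) where
  r M N := ∃ π, IsRootedIso M N π
  iseqv :=
    ⟨fun M => ⟨1, .refl M⟩, fun ⟨π, h⟩ => ⟨π⁻¹, h.symm⟩, fun ⟨π, h⟩ ⟨ρ, k⟩ => ⟨ρ * π, h.trans k⟩⟩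

/-- Two embedded rooted maps are the same if an orientation preserving isomorphism carries one onto
the other, roots and labels included. -/
def embeddedSetoid (n : ℕ) : Setoid (EmbeddedMap n) where
  r M N := ∃ π, IsRootedIso M.toRootedMap N.toRootedMap π ∧ ∀ d, N.label (π d) = M.label d
  iseqv :=
    ⟨fun M => ⟨1, .refl _, fun _ => rfl⟩,
     fun {M N} ⟨π, h, l⟩ => ⟨π⁻¹, h.symm, fun d => by rw [← l]; simp⟩,
     fun {M N P} ⟨π, h, l⟩ ⟨ρ, k, m⟩ =>
      ⟨ρ * π, h.trans k, fun d => by rw [Equiv.Perm.mul_apply, m, l]⟩⟩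

/-- The number of embedded rooted reduced `g`-trees with `n` edges. -/
noncomputable def reducedTreeCount (g n : ℕ) : ℕ :=
  (Quotient.mk (embeddedSetoid n) '' {M | M.IsTree g ∧ M.IsReduced}).ncard

/-- The number of rooted bipartite quadrangulations of genus `g` with `n` faces
(hence `2 n` edges). -/
noncomputable def quadrangulationCount (g n : ℕ) : ℕ :=
  (Quotient.mk (rootedSetoid (2 * n)) '' {M | M.HasGenus g ∧ M.IsQuadrangulation ∧
    M.IsBipartite ∧ Nat.card M.Face = n}).ncard

/-- The generating series `R_g(t)` of embedded rooted reduced `g`-trees, by number of edges. -/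
noncomputable def R (g : ℕ) : ℚ⟦X⟧ := PowerSeries.mk fun n => (reducedTreeCount g n : ℚ)

/-- The primitive of `R_g`: the series without constant term with `t (d/dt) Rhat_g = R_g`. -/
noncomputable def Rhat (g : ℕ) : ℚ⟦X⟧ := PowerSeries.mk fun n => (reducedTreeCount g n : ℚ) / n

/-- The generating series `Q_g(z)` of rooted bipartite quadrangulations of genus `g`, by number of
faces. -/
noncomputable def Q (g : ℕ) : ℚ⟦X⟧ := PowerSeries.mk fun n => (quadrangulationCount g n : ℚ)

theorem Rhat_spec (g : ℕ) : PowerSeries.constantCoeff (Rhat g) = 0 ∧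
    PowerSeries.X * PowerSeries.derivative ℚ (Rhat g) = R g := by
  refine ⟨by simp [Rhat], ?_⟩
  ext n
  cases n with
  | zero =>
    have h : IsEmpty (EmbeddedMap 0) := ⟨fun M => M.root.elim0⟩
    simp [R, reducedTreeCount, Set.eq_empty_of_isEmpty]
  | succ n =>
    have h : ((n : ℚ) + 1) ≠ 0 := by positivity
    rw [PowerSeries.coeff_succ_X_mul]
    rw [PowerSeries.coeff_derivative]
    simp [Rhat, R, h]

end TorusMaps

/-! Both series are read off from `unrootedSeries`, the series U that counts all labelled rooted
one-face maps of genus one, each with weight 1/n for n edges.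

Reduced maps. If no vertex has degree one, Euler's formula leaves, besides vertices of degree two,
either one vertex of degree four or two of degree three (`cycleCount_iff_card_branchSet`). Rooted at
a corner of such a vertex, the border of the face reads A B A⁻ B⁻ or A B C A⁻ B⁻ C⁻
(`exists_isHexagon`), and a labelling amounts to two closed walks, or three walks with a common
displacement, with steps -1, 0, 1. Since 4 or 6 of the 2n corners are branch corners, rerooting
yields the weights 1/2 and 1/3 (`reducedTreeCount_div`). The walk series are rational in u, where u
= t (1 + u + u²), and the sum over displacements is geometric; the total, a rational function of u,
turns out to be rational in t (`Rhat_eq`).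

All one-face maps. Being reduced is detected by inclusion–exclusion over sets of leaves. Deleting j
chosen leaves from a map with n edges leaves a map with n - j edges and a multiset of j of its 2 (n
- j) corners, and each leaf had three possible labels (`leafMoment_eq`). Summation gives Rhat(t) =
U(t / (1 + 3t)²) (`Rhat_eq_subst`).

Quadrangulations. In a labelled one-face map, join every corner to the first later corner with a
smaller label, or to one additional vertex if its label is minimal. The edges so drawn form a
bipartite quadrangulation whose labels are, up to a constant, the distances to the additional
vertex. Conversely the gluing and the inverse of its vertex rotation are the first-return maps, to
the descending arcs, of the face and vertex permutations of the quadrangulation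
(`IsLabelledQuad.exists_gluing`). A quadrangulation of the torus with n faces has n vertices, so
pointing it and orienting its root edge give n q_n = 2 |oneTrees n| (`mul_quadrangulationCount`),
that is Q = 2U. To avoid symmetries, the count is done with all arcs numbered, a rooted map having
no nontrivial automorphism.

Finally t = z T² inverts z = t / (1 + 3t)², since the equation for T says 1 + 3t = T; substitution
in the formula for Rhat gives Q. -/

namespace TorusMaps

open Equiv

/-! ### Cycles of permutations and first-return maps -/

section CycleCount

variable {D E : Type*}

/-- The number of cycles of a permutation, fixed points included. -/
noncomputable def cycleCount (f : Perm D) : ℕ := Nat.card (Quotient (Perm.SameCycle.setoid f))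

/-- `g` is the first return map of `f` to the image of `ι`. -/
def IsFirstReturn (f : Perm D) (g : Perm E) (ι : E → D) : Prop :=
  ∀ e, ∃ k, 0 < k ∧ (f ^ k) (ι e) = ι (g e) ∧ ∀ j, 0 < j → j < k → (f ^ j) (ι e) ∉ Set.range ι

/-- An orbit of `f` meets the image of `ι` exactly along an orbit of `g`; strong induction on the
number of steps of `f` removes one return at a time. -/
theorem IsFirstReturn.sameCycle_iff [Finite D] {f : Perm D} {g : Perm E} {ι : E → D}
    (h : IsFirstReturn f g ι) (hι : Function.Injective ι) (e e' : E) :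
    f.SameCycle (ι e) (ι e') ↔ g.SameCycle e e' := by
  have : Finite E := Finite.of_injective ι hι
  constructor
  · intro hs
    obtain ⟨m, hm⟩ := hs.exists_nat_pow_eq
    induction m using Nat.strong_induction_on generalizing e with
    | _ m ih =>
      obtain ⟨k, hk, hk', hj⟩ := h e
      rcases Nat.eq_zero_or_pos m with rfl | hmpos
      · obtain rfl : e = e' := hι (by simpa using hm)
        exact Perm.SameCycle.rfl
      rcases lt_or_ge m k with hlt | hge
      · exact absurd ⟨e', hm.symm⟩ (hj m hmpos hlt)
      · have h2 : (f ^ (m - k)) (ι (g e)) = ι e' := by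
          rw [← hk', ← Perm.mul_apply, ← pow_add, Nat.sub_add_cancel hge, hm]
        have := ih (m - k) (by omega) (g e) ⟨(m - k : ℕ), by simpa using h2⟩ h2
        exact Perm.sameCycle_apply_left.1 this
  · intro hs
    obtain ⟨m, rfl⟩ := hs.exists_nat_pow_eq
    clear hs
    induction m with
    | zero => exact Perm.SameCycle.rfl
    | succ m ih =>
      refine ih.trans ?_
      obtain ⟨k, -, hk', -⟩ := h ((g ^ m) e)
      rw [pow_succ', Perm.mul_apply, ← hk']
      exact Perm.sameCycle_pow_right.2 Perm.SameCycle.rfl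

/-- The extra cycle is the one through `d₀`, the only one that avoids the image of `ι`. It will be a
newly attached leaf, or the additional vertex of a quadrangulation. -/
theorem IsFirstReturn.cycleCount_eq [Finite D] {f : Perm D} {g : Perm E} {ι : E → D}
    (h : IsFirstReturn f g ι) (hι : Function.Injective ι) (d₀ : D)
    (h₀ : ∀ e, ¬ f.SameCycle d₀ (ι e)) (h₁ : ∀ d, f.SameCycle d₀ d ∨ ∃ e, f.SameCycle d (ι e)) :
    cycleCount f = cycleCount g + 1 := by
  have : Finite E := Finite.of_injective ι hι
  have : Finite (Quotient (Perm.SameCycle.setoid g)) := Quotient.finite _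
  let F : Option (Quotient (Perm.SameCycle.setoid g)) → Quotient (Perm.SameCycle.setoid f) :=
    fun o => o.elim (Quotient.mk _ d₀) (Quotient.map' ι fun a b hab =>
      (h.sameCycle_iff hι a b).2 hab)
  have hF : Function.Bijective F := by
    constructor
    · rintro (_ | a) (_ | b) hab
      · rfl
      · induction b using Quotient.inductionOn
        exact absurd (Quotient.exact hab) (h₀ _)
      · induction a using Quotient.inductionOn
        exact absurd (Quotient.exact hab.symm) (h₀ _)
      · induction a using Quotient.inductionOn
        induction b using Quotient.inductionOn
        exact congrArg some (Quotient.sound ((h.sameCycle_iff hι _ _).1 (Quotient.exact hab)))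
    · intro q
      induction q using Quotient.inductionOn with
      | _ d =>
        rcases h₁ d with hd | ⟨e, he⟩
        · exact ⟨none, Quotient.sound hd⟩
        · exact ⟨some (Quotient.mk _ e), Quotient.sound he.symm⟩
  rw [cycleCount, ← Nat.card_eq_of_bijective F hF, Finite.card_option, cycleCount]

theorem cycleCount_eq_of_semiconj {f : Perm D} {g : Perm E} (e : D ≃ E)
    (h : ∀ d, e (f d) = g (e d)) : cycleCount f = cycleCount g := by
  have hz : ∀ (i : ℤ) d, e ((f ^ i) d) = (g ^ i) (e d) := by
    have hg : g = e.permCongr f := by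
      ext x
      simp [Equiv.permCongr_apply, h]
    have : ∀ i : ℤ, g ^ i = e.permCongr (f ^ i) := by
      intro i
      rw [hg]
      exact (map_zpow (Equiv.permCongrHom e) f i).symm
    intro i d
    simp [this, Equiv.permCongr_apply]
  refine Nat.card_congr (Quotient.congr e fun a b => ?_)
  constructor
  · rintro ⟨i, hi⟩
    exact ⟨i, by rw [← hz, hi]⟩
  · rintro ⟨i, hi⟩
    exact ⟨i, e.injective (by rw [hz, hi])⟩

theorem cycleCount_inv (f : Perm D) : cycleCount f⁻¹ = cycleCount f :=
  Nat.card_congr (Quotient.congr (Equiv.refl D) fun _ _ => Perm.sameCycle_inv)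

end CycleCount

/-! ### Polygons with glued sides and labelled corners -/

section Gluing

variable {D E : Type*}

/-- A labelled gluing: the sides `d` of a polygon with next-side permutation `τ` are glued in pairs
by `α`, and `l d` is the label of the origin of `d`; labels differ at most by one along
each side. -/
structure IsLabelledGluing (τ α : Perm D) (l : D → ℤ) : Prop where
  invol : ∀ d, α (α d) = d
  ne : ∀ d, α d ≠ d
  next : ∀ d, l (τ d) = l (α d)
  edge : ∀ d, |l (α d) - l d| ≤ 1

theorem IsLabelledGluing.of_semiconj {τ α : Perm D} {l : D → ℤ} {τ' α' : Perm E} {l' : E → ℤ}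
    (h : IsLabelledGluing τ α l) (e : D ≃ E) (hτ : ∀ d, e (τ d) = τ' (e d))
    (hα : ∀ d, e (α d) = α' (e d)) (c : ℤ) (hl : ∀ d, l' (e d) = l d + c) :
    IsLabelledGluing τ' α' l' where
  invol x := by
    obtain ⟨d, rfl⟩ := e.surjective x
    rw [← hα, ← hα, h.invol]
  ne x := by
    obtain ⟨d, rfl⟩ := e.surjective x
    rw [← hα]
    exact fun he => h.ne d (e.injective he)
  next x := by
    obtain ⟨d, rfl⟩ := e.surjective x
    rw [← hα, ← hτ, hl, hl, h.next]
  edge x := by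
    obtain ⟨d, rfl⟩ := e.surjective x
    rw [← hα, hl, hl]
    simpa using h.edge d

/-- Rooted labelled one-face maps of genus one with `n` edges, in canonical form: the sides of the
face are numbered along its border, starting from the root. -/
def oneTrees (n : ℕ) : Set (Perm (Fin (2 * n)) × (Fin (2 * n) → ℤ)) :=
  {p | IsLabelledGluing (finRotate (2 * n)) p.1 p.2 ∧ (∀ d, d.val = 0 → p.2 d = 1) ∧
    cycleCount (finRotate (2 * n) * p.1) + 1 = n}

theorem finRotate_mk {N k : ℕ} (h : k + 1 < N) :
    finRotate N ⟨k, by omega⟩ = ⟨k + 1, h⟩ := by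
  obtain ⟨m, rfl⟩ : ∃ m, N = m + 1 := ⟨N - 1, by omega⟩
  exact finRotate_of_lt (by omega)

theorem finRotate_mk_last {N k : ℕ} (h : k + 1 = N) :
    finRotate N ⟨k, by omega⟩ = ⟨0, by omega⟩ := by
  subst h
  exact finRotate_last'

/-- Consecutive sides have labels at most one apart and side 0 has label 1, so all labels lie in a
bounded interval. -/
theorem oneTrees_finite (n : ℕ) : (oneTrees n).Finite := by
  have h : (oneTrees n) ⊆ Set.univ ×ˢ
      (Set.pi Set.univ fun _ : Fin (2 * n) => Set.Icc (1 - 2 * n : ℤ) (1 + 2 * n)) := by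
    rintro ⟨α, l⟩ ⟨hg, h0, -⟩
    refine ⟨trivial, ?_⟩
    have key : ∀ k (hk : k < 2 * n), |l ⟨k, hk⟩ - 1| ≤ k := by
      intro k
      induction k with
      | zero =>
        intro hk
        have h1 : l ⟨0, hk⟩ = 1 := h0 ⟨0, hk⟩ rfl
        simp [h1]
      | succ k ih =>
        intro hk
        have h1 := ih (by omega)
        have h2 := finRotate_mk hk
        have h3 := hg.next ⟨k, by omega⟩
        have h4 := hg.edge ⟨k, by omega⟩
        rw [← h3, h2] at h4
        simp only at h4
        rw [abs_le] at *
        push_cast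
        constructor <;> linarith
    intro d _
    have h1 := key d d.2
    rw [abs_le] at h1
    have h2 : (d : ℤ) < 2 * n := by exact_mod_cast d.2
    simp only [Set.mem_Icc]
    constructor <;> linarith
  refine Set.Finite.subset (Set.Finite.prod Set.finite_univ ?_) h
  exact Set.Finite.pi fun _ => Set.finite_Icc _ _

/-- The powers of `τ` applied to `r` enumerate the set. This numbers the sides of a one-face map
along its border, from the root. -/
theorem exists_equiv_finRotate [Fintype D] (τ : Perm D) (hτ : ∀ a b, τ.SameCycle a b) (r : D)
    {N : ℕ} (hN : Fintype.card D = N) (h : 0 < N) :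
    ∃ e : Fin N ≃ D, (∀ i, e (finRotate N i) = τ (e i)) ∧ e ⟨0, h⟩ = r := by
  obtain ⟨m, rfl⟩ : ∃ m, N = m + 1 := ⟨N - 1, by omega⟩
  have hc : τ.IsCycleOn (Finset.univ : Finset D) :=
    ⟨by simp [Set.bijOn_univ], fun a _ b _ => hτ a b⟩
  let f : Fin (m + 1) → D := fun i => (τ ^ (i : ℕ)) r
  have hf : Function.Surjective f := by
    intro d
    obtain ⟨i, hi, rfl⟩ := hc.exists_pow_eq (Finset.mem_univ r) (Finset.mem_univ d)
    rw [Finset.card_univ, hN] at hi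
    exact ⟨⟨i, hi⟩, rfl⟩
  have hb : Function.Bijective f :=
    (Fintype.bijective_iff_surjective_and_card f).2 ⟨hf, by simp [hN]⟩
  refine ⟨Equiv.ofBijective f hb, fun i => ?_, by simp [f]⟩
  simp only [Equiv.ofBijective_apply, f, coe_finRotate]
  split_ifs with hi
  · have := hc.pow_card_apply (Finset.mem_univ r)
    rw [Finset.card_univ, hN, pow_succ', Perm.mul_apply] at this
    simpa [hi] using this.symm
  · rw [pow_succ', Perm.mul_apply]

theorem finRotate_sameCycle {N : ℕ} (a b : Fin N) : (finRotate N).SameCycle a b := by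
  obtain ⟨m, rfl⟩ : ∃ m, N = m + 1 := ⟨N - 1, by have := a.2; omega⟩
  have h : ∀ b : Fin (m + 1), (finRotate (m + 1)).SameCycle 0 b := by
    intro b
    induction b using Fin.induction with
    | zero => exact Perm.SameCycle.rfl
    | succ i ih =>
      have : finRotate (m + 1) i.castSucc = i.succ := by simp
      rw [← this]
      exact Perm.sameCycle_apply_right.2 ih
  exact (h a).symm.trans (h b)

/-- Maps that commute with transitive permutations and agree at one point are equal. -/
theorem eq_of_semiconj [Finite D] {τ : Perm D} {τ' : Perm E} (hτ : ∀ a b, τ.SameCycle a b)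
    {f g : D → E} (hf : ∀ d, f (τ d) = τ' (f d)) (hg : ∀ d, g (τ d) = τ' (g d)) {r : D}
    (h : f r = g r) : f = g := by
  funext d
  obtain ⟨k, rfl⟩ := (hτ r d).exists_nat_pow_eq
  induction k with
  | zero => exact h
  | succ k ih => rw [pow_succ', Perm.mul_apply, hf, hg, ih]

end Gluing

/-! ### Canonical forms of rooted one-face maps -/

section CanonicalForm

variable {n : ℕ}

/-- Rigidity of rooted maps: the arcs are one orbit of the group generated by `σ` and `α`, so the
image of the root decides all others. -/
theorem IsRootedIso.eq_of_apply_eq {M N : RootedMap n} {π ρ : Perm (Fin (2 * n))}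
    (h : IsRootedIso M N π) (k : IsRootedIso M N ρ) : π = ρ := by
  ext1 d
  obtain ⟨g, hg, rfl⟩ := M.connected M.root d
  have key : ∀ g ∈ Subgroup.closure {M.σ, M.α}, ∀ d, π d = ρ d → π (g d) = ρ (g d) := by
    intro g hg
    induction hg using Subgroup.closure_induction with
    | mem x hx =>
      rcases hx with rfl | rfl
      · intro d hd; rw [h.1, k.1, hd]
      · intro d hd; rw [h.2.1, k.2.1, hd]
    | one => intro d hd; exact hd
    | mul x y _ _ hx hy => intro d hd; exact hx _ (hy _ hd)
    | inv x _ hx =>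
      intro d hd
      have hper : ∀ m : ℕ, π ((x ^ m) d) = ρ ((x ^ m) d) := by
        intro m
        induction m with
        | zero => exact hd
        | succ m ih => rw [pow_succ', Perm.mul_apply]; exact hx _ ih
      -- In a finite group the inverse is a nonnegative power, for which the induction hypothesis
      -- can be iterated.
      obtain ⟨m, hm⟩ : ∃ m : ℕ, x⁻¹ = x ^ m := by
        refine ⟨orderOf x - 1, ?_⟩
        rw [inv_eq_iff_mul_eq_one, ← pow_succ', Nat.sub_add_cancel (orderOf_pos x),
          pow_orderOf_eq_one]
      rw [hm]; exact hper m
  exact key g hg _ (h.2.2.trans k.2.2.symm)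

theorem mem_closure_mul_pair {G : Type*} [Group G] (a b : G) :
    a ∈ Subgroup.closure {a * b, b} := by
  have h1 : a * b ∈ Subgroup.closure {a * b, b} := Subgroup.subset_closure (Set.mem_insert _ _)
  have h2 : b ∈ Subgroup.closure {a * b, b} :=
    Subgroup.subset_closure (Set.mem_insert_of_mem _ rfl)
  simpa using mul_mem h1 (inv_mem h2)

/-- The embedded rooted map with a canonical form. -/
def ofGluing (p : Perm (Fin (2 * n)) × (Fin (2 * n) → ℤ))
    (hg : IsLabelledGluing (finRotate (2 * n)) p.1 p.2) (h0 : ∀ d, d.val = 0 → p.2 d = 1)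
    (hn : 0 < n) : EmbeddedMap n where
  σ := finRotate (2 * n) * p.1
  α := p.1
  α_invol := hg.invol
  α_ne := hg.ne
  connected d e := by
    obtain ⟨i, hi⟩ := finRotate_sameCycle d e
    exact ⟨_, Subgroup.zpow_mem _ (mem_closure_mul_pair _ _) i, hi⟩
  root := ⟨0, by omega⟩
  label := p.2
  label_vertex d := by rw [Perm.mul_apply, hg.next, hg.invol]
  label_edge := hg.edge
  label_root := h0 _ rfl

theorem ofGluing_φ (p : Perm (Fin (2 * n)) × (Fin (2 * n) → ℤ)) (hg h0 hn) :
    (ofGluing p hg h0 hn).φ = finRotate (2 * n) := by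
  ext1 d
  simp [CMap.φ, ofGluing, hg.invol]

theorem CMap.vertexDegree_eq_one_iff (M : CMap n) (d : Fin (2 * n)) :
    M.vertexDegree d = 1 ↔ M.σ d = d := by
  unfold CMap.vertexDegree
  rw [Nat.card_eq_one_iff_unique]
  constructor
  · rintro ⟨h, -⟩
    have := h.elim ⟨M.σ d, Perm.sameCycle_apply_right.2 Perm.SameCycle.rfl⟩ ⟨d, Perm.SameCycle.rfl⟩
    exact congrArg Subtype.val this
  · intro h
    have key : ∀ e : {e // M.σ.SameCycle d e}, e = ⟨d, Perm.SameCycle.rfl⟩ := fun e =>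
      Subtype.ext (e.2.eq_of_left h).symm
    exact ⟨⟨fun a b => (key a).trans (key b).symm⟩, ⟨⟨d, Perm.SameCycle.rfl⟩⟩⟩

theorem card_quotient_sameCycle_eq_one_iff {D : Type*} (f : Perm D) [Nonempty D] :
    Nat.card (Quotient (Perm.SameCycle.setoid f)) = 1 ↔ ∀ a b, f.SameCycle a b := by
  rw [Nat.card_eq_one_iff_unique]
  constructor
  · rintro ⟨h, -⟩ a b
    exact Quotient.exact (h.elim (Quotient.mk _ a) (Quotient.mk _ b))
  · intro h
    refine ⟨⟨fun a b => ?_⟩, ⟨Quotient.mk _ (Classical.arbitrary D)⟩⟩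
    induction a using Quotient.inductionOn
    induction b using Quotient.inductionOn
    exact Quotient.sound (h _ _)

/-- Each rooted one-face map has exactly one numbering in which the face permutation is the rotation
and the root is 0. Leaves are then the fixed points of `τ * α`, and genus one means `n - 1`
vertices. -/
theorem reducedTreeCount_eq (n : ℕ) : reducedTreeCount 1 n =
    Nat.card {p : oneTrees n // ∀ d, finRotate (2 * n) (p.1.1 d) ≠ d} := by
  rcases Nat.eq_zero_or_pos n with rfl | hn
  · have h1 : IsEmpty (EmbeddedMap 0) := ⟨fun M => M.root.elim0⟩
    have h2 : IsEmpty (oneTrees 0) := ⟨fun p => absurd p.2.2.2 (by simp)⟩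
    simp [reducedTreeCount, Set.eq_empty_of_isEmpty]
  have : Nonempty (Fin (2 * n)) := ⟨⟨0, by omega⟩⟩
  let F : {p : oneTrees n // ∀ d, finRotate (2 * n) (p.1.1 d) ≠ d} → Quotient (embeddedSetoid n) :=
    fun p => Quotient.mk _ (ofGluing p.1.1 p.1.2.1 p.1.2.2.1 hn)
  have hinj : Function.Injective F := by
    rintro ⟨⟨⟨α, l⟩, hp⟩, hp'⟩ ⟨⟨⟨α', l'⟩, hq⟩, hq'⟩ h
    obtain ⟨π, ⟨h1, h2, h3⟩, h4⟩ := Quotient.exact h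
    -- The isomorphism commutes with the rotation, which is the face permutation of both maps, and
    -- fixes side 0.
    have hπ : (π : Fin (2 * n) → Fin (2 * n)) = id := by
      refine eq_of_semiconj (τ := finRotate (2 * n)) (τ' := finRotate (2 * n)) finRotate_sameCycle
        (fun d => ?_) (fun d => rfl) (r := ⟨0, by omega⟩) h3
      have := h1 (α d)
      rw [show π (α d) = α' (π d) from h2 d] at this
      simp only [ofGluing, Perm.mul_apply, hp.1.invol, hq.1.invol] at this
      exact this
    have e1 : α = α' := by
      ext1 d
      have := h2 d
      simpa [hπ, ofGluing] using this
    have e2 : l = l' := by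
      funext d
      have := h4 d
      simpa [hπ, ofGluing] using this.symm
    subst e1 e2
    rfl
  have hrange : Set.range F = Quotient.mk (embeddedSetoid n) '' {M | M.IsTree 1 ∧ M.IsReduced} := by
    ext q
    constructor
    · rintro ⟨⟨⟨p, hp⟩, hp'⟩, rfl⟩
      refine ⟨_, ⟨⟨?_, ?_⟩, ?_⟩, rfl⟩
      · have h1 := hp.2.2
        have h2 : Nat.card (ofGluing p hp.1 hp.2.1 hn).Face = 1 := by
          unfold CMap.Face
          rw [ofGluing_φ, card_quotient_sameCycle_eq_one_iff]
          exact finRotate_sameCycle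
        have h3 : Nat.card (ofGluing p hp.1 hp.2.1 hn).Vertex + 1 = n := h1
        unfold CMap.HasGenus
        rw [h2]
        push_cast
        omega
      · unfold CMap.Face
        rw [ofGluing_φ, card_quotient_sameCycle_eq_one_iff]
        exact finRotate_sameCycle
      · intro d
        rw [Ne, CMap.vertexDegree_eq_one_iff]
        exact hp' d
    · rintro ⟨M, ⟨⟨hgen, hface⟩, hred⟩, rfl⟩
      have hφ := (card_quotient_sameCycle_eq_one_iff M.φ).1 hface
      obtain ⟨e, he, he0⟩ := exists_equiv_finRotate M.φ hφ M.root (Fintype.card_fin _) (by omega)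
      have hM : IsLabelledGluing M.φ M.α M.label :=
        { invol := M.α_invol
          ne := M.α_ne
          next := fun d => by rw [CMap.φ, Perm.mul_apply, M.label_vertex]
          edge := M.label_edge }
      let α : Perm (Fin (2 * n)) := e.symm.permCongr M.α
      have hα : ∀ d, e (α d) = M.α (e d) := fun d => by simp [α]
      have hσ : ∀ d, e ((finRotate (2 * n) * α) d) = M.σ (e d) := fun d => by
        rw [Perm.mul_apply, he, hα, CMap.φ, Perm.mul_apply, M.α_invol]
      have hG : IsLabelledGluing (finRotate (2 * n)) α (M.label ∘ e) :=
        hM.of_semiconj e.symm (fun d => by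
          rw [Equiv.symm_apply_eq, he, Equiv.apply_symm_apply]) (fun d => by
          rw [Equiv.symm_apply_eq, hα, Equiv.apply_symm_apply]) 0 (fun d => by simp)
      have h0 : ∀ d : Fin (2 * n), d.val = 0 → (M.label ∘ e) d = 1 := by
        intro d hd
        have hd' : d = ⟨0, by omega⟩ := Fin.ext hd
        simp [hd', he0, M.label_root]
      have hc : cycleCount (finRotate (2 * n) * α) + 1 = n := by
        rw [cycleCount_eq_of_semiconj e hσ]
        have h3 : cycleCount M.σ = Nat.card M.Vertex := rfl
        unfold CMap.HasGenus at hgen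
        rw [hface] at hgen
        push_cast at hgen
        omega
      refine ⟨⟨⟨(α, M.label ∘ e), hG, h0, hc⟩, fun d hd => ?_⟩, Quotient.sound ⟨e, ⟨hσ, hα, he0⟩,
        fun d => rfl⟩⟩
      refine hred (e d) ((CMap.vertexDegree_eq_one_iff _ _).2 ?_)
      rw [← hσ]
      exact congrArg e hd
  rw [reducedTreeCount, ← hrange, ← Set.image_univ, Set.ncard_image_of_injective _ hinj,
    Set.ncard_univ]

end CanonicalForm

theorem perm_apply_inv_self {D : Type*} (f : Perm D) (d : D) : f (f⁻¹ d) = d := by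
  rw [← Perm.mul_apply, mul_inv_cancel, Perm.one_apply]

/-! ### Rerooting -/

section Rerooting

variable {n : ℕ}

theorem commute_finRotate_zpow (N : ℕ) (i : ℤ) (d : Fin N) :
    (finRotate N ^ i) (finRotate N d) = finRotate N ((finRotate N ^ i) d) := by
  rw [← Perm.mul_apply, ← Perm.mul_apply, ← zpow_add_one, ← zpow_one_add, add_comm]

/-- Renumbering of the sides by a power of the rotation. -/
def rotate (i : ℤ) (p : Perm (Fin (2 * n)) × (Fin (2 * n) → ℤ)) :
    Perm (Fin (2 * n)) × (Fin (2 * n) → ℤ) :=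
  ((finRotate (2 * n) ^ i)⁻¹ * p.1 * finRotate (2 * n) ^ i,
    fun d => p.2 ((finRotate (2 * n) ^ i) d) -
      p.2 ((finRotate (2 * n) ^ i) ⟨0, lt_of_le_of_lt (Nat.zero_le _) d.2⟩) + 1)

theorem rotate_mem {p : Perm (Fin (2 * n)) × (Fin (2 * n) → ℤ)} (hp : p ∈ oneTrees n) (i : ℤ) :
    rotate i p ∈ oneTrees n := by
  have hn : 0 < 2 * n := by
    have := hp.2.2
    omega
  refine ⟨?_, fun d hd => ?_, ?_⟩
  · refine hp.1.of_semiconj (finRotate (2 * n) ^ i)⁻¹ (fun d => ?_) (fun d => ?_)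
      (1 - p.2 ((finRotate (2 * n) ^ i) ⟨0, hn⟩)) (fun d => ?_)
    · rw [← zpow_neg, commute_finRotate_zpow]
    · simp [rotate]
    · simp only [rotate, perm_apply_inv_self]
      ring
  · have hd' : d = ⟨0, hn⟩ := Fin.ext hd
    simp [rotate, hd']
  · refine Eq.trans (congrArg (· + 1) ?_) hp.2.2
    refine cycleCount_eq_of_semiconj (finRotate (2 * n) ^ i) fun d => ?_
    simp only [rotate, Perm.mul_apply]
    rw [commute_finRotate_zpow, perm_apply_inv_self]

theorem rotate_neg_rotate {p : Perm (Fin (2 * n)) × (Fin (2 * n) → ℤ)} (hp : p ∈ oneTrees n)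
    (i : ℤ) : rotate (-i) (rotate i p) = p := by
  have hn : 0 < 2 * n := by
    have := hp.2.2
    omega
  refine Prod.ext ?_ ?_
  · simp only [rotate, zpow_neg]
    group
  · funext d
    have h0 : p.2 ⟨0, hn⟩ = 1 := hp.2.1 _ rfl
    simp [rotate, zpow_neg, h0]

/-- The finite set of canonical forms. -/
noncomputable def oneTreeFinset (n : ℕ) : Finset (Perm (Fin (2 * n)) × (Fin (2 * n) → ℤ)) :=
  (oneTrees_finite n).toFinset

@[simp]
theorem mem_oneTreeFinset {p : Perm (Fin (2 * n)) × (Fin (2 * n) → ℤ)} :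
    p ∈ oneTreeFinset n ↔ p ∈ oneTrees n := Set.Finite.mem_toFinset _

/-- Rerooting: a weight that only depends on the gluing seen from a side has the same total
for all sides. -/
theorem sum_rotate {R : Type*} [AddCommMonoid R] (w : Perm (Fin (2 * n)) → Fin (2 * n) → R)
    (hw : ∀ (i : ℤ) α d, w ((finRotate (2 * n) ^ i)⁻¹ * α * finRotate (2 * n) ^ i) d =
      w α ((finRotate (2 * n) ^ i) d)) (a b : Fin (2 * n)) :
    ∑ p ∈ oneTreeFinset n, w p.1 a = ∑ p ∈ oneTreeFinset n, w p.1 b := by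
  obtain ⟨i, hi⟩ := finRotate_sameCycle b a
  refine Finset.sum_nbij' (rotate i) (rotate (-i)) ?_ ?_ ?_ ?_ ?_
  · intro p hp
    simpa using rotate_mem (by simpa using hp) i
  · intro p hp
    simpa using rotate_mem (by simpa using hp) (-i)
  · intro p hp
    exact rotate_neg_rotate (by simpa using hp) i
  · intro p hp
    simpa using rotate_neg_rotate (show p ∈ oneTrees n by simpa using hp) (-i)
  · intro p hp
    simp only [rotate, hw, hi]

/-- Double counting that trades a marked side, at a leaf or at a branch corner, for a prescribed
position relative to the root. -/
theorem sum_sum_rotate {R : Type*} [AddCommMonoid R] (w : Perm (Fin (2 * n)) → Fin (2 * n) → R)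
    (hw : ∀ (i : ℤ) α d, w ((finRotate (2 * n) ^ i)⁻¹ * α * finRotate (2 * n) ^ i) d =
      w α ((finRotate (2 * n) ^ i) d)) (a : Fin (2 * n)) :
    ∑ p ∈ oneTreeFinset n, ∑ d, w p.1 d = (2 * n) • ∑ p ∈ oneTreeFinset n, w p.1 a := by
  rw [Finset.sum_comm, Finset.sum_congr rfl fun d _ => sum_rotate w hw d a]
  simp

end Rerooting

/-! ### Attaching and removing a leaf -/

section Leaves

variable {N : ℕ}

/-- The number of leaves: of arcs whose origin has degree one. -/
def leafCount (α : Perm (Fin N)) : ℕ :=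
  (Finset.univ.filter fun d => finRotate N (α d) = d).card

theorem isLeaf_rotate_iff (i : ℤ) (α : Perm (Fin N)) (d : Fin N) :
    finRotate N (((finRotate N ^ i)⁻¹ * α * finRotate N ^ i) d) = d ↔
      finRotate N (α ((finRotate N ^ i) d)) = (finRotate N ^ i) d := by
  simp only [Perm.mul_apply]
  rw [← (finRotate N ^ i).injective.eq_iff, commute_finRotate_zpow, perm_apply_inv_self]

theorem leafCount_rotate (i : ℤ) (α : Perm (Fin N)) :
    leafCount ((finRotate N ^ i)⁻¹ * α * finRotate N ^ i) = leafCount α := by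
  refine Finset.card_bij (fun d _ => (finRotate N ^ i) d) ?_ ?_ ?_
  · intro d hd
    rw [Finset.mem_filter, isLeaf_rotate_iff] at hd
    exact Finset.mem_filter.2 ⟨Finset.mem_univ _, hd.2⟩
  · intro a _ b _ h
    exact (finRotate N ^ i).injective h
  · intro b hb
    refine ⟨(finRotate N ^ i)⁻¹ b, ?_, perm_apply_inv_self _ _⟩
    rw [Finset.mem_filter, isLeaf_rotate_iff, perm_apply_inv_self]
    exact ⟨Finset.mem_univ _, (Finset.mem_filter.1 hb).2⟩

/-- Gluing a new edge, with a leaf at its end, at the last corner. -/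
def addLeaf (α : Perm (Fin N)) : Perm (Fin (N + 2)) :=
  finSumFinEquiv.permCongr (Perm.sumCongr α (swap 0 1))

@[simp]
theorem addLeaf_castAdd (α : Perm (Fin N)) (x : Fin N) :
    addLeaf α (Fin.castAdd 2 x) = Fin.castAdd 2 (α x) := by
  simp [addLeaf, Equiv.permCongr_apply]

@[simp]
theorem addLeaf_natAdd_zero (α : Perm (Fin N)) :
    addLeaf α (Fin.natAdd N 0) = Fin.natAdd N 1 := by
  simp [addLeaf, Equiv.permCongr_apply, -Fin.natAdd_zero]

@[simp]
theorem addLeaf_natAdd_one (α : Perm (Fin N)) :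
    addLeaf α (Fin.natAdd N 1) = Fin.natAdd N 0 := by
  simp [addLeaf, Equiv.permCongr_apply, -Fin.natAdd_zero]

theorem finRotate_castAdd_of_lt {x : Fin N} (h : x.val + 1 < N) :
    finRotate (N + 2) (Fin.castAdd 2 x) = Fin.castAdd 2 (finRotate N x) := by
  have h1 := finRotate_mk (N := N + 2) (k := x) (by omega)
  have h2 := finRotate_mk h
  rw [Fin.eta] at h2
  rw [h2]
  exact h1

theorem finRotate_castAdd_of_eq {x : Fin N} (h : x.val + 1 = N) :
    finRotate (N + 2) (Fin.castAdd 2 x) = Fin.natAdd N 0 := by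
  have h1 := finRotate_mk (N := N + 2) (k := x) (by omega)
  refine h1.trans (Fin.ext ?_)
  simp [h]

theorem finRotate_natAdd_zero : finRotate (N + 2) (Fin.natAdd N 0) = Fin.natAdd N 1 :=
  finRotate_mk (N := N + 2) (k := N) (by omega)

theorem finRotate_natAdd_one (h : 0 < N) :
    finRotate (N + 2) (Fin.natAdd N 1) = Fin.castAdd 2 ⟨0, h⟩ :=
  finRotate_mk_last (N := N + 2) (k := N + 1) (by omega)

theorem finRotate_of_eq (h : 0 < N) {x : Fin N} (hx : x.val + 1 = N) :
    finRotate N x = ⟨0, h⟩ := finRotate_mk_last hx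

theorem forall_fin_add_two {P : Fin (N + 2) → Prop} :
    (∀ d, P d) ↔ (∀ x : Fin N, P (Fin.castAdd 2 x)) ∧ P (Fin.natAdd N 0) ∧ P (Fin.natAdd N 1) := by
  refine ⟨fun h => ⟨fun x => h _, h _, h _⟩, fun h d => ?_⟩
  refine Fin.addCases (fun x => h.1 x) (fun i => ?_) d
  fin_cases i
  · exact h.2.1
  · exact h.2.2

theorem castAdd_ne_natAdd (x : Fin N) (i : Fin 2) : Fin.castAdd 2 x ≠ Fin.natAdd N i := by
  intro h
  have := congrArg Fin.val h
  simp at this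
  omega

theorem natAdd_zero_ne_one : (Fin.natAdd N 0 : Fin (N + 2)) ≠ Fin.natAdd N 1 := by
  intro h
  have := congrArg Fin.val h
  simp at this

/-- The new sides come just before side 0. Side `N` starts at the root vertex, which forces its
label, and side `N + 1` starts at the leaf, whose label only has to be within one of it: three
choices. -/
theorem isLabelledGluing_addLeaf_iff (hN : 0 < N) (α : Perm (Fin N)) (l : Fin N → ℤ)
    (h0 : l ⟨0, hN⟩ = 1) (a b : ℤ) :
    IsLabelledGluing (finRotate (N + 2)) (addLeaf α) (Fin.append l ![a, b]) ↔
      IsLabelledGluing (finRotate N) α l ∧ a = 1 ∧ |b - 1| ≤ 1 := by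
  have ea : Fin.append l ![a, b] (Fin.natAdd N 0) = a := Fin.append_right _ _ _
  have eb : Fin.append l ![a, b] (Fin.natAdd N 1) = b := Fin.append_right _ _ _
  have ec : ∀ x, Fin.append l ![a, b] (Fin.castAdd 2 x) = l x := Fin.append_left _ _
  constructor
  · intro h
    have h1 := h.next (Fin.natAdd N 1)
    rw [finRotate_natAdd_one hN, addLeaf_natAdd_one, ec, h0, ea] at h1
    refine ⟨⟨fun d => ?_, fun d hd => ?_, fun d => ?_, fun d => ?_⟩, h1.symm, ?_⟩
    · have := h.invol (Fin.castAdd 2 d)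
      simpa using this
    · exact h.ne (Fin.castAdd 2 d) (by simp [hd])
    · have := h.next (Fin.castAdd 2 d)
      rw [addLeaf_castAdd, ec] at this
      rcases Nat.lt_or_ge (d.val + 1) N with hd | hd
      · rwa [finRotate_castAdd_of_lt hd, ec] at this
      · rw [finRotate_castAdd_of_eq (by omega), ea] at this
        rw [finRotate_of_eq hN (by omega), h0, ← this, h1]
    · have := h.edge (Fin.castAdd 2 d)
      rwa [addLeaf_castAdd, ec, ec] at this
    · have := h.edge (Fin.natAdd N 0)
      rwa [addLeaf_natAdd_zero, ea, eb, ← h1] at this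
  · rintro ⟨h, rfl, hb⟩
    refine ⟨?_, ?_, ?_, ?_⟩ <;> rw [forall_fin_add_two]
    · refine ⟨fun x => ?_, ?_, ?_⟩
      · simp [h.invol]
      · rw [addLeaf_natAdd_zero, addLeaf_natAdd_one]
      · rw [addLeaf_natAdd_one, addLeaf_natAdd_zero]
    · refine ⟨fun x hx => ?_, ?_, ?_⟩
      · rw [addLeaf_castAdd] at hx
        exact h.ne x (Fin.castAdd_injective _ _ hx)
      · rw [addLeaf_natAdd_zero]
        exact natAdd_zero_ne_one.symm
      · rw [addLeaf_natAdd_one]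
        exact natAdd_zero_ne_one
    · refine ⟨fun x => ?_, ?_, ?_⟩
      · rw [addLeaf_castAdd, ec]
        rcases Nat.lt_or_ge (x.val + 1) N with hd | hd
        · rw [finRotate_castAdd_of_lt hd, ec, h.next]
        · rw [finRotate_castAdd_of_eq (by omega), ea, ← h.next, finRotate_of_eq hN (by omega), h0]
      · rw [finRotate_natAdd_zero, addLeaf_natAdd_zero]
      · rw [finRotate_natAdd_one hN, addLeaf_natAdd_one, ec, ea, h0]
    · refine ⟨fun x => ?_, ?_, ?_⟩
      · rw [addLeaf_castAdd, ec, ec]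
        exact h.edge x
      · rwa [addLeaf_natAdd_zero, ea, eb]
      · rwa [addLeaf_natAdd_one, ea, eb, abs_sub_comm]

/-- The leaf `N + 1` is a fixed point. Side `N` is merely one more arc at the root vertex, which the
first-return map to the old sides skips. -/
theorem cycleCount_addLeaf (hN : 0 < N) (α : Perm (Fin N)) :
    cycleCount (finRotate (N + 2) * addLeaf α) = cycleCount (finRotate N * α) + 1 := by
  have h00 : (finRotate (N + 2) * addLeaf α) (Fin.natAdd N 0) = Fin.castAdd 2 ⟨0, hN⟩ := by
    rw [Perm.mul_apply, addLeaf_natAdd_zero, finRotate_natAdd_one hN]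
  have h11 : (finRotate (N + 2) * addLeaf α) (Fin.natAdd N 1) = Fin.natAdd N 1 := by
    rw [Perm.mul_apply, addLeaf_natAdd_one, finRotate_natAdd_zero]
  refine IsFirstReturn.cycleCount_eq (ι := Fin.castAdd 2) (fun x => ?_)
    (Fin.castAdd_injective _ _) (Fin.natAdd N 1) (fun e he => ?_) ?_
  · rcases Nat.lt_or_ge ((α x).val + 1) N with hd | hd
    · refine ⟨1, one_pos, ?_, fun j h1 h2 => by omega⟩
      simp only [pow_one, Perm.mul_apply, addLeaf_castAdd, finRotate_castAdd_of_lt hd]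
    · have h : (finRotate (N + 2) * addLeaf α) (Fin.castAdd 2 x) = Fin.natAdd N 0 := by
        rw [Perm.mul_apply, addLeaf_castAdd, finRotate_castAdd_of_eq (by omega)]
      refine ⟨2, two_pos, ?_, fun j h1 h2 => ?_⟩
      · rw [pow_two, Perm.mul_apply, h, h00, Perm.mul_apply, finRotate_of_eq hN (by omega)]
      · obtain rfl : j = 1 := by omega
        rw [pow_one, h]
        rintro ⟨e, he⟩
        exact castAdd_ne_natAdd _ _ he
  · exact castAdd_ne_natAdd _ _ (he.eq_of_left h11).symm
  · rw [forall_fin_add_two]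
    exact ⟨fun x => Or.inr ⟨x, Perm.SameCycle.rfl⟩,
      Or.inr ⟨⟨0, hN⟩, by rw [← h00]; exact Perm.sameCycle_apply_right.2 Perm.SameCycle.rfl⟩,
      Or.inl Perm.SameCycle.rfl⟩

/-- One leaf is gained, but if the root vertex was a leaf it is lost, since the new edge gives it
degree two. -/
theorem leafCount_addLeaf (hN : 0 < N) (α : Perm (Fin N)) :
    leafCount (addLeaf α) + (if finRotate N (α ⟨0, hN⟩) = ⟨0, hN⟩ then 1 else 0) =
      leafCount α + 1 := by
  have h1 : (Finset.univ.filter fun d => finRotate (N + 2) (addLeaf α d) = d) =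
      insert (Fin.natAdd N 1) (((Finset.univ.filter fun d => finRotate N (α d) = d).erase
        ⟨0, hN⟩).map ⟨Fin.castAdd 2, Fin.castAdd_injective _ _⟩) := by
    rw [Finset.ext_iff, forall_fin_add_two]
    refine ⟨fun x => ?_, ?_, ?_⟩
    · simp only [Finset.mem_filter, Finset.mem_univ, true_and, addLeaf_castAdd, Finset.mem_insert,
        Finset.mem_map, Finset.mem_erase, Function.Embedding.coeFn_mk, castAdd_ne_natAdd, false_or]
      constructor
      · intro h
        rcases Nat.lt_or_ge ((α x).val + 1) N with hd | hd
        · rw [finRotate_castAdd_of_lt hd] at h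
          have h' := Fin.castAdd_injective _ _ h
          refine ⟨x, ⟨?_, h'⟩, rfl⟩
          rintro rfl
          have h2 := finRotate_mk hd
          rw [Fin.eta, h'] at h2
          simpa using congrArg Fin.val h2
        · rw [finRotate_castAdd_of_eq (by omega)] at h
          exact absurd h.symm (castAdd_ne_natAdd _ _)
      · rintro ⟨y, ⟨hy0, hy⟩, hyx⟩
        obtain rfl := Fin.castAdd_injective _ _ hyx
        rcases Nat.lt_or_ge ((α y).val + 1) N with hd | hd
        · rw [finRotate_castAdd_of_lt hd, hy]
        · rw [finRotate_of_eq hN (by omega)] at hy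
          exact absurd hy.symm hy0
    · simp only [Finset.mem_filter, Finset.mem_univ, addLeaf_natAdd_zero,
        Finset.mem_insert, Finset.mem_map, Function.Embedding.coeFn_mk, natAdd_zero_ne_one,
        castAdd_ne_natAdd, and_false, exists_false, or_false, finRotate_natAdd_one hN]
    · simp only [Finset.mem_filter, Finset.mem_univ, true_and, addLeaf_natAdd_one,
        finRotate_natAdd_zero, Finset.mem_insert, true_or]
  unfold leafCount
  rw [h1, Finset.card_insert_of_notMem, Finset.card_map, Finset.card_erase_eq_ite]
  · simp only [Finset.mem_filter, Finset.mem_univ, true_and]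
    split_ifs with h
    · have : 0 < (Finset.univ.filter fun d => finRotate N (α d) = d).card :=
        Finset.card_pos.2 ⟨⟨0, hN⟩, by simpa using h⟩
      omega
    · rfl
  · simp [castAdd_ne_natAdd]

theorem exists_eq_addLeaf {α : Perm (Fin (N + 2))} (hα : ∀ d, α (α d) = d)
    (h : finRotate (N + 2) (α (Fin.natAdd N 1)) = Fin.natAdd N 1) :
    ∃ β : Perm (Fin N), α = addLeaf β := by
  rw [← finRotate_natAdd_zero] at h
  nth_rw 1 [finRotate_natAdd_zero] at h
  have h1 : α (Fin.natAdd N 1) = Fin.natAdd N 0 := (finRotate _).injective h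
  have h0 : α (Fin.natAdd N 0) = Fin.natAdd N 1 := by rw [← h1, hα]
  have key : ∀ x : Fin N, ∃ y : Fin N, α (Fin.castAdd 2 x) = Fin.castAdd 2 y := by
    intro x
    have : ∀ d : Fin (N + 2), d = α (Fin.castAdd 2 x) → ∃ y : Fin N, d = Fin.castAdd 2 y := by
      rw [forall_fin_add_two]
      refine ⟨fun y _ => ⟨y, rfl⟩, fun hd => ?_, fun hd => ?_⟩
      · rw [← h1] at hd
        exact absurd (α.injective hd).symm (castAdd_ne_natAdd _ _)
      · rw [← h0] at hd
        exact absurd (α.injective hd).symm (castAdd_ne_natAdd _ _)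
    exact this _ rfl
  choose f hf using key
  have hinv : Function.Involutive f := fun x => by
    apply Fin.castAdd_injective _ 2
    rw [← hf, ← hf, hα]
  refine ⟨hinv.toPerm, ?_⟩
  ext1 d
  revert d
  rw [forall_fin_add_two]
  refine ⟨fun x => ?_, ?_, ?_⟩
  · rw [hf, addLeaf_castAdd, Function.Involutive.coe_toPerm]
  · rw [h0, addLeaf_natAdd_zero]
  · rw [h1, addLeaf_natAdd_one]

end Leaves

/-! ### Inclusion–exclusion over leaves -/

section LeafMoments

/-- The total number of choices of `j` leaves in the trees with `n` edges. -/
noncomputable def leafMoment (n j : ℕ) : ℕ := ∑ p ∈ oneTreeFinset n, (leafCount p.1).choose j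

theorem mul_choose_pred (L j : ℕ) : L * (L - 1).choose j = (j + 1) * L.choose (j + 1) := by
  cases L with
  | zero => simp
  | succ L => rw [Nat.add_sub_cancel, Nat.add_one_mul_choose_eq, mul_comm]

/-- One of the `j + 1` chosen leaves is marked, and the map is rerooted so that the marked leaf is
at side `a`. -/
theorem succ_mul_leafMoment (n j : ℕ) (a : Fin (2 * n)) :
    (j + 1) * leafMoment n (j + 1) = 2 * n * ∑ p ∈ oneTreeFinset n,
      if finRotate _ (p.1 a) = a then (leafCount p.1 - 1).choose j else 0 := by
  have h := sum_sum_rotate (n := n) (R := ℕ)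
    (fun α d => if finRotate _ (α d) = d then (leafCount α - 1).choose j else 0)
    (fun i α d => by simp only [isLeaf_rotate_iff, leafCount_rotate]) a
  rw [smul_eq_mul] at h
  rw [← h, leafMoment, Finset.mul_sum]
  refine Finset.sum_congr rfl fun p _ => ?_
  rw [← mul_choose_pred, ← Finset.sum_filter, Finset.sum_const, smul_eq_mul, leafCount]

/-- Deleting the leaf at the last side is a bijection onto maps with one edge fewer, together with
the label of the leaf relative to its neighbour, hence the factor 3. The subtracted indicator stands
for a root leaf that the attachment destroys. -/
theorem sum_leaf_eq (k j : ℕ) :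
    (∑ p ∈ oneTreeFinset (k + 2), if finRotate _ (p.1 (Fin.natAdd (2 * (k + 1)) 1)) =
      Fin.natAdd (2 * (k + 1)) 1 then (leafCount p.1 - 1).choose j else 0) =
    3 * ∑ p ∈ oneTreeFinset (k + 1), (leafCount p.1 -
      if finRotate _ (p.1 ⟨0, by omega⟩) = ⟨0, by omega⟩ then 1 else 0).choose j := by
  have hN : 0 < 2 * (k + 1) := by omega
  have h3 : ∀ S : ℕ, 3 * S = ∑ _s ∈ Finset.Icc (-1 : ℤ) 1, S := fun S => by simp
  rw [h3, Finset.sum_comm, ← Finset.sum_product', ← Finset.sum_filter]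
  symm
  have hleaf : ∀ α : Perm (Fin (2 * (k + 1))),
      finRotate (2 * (k + 1) + 2) (addLeaf α (Fin.natAdd (2 * (k + 1)) 1)) =
        Fin.natAdd (2 * (k + 1)) 1 := fun α => by
    rw [addLeaf_natAdd_one, finRotate_natAdd_zero]
  refine Finset.sum_bij (fun q _ => ((addLeaf q.1.1 : Perm (Fin (2 * (k + 1) + 2))),
    (Fin.append q.1.2 ![1, 1 + q.2] : Fin (2 * (k + 1) + 2) → ℤ))) ?_ ?_ ?_ ?_
  · rintro ⟨⟨α, l⟩, s⟩ hq
    rw [Finset.mem_product, mem_oneTreeFinset, Finset.mem_Icc] at hq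
    obtain ⟨⟨hg, h0, hc⟩, hs⟩ := hq
    refine Finset.mem_filter.2 ⟨mem_oneTreeFinset.2 ⟨?_, ?_, ?_⟩, hleaf α⟩
    · exact (isLabelledGluing_addLeaf_iff hN α l (h0 ⟨0, hN⟩ rfl) _ _).2
        ⟨hg, rfl, by simpa [abs_le] using hs⟩
    · intro d hd
      have hd' : d = Fin.castAdd 2 (⟨0, hN⟩ : Fin (2 * (k + 1))) := Fin.ext hd
      rw [hd']
      exact (Fin.append_left l ![1, 1 + s] ⟨0, hN⟩).trans (h0 ⟨0, hN⟩ rfl)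
    · have := cycleCount_addLeaf hN α
      simp only at hc
      rw [hc] at this
      exact congrArg (· + 1) this
  · rintro ⟨⟨α, l⟩, s⟩ hq ⟨⟨α', l'⟩, s'⟩ hq' h
    obtain ⟨h1, h2⟩ := Prod.ext_iff.1 h
    simp only at h1 h2
    have e1 : α = α' := by
      ext1 x
      have := Equiv.congr_fun h1 (Fin.castAdd 2 x)
      rw [addLeaf_castAdd, addLeaf_castAdd] at this
      exact Fin.castAdd_injective _ _ this
    have e2 : l = l' := by
      funext x
      have := congr_fun h2 (Fin.castAdd 2 x)
      rwa [Fin.append_left, Fin.append_left] at this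
    have e3 : s = s' := by
      have := congr_fun h2 (Fin.natAdd _ 1)
      rw [Fin.append_right, Fin.append_right] at this
      simpa using this
    subst e1 e2 e3
    rfl
  · rintro ⟨α, l⟩ hp
    obtain ⟨hp, hl⟩ := Finset.mem_filter.1 hp
    obtain ⟨hg, h0, hc⟩ := mem_oneTreeFinset.1 hp
    obtain ⟨β, rfl⟩ := exists_eq_addLeaf hg.invol hl
    obtain ⟨m, s, rfl⟩ : ∃ (m : Fin (2 * (k + 1)) → ℤ) (s : Fin 2 → ℤ), l = Fin.append m s :=
      ⟨fun i => l (Fin.castAdd 2 i), fun i => l (Fin.natAdd _ i), (Fin.append_castAdd_natAdd).symm⟩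
    obtain ⟨a, b, rfl⟩ : ∃ a b, s = ![a, b] := ⟨s 0, s 1, by ext i; fin_cases i <;> rfl⟩
    have h0' : m ⟨0, hN⟩ = 1 := by
      have := h0 (Fin.castAdd 2 ⟨0, hN⟩) rfl
      exact (Fin.append_left m ![a, b] ⟨0, hN⟩).symm.trans this
    obtain ⟨hg', rfl, hb⟩ := (isLabelledGluing_addLeaf_iff hN β m h0' a b).1 hg
    refine ⟨⟨⟨β, m⟩, b - 1⟩, ?_, ?_⟩
    · rw [Finset.mem_product, mem_oneTreeFinset, Finset.mem_Icc]
      refine ⟨⟨hg', ?_, ?_⟩, abs_le.1 hb⟩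
      · intro d hd
        have hd' : d = ⟨0, hN⟩ := Fin.ext hd
        rw [hd']
        exact h0'
      · have h1 := cycleCount_addLeaf hN β
        have h2 : cycleCount (finRotate (2 * (k + 1) + 2) * addLeaf β) + 1 = k + 2 := hc
        rw [h1] at h2
        exact Nat.succ_injective h2
    · simp
  · rintro ⟨⟨α, l⟩, s⟩ hq
    have := leafCount_addLeaf hN α
    have h1 : leafCount α - (if finRotate _ (α ⟨0, hN⟩) = ⟨0, hN⟩ then 1 else 0) =
        leafCount (addLeaf α) - 1 := by
      omega
    exact congrArg (Nat.choose · j) h1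

/-- A new leaf may be attached at any of the `2 (k + 1)` corners except at the `j` leaves already
chosen; rerooting converts this count of corners into a relation between the sums. -/
theorem leafMoment_succ_succ (k j : ℕ) :
    ((k : ℚ) + 1) * (j + 1) * leafMoment (k + 2) (j + 1) =
      3 * (k + 2) * (2 * (k + 1) - j) * leafMoment (k + 1) j := by
  have h1 := succ_mul_leafMoment (k + 2) j (Fin.natAdd (2 * (k + 1)) 1)
  rw [sum_leaf_eq] at h1
  -- Pascal's rule: the sum counts choices of `j` leaves that avoid the root, and rerooting counts
  -- those that contain it.
  have h2 : (2 * (k + 1)) * ∑ p ∈ oneTreeFinset (k + 1), (leafCount p.1 -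
      if finRotate _ (p.1 ⟨0, by omega⟩) = ⟨0, by omega⟩ then 1 else 0).choose j +
      j * leafMoment (k + 1) j = (2 * (k + 1)) * leafMoment (k + 1) j := by
    cases j with
    | zero => simp [leafMoment]
    | succ i =>
      rw [succ_mul_leafMoment (k + 1) i ⟨0, by omega⟩, ← mul_add, ← Finset.sum_add_distrib,
        leafMoment]
      congr 1
      refine Finset.sum_congr rfl fun p _ => ?_
      split_ifs with h
      · have : 0 < leafCount p.1 := Finset.card_pos.2 ⟨⟨0, by omega⟩, by simpa using h⟩
        obtain ⟨L, hL⟩ : ∃ L, leafCount p.1 = L + 1 := ⟨leafCount p.1 - 1, by omega⟩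
        rw [hL, Nat.add_sub_cancel, Nat.choose_succ_succ, add_comm]
      · simp
  generalize (∑ p ∈ oneTreeFinset (k + 1), (leafCount p.1 -
      if finRotate _ (p.1 ⟨0, by omega⟩) = ⟨0, by omega⟩ then 1 else 0).choose j) = S at h1 h2
  have h1' : ((j : ℚ) + 1) * leafMoment (k + 2) (j + 1) = 2 * (k + 2) * (3 * S) := by
    exact_mod_cast h1
  have h2' : (2 * ((k : ℚ) + 1)) * S + j * leafMoment (k + 1) j =
      (2 * (k + 1)) * leafMoment (k + 1) j := by
    exact_mod_cast h2
  linear_combination ((k : ℚ) + 1) * h1' + 3 * (k + 2) * h2'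

theorem oneTreeFinset_eq_empty {n : ℕ} (hn : n ≤ 1) : oneTreeFinset n = ∅ := by
  rw [Finset.eq_empty_iff_forall_notMem]
  intro p hp
  obtain ⟨-, -, hc⟩ := mem_oneTreeFinset.1 hp
  have h0 : cycleCount (finRotate (2 * n) * p.1) ≠ 0 ∨ n = 0 := by
    rcases Nat.eq_zero_or_pos n with h | h
    · exact Or.inr h
    · left
      have : Nonempty (Quotient (Perm.SameCycle.setoid (finRotate (2 * n) * p.1))) :=
        ⟨Quotient.mk _ ⟨0, by omega⟩⟩
      have : Finite (Quotient (Perm.SameCycle.setoid (finRotate (2 * n) * p.1))) :=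
        Quotient.finite _
      exact Nat.card_pos.ne'
  omega

/-- The binomial coefficient counts multisets of `j` among `2 (m + 1)` corners, and `3 ^ j` counts
the labels of the leaves attached there. Division by the number of edges compensates for the change
in the number of possible roots. -/
theorem leafMoment_eq (m j : ℕ) : (leafMoment (m + 1 + j) j : ℚ) / (m + 1 + j) =
    3 ^ j * ((2 * m + 1 + j).choose j : ℚ) * (leafMoment (m + 1) 0 / (m + 1)) := by
  suffices h : ∀ j' i : ℕ, i + j' = j → (leafMoment (m + 1 + j') j' : ℚ) / (m + 1 + j') =
    3 ^ j' * ((2 * m + 1 + j').choose j' : ℚ) * (leafMoment (m + 1) 0 / (m + 1)) from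
    h j 0 (by simp)
  intro j'
  induction j' with
  | zero => intro i hi; simp
  | succ j' ih =>
    intro i hi
    have h1 := leafMoment_succ_succ (m + j') j'
    have h2 := ih (i + 1) (by omega)
    have h3 : ((2 * m + 1 + (j' + 1)).choose (j' + 1) : ℚ) * (j' + 1) =
        (2 * m + 2 + j') * (2 * m + 1 + j').choose j' := by
      have := Nat.add_one_mul_choose_eq (2 * m + 1 + j') j'
      rw [show 2 * m + 1 + (j' + 1) = 2 * m + 1 + j' + 1 by ring]
      have h : (((2 * m + 1 + j' + 1) * (2 * m + 1 + j').choose j' : ℕ) : ℚ) =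
          ((2 * m + 1 + j' + 1).choose (j' + 1) * (j' + 1) : ℕ) := by rw [this]
      push_cast at h ⊢
      linarith
    rw [show m + 1 + (j' + 1) = m + j' + 2 by ring]
    rw [show m + 1 + j' = m + j' + 1 by ring] at h2
    have hpos : ((m : ℚ) + 1 + j') ≠ 0 := by positivity
    have hpos2 : ((m : ℚ) + j' + 2) ≠ 0 := by positivity
    have hj : ((j' : ℚ) + 1) ≠ 0 := by positivity
    rw [div_eq_iff hpos] at h2
    push_cast at h1 ⊢
    rw [h2] at h1
    rw [show (m : ℚ) + 1 + (j' + 1) = m + j' + 2 by ring, div_eq_iff hpos2]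
    apply mul_left_cancel₀ hj
    apply mul_left_cancel₀ hpos
    linear_combination h1 - 3 ^ (j' + 1) * (leafMoment (m + 1) 0 / (m + 1)) *
      ((m : ℚ) + 1 + j') * (m + j' + 2) * h3

theorem reducedTreeCount_eq_card (n : ℕ) : reducedTreeCount 1 n =
    ((oneTreeFinset n).filter fun p => ∀ d, finRotate (2 * n) (p.1 d) ≠ d).card := by
  rw [reducedTreeCount_eq, ← Fintype.card_coe, ← Nat.card_eq_fintype_card]
  refine Nat.card_congr ((Equiv.subtypeSubtypeEquivSubtypeInter (· ∈ oneTrees n) fun p =>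
    ∀ d, finRotate (2 * n) (p.1 d) ≠ d).trans (Equiv.subtypeEquivRight fun p => ?_))
  simp

/-- The alternating sum of `L.choose j` over `j` is the indicator of `L = 0`; as `L ≤ 2 n`, one
range serves all maps. -/
theorem reducedTreeCount_eq_sum (n : ℕ) :
    (reducedTreeCount 1 n : ℤ) =
      ∑ j ∈ Finset.range (2 * n + 1), (-1) ^ j * (leafMoment n j : ℤ) := by
  simp only [leafMoment, Nat.cast_sum, Finset.mul_sum]
  rw [Finset.sum_comm]
  have h : ∀ p ∈ oneTreeFinset n, ∑ j ∈ Finset.range (2 * n + 1),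
      (-1 : ℤ) ^ j * ((leafCount p.1).choose j : ℤ) =
        if ∀ d, finRotate (2 * n) (p.1 d) ≠ d then 1 else 0 := by
    intro p _
    have hle : leafCount p.1 ≤ 2 * n := by
      simpa [leafCount] using Finset.card_filter_le (Finset.univ : Finset (Fin (2 * n)))
        (fun d => finRotate _ (p.1 d) = d)
    rw [← Finset.sum_subset (Finset.range_mono (Nat.succ_le_succ hle)),
      Int.alternating_sum_range_choose]
    · refine if_congr ?_ rfl rfl
      rw [leafCount, Finset.card_eq_zero, Finset.filter_eq_empty_iff]
      simp
    · intro j _ hj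
      rw [Nat.choose_eq_zero_of_lt, Nat.cast_zero, mul_zero]
      simpa using hj
  rw [Finset.sum_congr rfl h, reducedTreeCount_eq_card, Finset.sum_boole]

end LeafMoments

/-! ### Existence and uniqueness of first-return maps -/

section FirstReturn

variable {D E : Type*}

theorem IsFirstReturn.unique {f : Perm D} {g g' : Perm E} {ι : E → D}
    (h : IsFirstReturn f g ι) (h' : IsFirstReturn f g' ι) (hι : Function.Injective ι) : g = g' := by
  ext1 e
  obtain ⟨k, hk, hk1, hk2⟩ := h e
  obtain ⟨k', hk', hk1', hk2'⟩ := h' e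
  rcases lt_trichotomy k k' with hlt | rfl | hlt
  · exact absurd ⟨_, hk1.symm⟩ (hk2' k hk hlt)
  · exact hι (hk1.symm.trans hk1')
  · exact absurd ⟨_, hk1'.symm⟩ (hk2 k' hk' hlt)

theorem IsFirstReturn.of_semiconj {D' E' : Type*} {f : Perm D} {g : Perm E} {ι : E → D}
    (h : IsFirstReturn f g ι) {f' : Perm D'} {ι' : E' → D'} (a : D ≃ D') (b : E ≃ E')
    (ha : ∀ d, a (f d) = f' (a d)) (hb : ∀ e, a (ι e) = ι' (b e)) :
    IsFirstReturn f' (b.permCongr g) ι' := by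
  have hp : ∀ (k : ℕ) d, a ((f ^ k) d) = (f' ^ k) (a d) := by
    intro k
    induction k with
    | zero => simp
    | succ k ih => intro d; rw [pow_succ', pow_succ', Perm.mul_apply, Perm.mul_apply, ha, ih]
  intro e'
  obtain ⟨e, rfl⟩ := b.surjective e'
  obtain ⟨k, hk, hk1, hk2⟩ := h e
  refine ⟨k, hk, ?_, fun j hj hjk => ?_⟩
  · rw [← hb, ← hp, hk1, hb, Equiv.permCongr_apply, Equiv.symm_apply_apply]
  · rintro ⟨x, hx⟩
    obtain ⟨x, rfl⟩ := b.surjective x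
    rw [← hb, ← hb, ← hp] at hx
    exact hk2 j hj hjk ⟨x, a.injective hx⟩

/-- Returns occur because `f` has finite order. If two elements had the same first return, the one
with the longer way would meet the other before it. -/
theorem exists_isFirstReturn [Finite D] (f : Perm D) (P : D → Prop) :
    ∃ g : Perm {d // P d}, IsFirstReturn f g Subtype.val := by
  classical
  have hex : ∀ e : {d // P d}, ∃ k, 0 < k ∧ P ((f ^ k) e) := fun e =>
    ⟨orderOf f, orderOf_pos f, by rw [pow_orderOf_eq_one]; exact e.2⟩
  let g : {d // P d} → {d // P d} := fun e => ⟨(f ^ Nat.find (hex e)) e, (Nat.find_spec (hex e)).2⟩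
  have hmin : ∀ e j, 0 < j → j < Nat.find (hex e) → ¬ P ((f ^ j) e) := fun e j h1 h2 h3 =>
    Nat.find_min (hex e) h2 ⟨h1, h3⟩
  have key : ∀ e e', Nat.find (hex e) ≤ Nat.find (hex e') → g e = g e' → e = e' := by
    intro e e' hle h
    have h1 : (f ^ Nat.find (hex e)) (e : D) = (f ^ Nat.find (hex e')) (e' : D) :=
      congrArg Subtype.val h
    rw [← Nat.add_sub_of_le hle, pow_add, Perm.mul_apply] at h1
    have h2 : (e : D) = (f ^ (Nat.find (hex e') - Nat.find (hex e))) (e' : D) :=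
      (f ^ _).injective h1
    rcases Nat.eq_zero_or_pos (Nat.find (hex e') - Nat.find (hex e)) with h0 | h0
    · rw [h0] at h2
      exact Subtype.ext h2
    · have := (Nat.find_spec (hex e)).1
      exact absurd (h2 ▸ e.2) (hmin e' _ h0 (by omega))
  have hinj : Function.Injective g := by
    intro e e' h
    rcases le_total (Nat.find (hex e)) (Nat.find (hex e')) with hle | hle
    · exact key e e' hle h
    · exact (key e' e hle h.symm).symm
  refine ⟨Equiv.ofBijective g (Finite.injective_iff_bijective.1 hinj), fun e => ?_⟩
  refine ⟨Nat.find (hex e), (Nat.find_spec (hex e)).1, rfl, fun j h1 h2 => ?_⟩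
  rintro ⟨x, hx⟩
  exact hmin e j h1 h2 (hx ▸ x.2)

end FirstReturn

/-! ### The next side whose label is not larger -/

section NextLE

variable {E : Type*}

/-- `e'` is the first element after `e` whose label is at most the label of `e`. -/
def IsNextLE (τ : Perm E) (l : E → ℤ) (e e' : E) : Prop :=
  ∃ k, 0 < k ∧ (τ ^ k) e = e' ∧ l e' ≤ l e ∧ ∀ j, 0 < j → j < k → l e < l ((τ ^ j) e)

theorem IsNextLE.unique {τ : Perm E} {l : E → ℤ} {e a b : E} (ha : IsNextLE τ l e a)
    (hb : IsNextLE τ l e b) : a = b := by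
  obtain ⟨k, hk, rfl, hk1, hk2⟩ := ha
  obtain ⟨k', hk', rfl, hk1', hk2'⟩ := hb
  rcases lt_trichotomy k k' with hlt | rfl | hlt
  · exact absurd hk1 (hk2' k hk hlt).not_ge
  · rfl
  · exact absurd hk1' (hk2 k' hk' hlt).not_ge

theorem exists_isNextLE [Finite E] (τ : Perm E) (l : E → ℤ) (e : E) : ∃ e', IsNextLE τ l e e' := by
  classical
  have hex : ∃ k, 0 < k ∧ l ((τ ^ k) e) ≤ l e :=
    ⟨orderOf τ, orderOf_pos τ, by rw [pow_orderOf_eq_one]; exact le_rfl⟩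
  refine ⟨_, Nat.find hex, (Nat.find_spec hex).1, rfl, (Nat.find_spec hex).2, fun j h1 h2 => ?_⟩
  by_contra h3
  exact Nat.find_min hex h2 ⟨h1, not_lt.1 h3⟩

/-- Labels drop by at most one per step, so a walk coming down from above the level of `e` lands
exactly on it. -/
theorem IsNextLE.label_eq {τ : Perm E} {l : E → ℤ} (hl : ∀ e, l e - 1 ≤ l (τ e)) {e e' : E}
    (h : IsNextLE τ l e e') (he : l e ≤ l (τ e)) : l e' = l e := by
  obtain ⟨k, hk, rfl, hk1, hk2⟩ := h
  refine le_antisymm hk1 ?_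
  rcases Nat.lt_or_ge 1 k with h1 | h1
  · have h2 := hk2 (k - 1) (by omega) (by omega)
    have h3 := hl ((τ ^ (k - 1)) e)
    rw [← Perm.mul_apply, ← pow_succ', Nat.sub_add_cancel hk] at h3
    omega
  · obtain rfl : k = 1 := by omega
    simpa using he

/-- For equal labels the relation is symmetric: everything strictly in between is larger than both.
-/
theorem IsNextLE.inv {τ : Perm E} {l : E → ℤ} {e e' : E} (h : IsNextLE τ l e e')
    (he : l e' = l e) : IsNextLE τ⁻¹ l e' e := by
  obtain ⟨k, hk, rfl, hk1, hk2⟩ := h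
  refine ⟨k, hk, ?_, he.ge, fun j h1 h2 => ?_⟩
  · rw [inv_pow, ← Perm.mul_apply, inv_mul_cancel, Perm.one_apply]
  · have h3 : (τ⁻¹ ^ j) ((τ ^ k) e) = (τ ^ (k - j)) e := by
      rw [← Perm.mul_apply, inv_pow]
      congr 1
      rw [inv_mul_eq_iff_eq_mul, ← pow_add, Nat.add_sub_of_le h2.le]
    rw [h3, he]
    exact hk2 _ (by omega) (by omega)

theorem IsNextLE.eq_apply {τ : Perm E} {l : E → ℤ} {e e' : E} (h : IsNextLE τ l e e')
    (he : l (τ e) ≤ l e) : e' = τ e :=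
  h.unique ⟨1, one_pos, by simp, he, fun j h1 h2 => by omega⟩

theorem IsNextLE.exists_of_lt {τ : Perm E} {l : E → ℤ} {e e' : E} (h : IsNextLE τ l e e')
    (he : l e < l (τ e)) : l e < l (τ⁻¹ e') := by
  obtain ⟨k, hk, rfl, hk1, hk2⟩ := h
  have h1 : 1 < k := by
    by_contra h1
    obtain rfl : k = 1 := by omega
    simp only [pow_one] at hk1
    omega
  have h3 : τ⁻¹ ((τ ^ k) e) = (τ ^ (k - 1)) e := by
    rw [Perm.inv_eq_iff_eq, ← Perm.mul_apply, ← pow_succ', Nat.sub_add_cancel hk]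
  rw [h3]
  exact hk2 _ (by omega) (by omega)

/-- The first element after `e` whose label is at most the label of `e`. -/
noncomputable def nextLE [Finite E] (τ : Perm E) (l : E → ℤ) (e : E) : E :=
  (exists_isNextLE τ l e).choose

theorem nextLE_spec [Finite E] (τ : Perm E) (l : E → ℤ) (e : E) :
    IsNextLE τ l e (nextLE τ l e) := (exists_isNextLE τ l e).choose_spec

theorem IsNextLE.eq_nextLE [Finite E] {τ : Perm E} {l : E → ℤ} {e e' : E}
    (h : IsNextLE τ l e e') : nextLE τ l e = e' := (nextLE_spec τ l e).unique h

end NextLE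

/-! ### Variation of the labels along the border -/

section Labels

variable {E : Type*} {τ α : Perm E} {l : E → ℤ}

theorem IsLabelledGluing.sub_one_le (H : IsLabelledGluing τ α l) (e : E) : l e - 1 ≤ l (τ e) := by
  have := abs_le.1 (H.edge e)
  rw [H.next]
  omega

theorem IsLabelledGluing.sub_one_le_inv (H : IsLabelledGluing τ α l) (e : E) :
    l e - 1 ≤ l (τ⁻¹ e) := by
  have := abs_le.1 (H.edge (τ⁻¹ e))
  rw [← H.next, perm_apply_inv_self] at this
  omega

theorem IsLabelledGluing.le_add_one (H : IsLabelledGluing τ α l) (e : E) : l (τ e) ≤ l e + 1 := by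
  have := abs_le.1 (H.edge e)
  rw [H.next]
  omega

theorem label_next_alpha (H : IsLabelledGluing τ α l) (e : E) : l (τ (α e)) = l e := by
  rw [H.next, H.invol]

end Labels

/-! ### From a labelled gluing to a quadrangulation -/

section Closure

variable {E : Type*} [Finite E]

/-- The face permutation of the quadrangulation built on a labelled gluing. Its arcs are
`(e, true)`, from the corner `e` to the vertex preceding it in label, and the reversed
arcs `(e, false)`. -/
noncomputable def quadFace (τ α : Perm E) (l : E → ℤ) : E × Bool → E × Bool
  -- If the label drops, the arc from `e` ends at the corner `τ e`, after which the rotation comes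
  -- to the arc leaving the corner `α e` of the same vertex. Otherwise the next corner of equal
  -- label sends its arc to the same place.
  | (e, true) => if l (τ e) < l e then (α e, true) else (nextLE τ l e, false)
  -- If the preceding label is not larger, no arc arrives at the corner `e`. Otherwise the first
  -- corner whose arc arrives there comes right after the last earlier corner with label at most `l
  -- e`.
  | (e, false) => if l (τ⁻¹ e) ≤ l e then (α (τ⁻¹ e), true) else (τ (nextLE τ⁻¹ l e), false)

/-- The labels of the origins of the arcs. -/
def quadLabel (l : E → ℤ) : E × Bool → ℤ
  | (e, true) => l e
  | (e, false) => l e - 1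

variable {τ α : Perm E} {l : E → ℤ}

theorem quadFace_of_lt {e : E} (h : l (τ e) < l e) :
    quadFace τ α l (e, true) = (α e, true) := by
  simp [quadFace, h]

theorem quadFace_of_le {e : E} (h : l e ≤ l (τ e)) :
    quadFace τ α l (e, true) = (nextLE τ l e, false) := by
  simp [quadFace, not_lt.2 h]

theorem quadFace_of_eq {e : E} (h : l (τ e) = l e) :
    quadFace τ α l (e, true) = (τ e, false) := by
  rw [quadFace_of_le h.ge, (nextLE_spec τ l e).eq_apply h.le]

theorem quadFace_apply_false {e : E} (h : l e ≤ l (τ e)) :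
    quadFace τ α l (τ e, false) = (α e, true) := by
  simp [quadFace, h]

theorem quadFace_quadFace_of_lt (H : IsLabelledGluing τ α l) {e : E} (h : l e < l (τ e)) :
    quadFace τ α l (nextLE τ l e, false) = (τ e, false) := by
  have h1 := nextLE_spec τ l e
  have h2 := h1.label_eq H.sub_one_le h.le
  have h3 := h1.exists_of_lt h
  have h4 := (h1.inv h2).eq_nextLE
  rw [quadFace, if_neg (not_le.2 (h2.trans_lt h3)), h4]

/-- Every side is met by a side of type `true`, at most two steps before. -/
theorem exists_quadFace_eq (H : IsLabelledGluing τ α l) (d : E × Bool) :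
    ∃ e, d = (e, true) ∨ d = quadFace τ α l (e, true) ∨
      d = quadFace τ α l (quadFace τ α l (e, true)) := by
  obtain ⟨f, b⟩ := d
  cases b with
  | true => exact ⟨f, Or.inl rfl⟩
  | false =>
    rcases le_or_gt (l (τ⁻¹ f)) (l f) with h | h
    · refine ⟨τ⁻¹ f, Or.inr ?_⟩
      nth_rw 2 [← perm_apply_inv_self τ f] at h
      rcases h.lt_or_eq with h | h
      · right
        rw [quadFace_of_le h.le, quadFace_quadFace_of_lt H h, perm_apply_inv_self]
      · left
        rw [quadFace_of_eq h.symm, perm_apply_inv_self]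
    · have h1 := nextLE_spec τ⁻¹ l f
      have h2 := h1.label_eq H.sub_one_le_inv h.le
      have h3 := h1.exists_of_lt h
      have h4 := h1.inv h2
      rw [inv_inv] at h3 h4
      refine ⟨nextLE τ⁻¹ l f, Or.inr (Or.inl ?_)⟩
      rw [quadFace_of_le (h2 ▸ h3.le), h4.eq_nextLE]

/-- The cases of the shape of a face. -/
theorem quadFace_cases (H : IsLabelledGluing τ α l) (e : E) :
    (quadFace τ α l (e, true) = (α e, true) ∧
      quadFace τ α l (α e, true) = (nextLE τ l (α e), false) ∧
      quadFace τ α l (nextLE τ l (α e), false) = (τ (α e), false) ∧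
      quadFace τ α l (τ (α e), false) = (e, true)) ∨
    (quadFace τ α l (e, true) = (τ e, false) ∧
      quadFace τ α l (τ e, false) = (α e, true) ∧
      quadFace τ α l (α e, true) = (τ (α e), false) ∧
      quadFace τ α l (τ (α e), false) = (e, true)) ∨
    (quadFace τ α l (e, true) = (nextLE τ l e, false) ∧
      quadFace τ α l (nextLE τ l e, false) = (τ e, false) ∧
      quadFace τ α l (τ e, false) = (α e, true) ∧
      quadFace τ α l (α e, true) = (e, true)) := by
  have h1 := H.next e
  have h2 := label_next_alpha H e
  -- One face for each pair `e`, `α e`. Its labels read `h, h - 1, h, h - 1` if the two ends agree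
  -- and `h, h - 1, h - 2, h - 1` if not; the first and third cases differ by exchanging `e` and `α
  -- e`.
  rcases lt_trichotomy (l (α e)) (l e) with h | h | h
  · refine Or.inl ⟨quadFace_of_lt (by omega), quadFace_of_le (by omega),
      quadFace_quadFace_of_lt H (by omega), ?_⟩
    rw [quadFace_apply_false (by omega), H.invol]
  · refine Or.inr (Or.inl ⟨quadFace_of_eq (by omega), quadFace_apply_false (by omega),
      quadFace_of_eq (by omega), ?_⟩)
    rw [quadFace_apply_false (by omega), H.invol]
  · refine Or.inr (Or.inr ⟨quadFace_of_le (by omega), quadFace_quadFace_of_lt H (by omega),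
      quadFace_apply_false (by omega), ?_⟩)
    rw [quadFace_of_lt (by omega), H.invol]

theorem quadFace_iterate_four (H : IsLabelledGluing τ α l) (d : E × Bool) :
    (quadFace τ α l)^[4] d = d := by
  have key : ∀ e, (quadFace τ α l)^[4] (e, true) = (e, true) := by
    intro e
    simp only [Function.iterate_succ, Function.iterate_zero, Function.comp_apply, id]
    rcases quadFace_cases H e with ⟨h1, h2, h3, h4⟩ | ⟨h1, h2, h3, h4⟩ | ⟨h1, h2, h3, h4⟩ <;>
      rw [h1, h2, h3, h4]
  obtain ⟨e, rfl | rfl | rfl⟩ := exists_quadFace_eq H d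
  · exact key e
  · rw [← Function.iterate_succ_apply, Function.iterate_succ_apply', key]
  · rw [← Function.iterate_succ_apply, ← Function.iterate_succ_apply, Function.iterate_succ_apply',
      Function.iterate_succ_apply', key]

/-- The face permutation as a permutation. -/
noncomputable def quadPhi (H : IsLabelledGluing τ α l) : Perm (E × Bool) where
  toFun := quadFace τ α l
  invFun := (quadFace τ α l)^[3]
  left_inv d := quadFace_iterate_four H d
  right_inv d := by
    rw [← Function.iterate_succ_apply' (quadFace τ α l)]
    exact quadFace_iterate_four H d

/-- Reversal of the arcs. -/
def quadAlpha (E : Type*) : Perm (E × Bool) where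
  toFun d := (d.1, !d.2)
  invFun d := (d.1, !d.2)
  left_inv d := by simp
  right_inv d := by simp

/-- The vertex permutation. -/
noncomputable def quadSigma (H : IsLabelledGluing τ α l) : Perm (E × Bool) :=
  quadPhi H * quadAlpha E

theorem quadSigma_apply (H : IsLabelledGluing τ α l) (e : E) (b : Bool) :
    quadSigma H (e, b) = quadFace τ α l (e, !b) := rfl

theorem quadPhi_apply (H : IsLabelledGluing τ α l) (d : E × Bool) :
    quadPhi H d = quadFace τ α l d := rfl

/-- The only descending arcs of a face are those at `e` and `α e`, so the gluing can be recovered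
from the quadrangulation. -/
theorem quadPhi_isFirstReturn (H : IsLabelledGluing τ α l) :
    IsFirstReturn (quadPhi H) α (fun e => (e, true)) := by
  intro e
  rcases quadFace_cases H e with ⟨h1, h2, h3, h4⟩ | ⟨h1, h2, h3, h4⟩ | ⟨h1, h2, h3, h4⟩
  · refine ⟨1, one_pos, ?_, fun j hj hj' => by omega⟩
    rw [pow_one, quadPhi_apply, h1]
  · refine ⟨2, two_pos, ?_, fun j hj hj' => ?_⟩
    · rw [pow_two, Perm.mul_apply, quadPhi_apply, quadPhi_apply, h1, h2]
    · obtain rfl : j = 1 := by omega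
      rw [pow_one, quadPhi_apply, h1]
      simp
  · refine ⟨3, by omega, ?_, fun j hj hj' => ?_⟩
    · rw [pow_succ, pow_two, Perm.mul_apply, Perm.mul_apply, quadPhi_apply, quadPhi_apply,
        quadPhi_apply, h1, h2, h3]
    · obtain rfl | rfl : j = 1 ∨ j = 2 := by omega
      · rw [pow_one, quadPhi_apply, h1]
        simp
      · rw [pow_two, Perm.mul_apply, quadPhi_apply, quadPhi_apply, h1, h2]
        simp

theorem quadFace_quadFace_ne (H : IsLabelledGluing τ α l) (d : E × Bool) :
    quadFace τ α l (quadFace τ α l d) ≠ d := by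
  have hinj : Function.Injective (quadFace τ α l) := (quadPhi H).injective
  have key : ∀ e, quadFace τ α l (quadFace τ α l (e, true)) ≠ (e, true) := by
    intro e
    rcases quadFace_cases H e with ⟨h1, h2, h3, h4⟩ | ⟨h1, h2, h3, h4⟩ | ⟨h1, h2, h3, h4⟩ <;>
      rw [h1, h2] <;> simp [H.ne]
  obtain ⟨e, rfl | rfl | rfl⟩ := exists_quadFace_eq H d
  · exact key e
  · exact fun h => key e (hinj h)
  · exact fun h => key e (hinj (hinj h))

theorem quadLabel_quadFace (H : IsLabelledGluing τ α l) (e : E) (b : Bool) :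
    quadLabel l (quadFace τ α l (e, b)) = quadLabel l (e, !b) := by
  cases b with
  | true =>
    rcases lt_or_ge (l (τ e)) (l e) with h | h
    · have := H.sub_one_le e
      rw [quadFace_of_lt h]
      simp only [quadLabel, Bool.not_true]
      rw [← H.next]
      omega
    · rw [quadFace_of_le h]
      simp only [quadLabel, Bool.not_true]
      rw [(nextLE_spec τ l e).label_eq H.sub_one_le h]
  | false =>
    rcases le_or_gt (l (τ⁻¹ e)) (l e) with h | h
    · simp only [quadFace, h, if_true, quadLabel, Bool.not_false]
      rw [← H.next, perm_apply_inv_self]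
    · have h1 := nextLE_spec τ⁻¹ l e
      have h2 := h1.label_eq H.sub_one_le_inv h.le
      have h3 := h1.exists_of_lt h
      rw [inv_inv] at h3
      have h4 := H.le_add_one (nextLE τ⁻¹ l e)
      simp only [quadFace, not_le.2 h, if_false, quadLabel, Bool.not_false]
      omega

theorem quadLabel_quadSigma (H : IsLabelledGluing τ α l) (d : E × Bool) :
    quadLabel l (quadSigma H d) = quadLabel l d := by
  obtain ⟨e, b⟩ := d
  rw [quadSigma_apply, quadLabel_quadFace H, Bool.not_not]

end Closure

/-! ### Vertices of the closed quadrangulation -/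

section Closure

variable {E : Type*} {τ α : Perm E} {l : E → ℤ}

/-- A quadrangulation with face permutation `φ = σ α` whose arcs have origins labelled in such
a way that labels differ by exactly one along edges, with only one vertex at which the label is
locally minimal. -/
structure IsLabelledQuad {D : Type*} (σ α : Perm D) (l : D → ℤ) : Prop where
  invol : ∀ d, α (α d) = d
  vertex : ∀ d, l (σ d) = l d
  edge : ∀ d, l (α d) = l d + 1 ∨ l (α d) = l d - 1
  face : ∀ d, (σ * α) ((σ * α) ((σ * α) ((σ * α) d))) = d
  face_ne : ∀ d, (σ * α) ((σ * α) d) ≠ d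
  connected : ∀ d e, ∃ g ∈ Subgroup.closure {σ, α}, g d = e
  sink : ∀ d e, (∀ x, σ.SameCycle d x → l (α x) = l x + 1) →
    (∀ x, σ.SameCycle e x → l (α x) = l x + 1) → σ.SameCycle d e

variable [Finite E]

/-- Here `g` is the corner at which the arc from `f` ends. Rotation runs through the arcs into `g`
from later and later corners with the label of `f`, the last one being `τ⁻¹ g`, and then leaves `g`
for the next corner of the vertex. -/
theorem quadSigma_fan (H : IsLabelledGluing τ α l) (g : E) (k : ℕ) :
    ∀ f, 0 < k → (τ ^ k) f = g → l f = l g + 1 → (∀ j, j < k → l g < l ((τ ^ j) f)) →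
    ∃ m, 0 < m ∧ (quadSigma H ^ m) (f, false) = ((τ * α)⁻¹ g, true) ∧
      ∀ j, j < m → ((quadSigma H ^ j) (f, false)).2 = false := by
  induction k using Nat.strong_induction_on with
  | _ k ih =>
    intro f hk hf hl hlt
    rcases lt_or_ge (l (τ f)) (l f) with h | h
    · have hk1 : k = 1 := by
        by_contra hk1
        have h1 := hlt 1 (by omega)
        rw [pow_one] at h1
        omega
      subst hk1
      rw [pow_one] at hf
      refine ⟨1, one_pos, ?_, fun j hj => ?_⟩
      · rw [pow_one, quadSigma_apply, Bool.not_false, quadFace_of_lt h, ← hf, mul_inv_rev,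
          Perm.mul_apply]
        congr 1
        rw [show τ⁻¹ (τ f) = f from by simp, eq_comm, Perm.inv_eq_iff_eq, H.invol]
      · obtain rfl : j = 0 := by omega
        rfl
    · have h1 := nextLE_spec τ l f
      have h2 := h1.label_eq H.sub_one_le h
      obtain ⟨i, hi, hi1, hi2, hi3⟩ := h1
      have hik : i < k := by
        rcases lt_trichotomy i k with h4 | rfl | h4
        · exact h4
        · rw [hf] at hi1
          rw [← hi1] at h2
          omega
        · have := hi3 k hk h4
          rw [hf] at this
          omega
      obtain ⟨m, hm, hm1, hm2⟩ := ih (k - i) (by omega) (nextLE τ l f) (by omega)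
        (by rw [← hi1, ← Perm.mul_apply, ← pow_add, Nat.sub_add_cancel hik.le, hf]) (h2.trans hl)
        (fun j hj => by
          rw [← hi1, ← Perm.mul_apply, ← pow_add]
          exact hlt _ (by omega))
      have hs : quadSigma H (f, false) = (nextLE τ l f, false) := by
        rw [quadSigma_apply, Bool.not_false, quadFace_of_le h]
      refine ⟨m + 1, by omega, ?_, fun j hj => ?_⟩
      · rw [pow_succ, Perm.mul_apply, hs, hm1]
      · cases j with
        | zero => rfl
        | succ j => rw [pow_succ, Perm.mul_apply, hs, hm2 j (by omega)]

/-- Between the arcs that leave two consecutive corners of a vertex lie only arcs arriving at the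
first of them, all swept by `quadSigma_fan`. The corners are visited in the order opposite to that
of `τ * α`. -/
theorem quadSigma_isFirstReturn (H : IsLabelledGluing τ α l) :
    IsFirstReturn (quadSigma H) (τ * α)⁻¹ (fun e => (e, true)) := by
  intro g
  have hnot : ∀ d : E × Bool, d.2 = false → d ∉ Set.range (fun e : E => (e, true)) := by
    rintro ⟨e, b⟩ rfl ⟨x, hx⟩
    simp at hx
  rcases le_or_gt (l (τ⁻¹ g)) (l g) with h | h
  · refine ⟨1, one_pos, ?_, fun j h1 h2 => by omega⟩
    rw [pow_one, quadSigma_apply, Bool.not_true, quadFace, if_pos h, mul_inv_rev, Perm.mul_apply]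
    congr 1
    rw [eq_comm, Perm.inv_eq_iff_eq, H.invol]
  · have h1 := nextLE_spec τ⁻¹ l g
    have h2 := h1.label_eq H.sub_one_le_inv h.le
    have h3 := h1.exists_of_lt h
    rw [inv_inv] at h3
    have h4 := H.le_add_one (nextLE τ⁻¹ l g)
    obtain ⟨k, hk, hk1, hk2, hk3⟩ := h1.inv h2
    rw [inv_inv] at hk1 hk3
    have hk' : k ≠ 1 := by
      rintro rfl
      rw [pow_one] at hk1
      rw [hk1] at h3
      omega
    have hs : quadSigma H (g, true) = (τ (nextLE τ⁻¹ l g), false) := by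
      rw [quadSigma_apply, Bool.not_true, quadFace, if_neg (not_le.2 h)]
    obtain ⟨m, hm, hm1, hm2⟩ := quadSigma_fan H g (k - 1) (τ (nextLE τ⁻¹ l g)) (by omega)
      (by rw [← Perm.mul_apply, ← pow_succ, Nat.sub_add_cancel hk, hk1]) (by omega)
      (fun j hj => by
        rw [← Perm.mul_apply, ← pow_succ, ← h2]
        exact hk3 _ (by omega) (by omega))
    refine ⟨m + 1, by omega, ?_, fun j hj1 hj2 => hnot _ ?_⟩
    · rw [pow_succ, Perm.mul_apply, hs, hm1]
    · obtain ⟨j, rfl⟩ : ∃ i, j = i + 1 := ⟨j - 1, by omega⟩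
      rw [pow_succ, Perm.mul_apply, hs, hm2 j (by omega)]

/-- The arcs leaving the corners of minimal label all end at the additional vertex, around which
they follow the order of the border. -/
theorem sameCycle_quadSigma_of_isMin (H : IsLabelledGluing τ α l) {e : E} (he : ∀ x, l e ≤ l x)
    (k : ℕ) : ∀ f, l f = l e → (τ ^ k) f = e → (quadSigma H).SameCycle (f, false) (e, false) := by
  induction k using Nat.strong_induction_on with
  | _ k ih =>
    intro f hf hk
    rcases Nat.eq_zero_or_pos k with rfl | hpos
    · rw [← hk]
      exact Perm.SameCycle.rfl
    have h := nextLE_spec τ l f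
    have hle : l f ≤ l (τ f) := hf ▸ he _
    have h2 := h.label_eq H.sub_one_le hle
    obtain ⟨i, hi, hi1, hi2, hi3⟩ := h
    have hik : i ≤ k := by
      by_contra hik
      have := hi3 k hpos (by omega)
      rw [hk] at this
      omega
    have hs : quadSigma H (f, false) = (nextLE τ l f, false) := by
      rw [quadSigma_apply, Bool.not_false, quadFace_of_le hle]
    have := ih (k - i) (by omega) (nextLE τ l f) (h2.trans hf)
      (by rw [← hi1, ← Perm.mul_apply, ← pow_add, Nat.sub_add_cancel hik, hk])
    rw [← hs] at this
    exact Perm.sameCycle_apply_left.1 this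

theorem not_sameCycle_of_isMin (H : IsLabelledGluing τ α l) {e : E} (he : ∀ x, l e ≤ l x)
    (x : E) : ¬ (quadSigma H).SameCycle (e, false) (x, true) := by
  rintro ⟨i, hi⟩
  have : ∀ d, (quadSigma H).SameCycle (e, false) d → quadLabel l d = l e - 1 := by
    intro d hd
    obtain ⟨k, rfl⟩ := hd.exists_nat_pow_eq
    clear hd
    induction k with
    | zero => rfl
    | succ k ih => rw [pow_succ', Perm.mul_apply, quadLabel_quadSigma, ih]
  have h1 := this _ ⟨i, hi⟩
  have h2 := he x
  simp only [quadLabel] at h1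
  omega

theorem exists_sameCycle_true (H : IsLabelledGluing τ α l) (hτ : ∀ a b, τ.SameCycle a b) {e : E}
    (he : ∀ x, l e ≤ l x) {f : E} (hf : l f ≠ l e) :
    ∃ x, (quadSigma H).SameCycle (f, false) (x, true) := by
  classical
  obtain ⟨k, hk⟩ := (hτ f e).exists_nat_pow_eq
  have hlt : l e < l f := lt_of_le_of_ne (he f) (Ne.symm hf)
  have hex : ∃ k, l ((τ ^ k) f) < l f := ⟨k, by rwa [hk]⟩
  have hpos : 0 < Nat.find hex := by
    rw [Nat.find_pos]
    simp
  have hmin : ∀ j, j < Nat.find hex → l f ≤ l ((τ ^ j) f) := fun j hj =>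
    not_lt.1 (Nat.find_min hex hj)
  have h1 := hmin (Nat.find hex - 1) (by omega)
  have h2 := H.sub_one_le ((τ ^ (Nat.find hex - 1)) f)
  rw [← Perm.mul_apply, ← pow_succ', Nat.sub_add_cancel hpos] at h2
  have h3 := Nat.find_spec hex
  obtain ⟨m, hm, hm1, -⟩ := quadSigma_fan H ((τ ^ Nat.find hex) f) (Nat.find hex) f hpos rfl
    (by omega) (fun j hj => h3.trans_le (hmin j hj))
  exact ⟨_, m, by simpa using hm1⟩

/-- The cycles that contain a descending arc are the vertices of the gluing; the remaining one is
the additional vertex, whose label is one below the minimum. -/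
theorem cycleCount_quadSigma [Nonempty E] (H : IsLabelledGluing τ α l)
    (hτ : ∀ a b, τ.SameCycle a b) : cycleCount (quadSigma H) = cycleCount (τ * α) + 1 := by
  obtain ⟨e, he⟩ := Finite.exists_min l
  rw [← cycleCount_inv (τ * α)]
  refine (quadSigma_isFirstReturn H).cycleCount_eq (fun a b h => (Prod.ext_iff.1 h).1) (e, false)
    (fun x => not_sameCycle_of_isMin H he x) ?_
  rintro ⟨f, b⟩
  cases b with
  | true => exact Or.inr ⟨f, Perm.SameCycle.rfl⟩
  | false =>
    by_cases hf : l f = l e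
    · obtain ⟨k, hk⟩ := (hτ f e).exists_nat_pow_eq
      exact Or.inl (sameCycle_quadSigma_of_isMin H he k f hf hk).symm
    · exact Or.inr (exists_sameCycle_true H hτ he hf)

/-- A vertex with only ascending arcs contains no `(x, true)`, so it is the additional vertex.
Transitivity of `τ` gives connectedness. -/
theorem isLabelledQuad_quadSigma (H : IsLabelledGluing τ α l) (hτ : ∀ a b, τ.SameCycle a b) :
    IsLabelledQuad (quadSigma H) (quadAlpha E) (quadLabel l) := by
  have hφ : quadSigma H * quadAlpha E = quadPhi H := by
    ext1 d
    simp [quadSigma, quadAlpha]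
  have hedge : ∀ d, quadLabel l (quadAlpha E d) = quadLabel l d + 1 ∨
      quadLabel l (quadAlpha E d) = quadLabel l d - 1 := by
    rintro ⟨e, b⟩
    cases b <;> simp [quadAlpha, quadLabel]
  refine ⟨fun d => by simp [quadAlpha], quadLabel_quadSigma H, hedge, fun d => ?_, fun d => ?_, ?_,
    ?_⟩
  · rw [hφ]
    exact quadFace_iterate_four H d
  · rw [hφ]
    exact quadFace_quadFace_ne H d
  · intro d d'
    let G := Subgroup.closure {quadSigma H, quadAlpha E}
    have hσ : quadSigma H ∈ G := Subgroup.subset_closure (Set.mem_insert _ _)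
    have hα : quadAlpha E ∈ G := Subgroup.subset_closure (Set.mem_insert_of_mem _ rfl)
    have htrans : ∀ {a b c : E × Bool}, (∃ g ∈ G, g a = b) → (∃ g ∈ G, g b = c) →
        ∃ g ∈ G, g a = c := by
      rintro a b c ⟨g, hg, rfl⟩ ⟨k, hk, rfl⟩
      exact ⟨k * g, mul_mem hk hg, rfl⟩
    have hsymm : ∀ {a b : E × Bool}, (∃ g ∈ G, g a = b) → (∃ g ∈ G, g b = a) := by
      rintro a b ⟨g, hg, rfl⟩
      exact ⟨g⁻¹, inv_mem hg, by simp⟩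
    -- Both are linked to `(α e, true)`: one around a face, the other around a vertex.
    have h1 : ∀ e, ∃ g ∈ G, g (e, true) = (τ e, true) := by
      intro e
      have ha : ∃ g ∈ G, g (e, true) = (α e, true) := by
        obtain ⟨k, -, hk, -⟩ := quadPhi_isFirstReturn H e
        exact ⟨_, pow_mem (hφ ▸ mul_mem hσ hα) k, hk⟩
      have hb : ∃ g ∈ G, g (τ e, true) = (α e, true) := by
        obtain ⟨k, -, hk, -⟩ := quadSigma_isFirstReturn H (τ e)
        refine ⟨_, pow_mem hσ k, hk.trans ?_⟩
        congr 1
        rw [Perm.inv_eq_iff_eq, Perm.mul_apply, H.invol]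
      exact htrans ha (hsymm hb)
    have h2 : ∀ e e', ∃ g ∈ G, g (e, true) = (e', true) := by
      intro e e'
      obtain ⟨k, rfl⟩ := (hτ e e').exists_nat_pow_eq
      induction k with
      | zero => exact ⟨1, one_mem _, rfl⟩
      | succ k ih =>
        rw [pow_succ', Perm.mul_apply]
        exact htrans ih (h1 _)
    have h3 : ∀ d : E × Bool, ∃ g ∈ G, g d = (d.1, true) := by
      rintro ⟨e, b⟩
      cases b with
      | true => exact ⟨1, one_mem _, rfl⟩
      | false => exact ⟨_, hα, rfl⟩
    exact htrans (h3 d) (htrans (h2 _ _) (hsymm (h3 d')))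
  · rintro ⟨f, b⟩ ⟨f', b'⟩ h h'
    have : Nonempty E := ⟨f⟩
    obtain ⟨e, he⟩ := Finite.exists_min l
    have key : ∀ f b, (∀ x, (quadSigma H).SameCycle (f, b) x →
        quadLabel l (quadAlpha E x) = quadLabel l x + 1) →
        (quadSigma H).SameCycle (f, b) (e, false) := by
      intro f b h
      have hno : ∀ x, ¬ (quadSigma H).SameCycle (f, b) (x, true) := by
        intro x hx
        have := h _ hx
        simp [quadLabel, quadAlpha] at this
        omega
      cases b with
      | true => exact absurd Perm.SameCycle.rfl (hno f)
      | false =>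
        by_cases hf : l f = l e
        · obtain ⟨k, hk⟩ := (hτ f e).exists_nat_pow_eq
          exact sameCycle_quadSigma_of_isMin H he k f hf hk
        · obtain ⟨x, hx⟩ := exists_sameCycle_true H hτ he hf
          exact absurd hx (hno x)
    exact (key f b h).trans (key f' b' h').symm

end Closure

/-! ### From a labelled quadrangulation back to a gluing -/

section Opening

variable {D : Type*} {σ α : Perm D} {l : D → ℤ}

theorem IsFirstReturn.apply_eq {E : Type*} {f : Perm D} {g : Perm E} {ι : E → D}
    (h : IsFirstReturn f g ι) (hι : Function.Injective ι) {e e' : E} {k : ℕ} (hk : 0 < k)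
    (he : (f ^ k) (ι e) = ι e') (hj : ∀ j, 0 < j → j < k → (f ^ j) (ι e) ∉ Set.range ι) :
    g e = e' := by
  obtain ⟨k', hk', hk1', hk2'⟩ := h e
  rcases lt_trichotomy k k' with hlt | rfl | hlt
  · exact absurd ⟨_, he.symm⟩ (hk2' k hk hlt)
  · exact hι (hk1'.symm.trans he)
  · exact absurd ⟨_, hk1'.symm⟩ (hj k' hk' hlt)

/-- The arcs along which the label decreases. -/
abbrev Down (α : Perm D) (l : D → ℤ) : Type _ := {d : D // l (α d) = l d - 1}

/-- `b` is reached from `a` by iterating `ψ` through labels larger than the label of `a`. -/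
def Reach {E : Type*} (ψ : Perm E) (l : E → ℤ) (a b : E) : Prop :=
  ∃ k, 0 < k ∧ (ψ ^ k) a = b ∧ ∀ j, 0 < j → j ≤ k → l a < l ((ψ ^ j) a)

section Reach

variable {E : Type*} {ψ : Perm E} {m : E → ℤ} {a b c : E}

theorem Reach.lt (h : Reach ψ m a b) : m a < m b := by
  obtain ⟨k, hk, rfl, hk2⟩ := h
  exact hk2 k hk le_rfl

theorem Reach.of_apply (h : m a < m (ψ a)) : Reach ψ m a (ψ a) :=
  ⟨1, one_pos, by simp, fun j h1 h2 => by
    obtain rfl : j = 1 := by omega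
    simpa using h⟩

theorem Reach.trans (h : Reach ψ m a b) (h' : Reach ψ m b c) : Reach ψ m a c := by
  have hab := h.lt
  obtain ⟨k, hk, rfl, hk2⟩ := h
  obtain ⟨k', hk', rfl, hk2'⟩ := h'
  refine ⟨k' + k, by omega, by rw [pow_add, Perm.mul_apply], fun j h1 h2 => ?_⟩
  rcases le_or_gt j k with h3 | h3
  · exact hk2 j h1 h3
  · have := hk2' (j - k) (by omega) (by omega)
    rw [← Perm.mul_apply, ← pow_add, Nat.sub_add_cancel h3.le] at this
    exact hab.trans this

theorem Reach.step (h : Reach ψ m a b) (hb : m a < m (ψ b)) : Reach ψ m a (ψ b) := by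
  obtain ⟨k, hk, rfl, hk2⟩ := h
  rw [← Perm.mul_apply, ← pow_succ'] at *
  refine ⟨k + 1, by omega, rfl, fun j h1 h2 => ?_⟩
  rcases h2.lt_or_eq with h2 | rfl
  · exact hk2 j h1 (by omega)
  · exact hb

theorem Reach.sameCycle (h : Reach ψ m a b) : ψ.SameCycle a b := by
  obtain ⟨k, hk, rfl, hk2⟩ := h
  exact ⟨k, by simp⟩

theorem Reach.isNextLE (h : Reach ψ m a b) (hb : m (ψ b) ≤ m a) : IsNextLE ψ m a (ψ b) := by
  obtain ⟨k, hk, rfl, hk2⟩ := h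
  exact ⟨k + 1, by omega, by rw [pow_succ', Perm.mul_apply], hb, fun j h1 h2 =>
    hk2 j h1 (by omega)⟩

end Reach

namespace IsLabelledQuad

theorem up_of_not_down (H : IsLabelledQuad σ α l) {d : D} (h : ¬ l (α d) = l d - 1) :
    l (α d) = l d + 1 := (H.edge d).resolve_right h

theorem down_alpha (H : IsLabelledQuad σ α l) {d : D} (h : l (α d) = l d + 1) :
    l (α (α d)) = l (α d) - 1 := by
  rw [H.invol]; omega

theorem up_alpha (H : IsLabelledQuad σ α l) {d : D} (h : l (α d) = l d - 1) :
    l (α (α d)) = l (α d) + 1 := by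
  rw [H.invol]; omega

theorem phi_four (H : IsLabelledQuad σ α l) (d : D) :
    σ (α (σ (α (σ (α (σ (α d))))))) = d := H.face d

theorem phi_two_ne (H : IsLabelledQuad σ α l) (d : D) : σ (α (σ (α d))) ≠ d := H.face_ne d

theorem labels (H : IsLabelledQuad σ α l) (d : D) :
    (l (α (σ (α d))) = l (α d) + 1 ∨ l (α (σ (α d))) = l (α d) - 1) ∧
    (l (α (σ (α (σ (α d))))) = l (α (σ (α d))) + 1 ∨
      l (α (σ (α (σ (α d))))) = l (α (σ (α d))) - 1) ∧
    (l d = l (α (σ (α (σ (α d))))) + 1 ∨ l d = l (α (σ (α (σ (α d))))) - 1) ∧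
    l (α (σ (α (σ (α (σ (α d))))))) = l d := by
  have h1 := H.edge (σ (α d))
  have h2 := H.edge (σ (α (σ (α d))))
  have h3 := H.edge (σ (α (σ (α (σ (α d))))))
  have h4 : l (σ (α (σ (α (σ (α (σ (α d)))))))) = l d := by rw [H.phi_four]
  simp only [H.vertex] at h1 h2 h3 h4
  rw [h4] at h3
  exact ⟨h1, h2, h3, h4⟩

variable {a r : Perm (Down α l)}

section

variable (H : IsLabelledQuad σ α l) (ha : IsFirstReturn (σ * α) a Subtype.val)
  (hr : IsFirstReturn σ r Subtype.val)

theorem alpha_of_one (ha : IsFirstReturn (σ * α) a Subtype.val) {e e' : Down α l}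
    (h : σ (α e) = e') : a e = e' :=
  ha.apply_eq Subtype.val_injective one_pos h fun j _ _ => by omega

theorem rho_of_one (hr : IsFirstReturn σ r Subtype.val) {e e' : Down α l}
    (h : σ e = e') : r e = e' :=
  hr.apply_eq Subtype.val_injective one_pos (by simpa using h) fun j _ _ => by omega

theorem apply_rho {e f : Down α l} (hinv : ∀ e, a (a e) = e) (h : r f = a e) : (a * r) f = e := by
  rw [Perm.mul_apply, h, hinv]

include H ha

theorem alpha_of_two {e e' : Down α l} (h1 : l (α (σ (α e))) = l (α e) + 1)
    (h : σ (α (σ (α e))) = e') : a e = e' := by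
  refine ha.apply_eq Subtype.val_injective two_pos h fun j _ _ => ?_
  obtain rfl : j = 1 := by omega
  rintro ⟨⟨x, hx⟩, hx'⟩
  simp only [pow_one, Perm.mul_apply] at hx'
  rw [hx', H.vertex] at hx
  omega

theorem alpha_of_three {e e' : Down α l} (h1 : l (α (σ (α e))) = l (α e) + 1)
    (h2 : l (α (σ (α (σ (α e))))) = l (α (σ (α e))) + 1)
    (h : σ (α (σ (α (σ (α e))))) = e') : a e = e' := by
  refine ha.apply_eq Subtype.val_injective (k := 3) (by omega) h fun j _ _ => ?_
  obtain rfl | rfl : j = 1 ∨ j = 2 := by omega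
  · rintro ⟨⟨x, hx⟩, hx'⟩
    simp only [pow_one, Perm.mul_apply] at hx'
    rw [hx', H.vertex] at hx
    omega
  · rintro ⟨⟨x, hx⟩, hx'⟩
    simp only [pow_two, Perm.mul_apply] at hx'
    rw [hx', H.vertex] at hx
    omega

/-- The three shapes of the face at a descending arc. -/
theorem alpha_cases (e : Down α l) :
    ((a e : D) = σ (α e) ∧ l (α (σ (α e))) = l (α e) - 1 ∧ l (a e : D) = l e - 1) ∨
    ((a e : D) = σ (α (σ (α e))) ∧ l (α (σ (α e))) = l (α e) + 1 ∧ l (a e : D) = l e) ∨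
    ((a e : D) = σ (α (σ (α (σ (α e))))) ∧ l (α (σ (α e))) = l (α e) + 1 ∧
      l (α (σ (α (σ (α e))))) = l (α (σ (α e))) + 1 ∧ l (a e : D) = l e + 1) := by
  obtain ⟨h1, h2, h3, h4⟩ := H.labels e
  have he := e.2
  rcases h1 with h1 | h1
  · rcases h2 with h2 | h2
    · right; right
      have h5 := alpha_of_three H ha (e := e)
        (e' := ⟨σ (α (σ (α (σ (α e))))), by rw [H.vertex, h4]; omega⟩) h1 h2 rfl
      rw [h5]
      refine ⟨rfl, h1, h2, ?_⟩
      rw [H.vertex]; omega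
    · right; left
      have h5 := alpha_of_two H ha (e := e)
        (e' := ⟨σ (α (σ (α e))), by rw [H.vertex, h2]⟩) h1 rfl
      rw [h5]
      refine ⟨rfl, h1, ?_⟩
      rw [H.vertex]; omega
  · left
    have h5 := alpha_of_one ha (e := e) (e' := ⟨σ (α e), by rw [H.vertex, h1]⟩) rfl
    rw [h5]
    refine ⟨rfl, h1, ?_⟩
    rw [H.vertex]; omega

/-- Around a face the label makes four steps `±1` and closes up, so exactly two of its arcs descend,
and `a` exchanges them. -/
theorem alpha_invol (e : Down α l) : a (a e) = e := by
  obtain ⟨h1, h2, h3, h4⟩ := H.labels e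
  have he := e.2
  rcases alpha_cases H ha e with ⟨h5, h6, -⟩ | ⟨h5, h6, -⟩ | ⟨h5, h6, h7, -⟩
  · refine alpha_of_three H ha ?_ ?_ ?_ <;> rw [h5]
    · omega
    · omega
    · exact H.phi_four _
  · have : l (a e : D) = l (α (σ (α e))) := by rw [h5, H.vertex]
    have h8 := (a e).2
    rw [this, h5] at h8
    refine alpha_of_two H ha ?_ ?_ <;> rw [h5]
    · omega
    · exact H.phi_four _
  · refine alpha_of_one ha ?_
    rw [h5, H.phi_four]

theorem alpha_ne (e : Down α l) : a e ≠ e := by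
  intro h
  have h1 := congrArg Subtype.val h
  rcases alpha_cases H ha e with ⟨h5, h6, h7⟩ | ⟨h5, h6, -⟩ | ⟨h5, h6, h7, h8⟩
  · rw [h1] at h7; omega
  · exact H.phi_two_ne _ (h5.symm.trans h1)
  · rw [h1] at h8; omega

theorem label_alpha (e : Down α l) : |l (a e : D) - l e| ≤ 1 := by
  rw [abs_le]
  rcases alpha_cases H ha e with ⟨-, -, h⟩ | ⟨-, -, h⟩ | ⟨-, -, -, h⟩ <;> omega

include hr

omit ha in
theorem label_rho (e : Down α l) : l (r e : D) = l e := by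
  obtain ⟨k, -, hk, -⟩ := hr e
  rw [← hk]
  clear hk
  induction k with
  | zero => rfl
  | succ k ih => rw [pow_succ', Perm.mul_apply, H.vertex, ih]

/-- All ascending arcs following the descending arc `e` around its origin are, once reversed,
reached from `e`. -/
def Fan (σ : Perm D) (a r : Perm (Down α l)) (e : Down α l) : Prop :=
  ∀ i, 0 < i → (∀ j, 0 < j → j ≤ i → ¬ l (α ((σ ^ j) e)) = l ((σ ^ j) e) - 1) →
    ∀ f : Down α l, (f : D) = α ((σ ^ i) e) → Reach (a * r) (fun x => l x) e f

/-- The step from an ascending arc to the next ascending arc around a vertex. -/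
theorem exists_reach_of_phi {e f : Down α l} (h : σ (α e) = α f) (hf : Fan σ a r f) :
    ∃ g, (g = f ∨ Reach (a * r) (fun x => l x) f g) ∧ (a * r) g = e := by
  have hup := H.up_alpha f.2
  -- The face of `e` continues with the ascending arc `α f`, which excludes the first shape. In the
  -- second, `σ f = a e`; in the third, `σ f` ascends and its reverse `g` satisfies `σ g = a e`.
  rcases alpha_cases H ha e with ⟨h5, h6, h7⟩ | ⟨h5, h6, -⟩ | ⟨h5, h6, h7, h8⟩
  · have := (a e).2
    rw [h5, h] at this
    omega
  · refine ⟨f, Or.inl rfl, apply_rho (alpha_invol H ha) (rho_of_one hr ?_)⟩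
    rw [h5, h, H.invol]
  · have h9 : l (α (σ f)) = l (σ f) + 1 := by
      rw [h, H.invol] at h7
      rw [h7, H.vertex]
    refine ⟨⟨α (σ f), H.down_alpha h9⟩, Or.inr (hf 1 one_pos (fun j h1 h2 => ?_) _ (by simp)),
      apply_rho (alpha_invol H ha) (rho_of_one hr ?_)⟩
    · obtain rfl : j = 1 := by omega
      rw [pow_one]
      omega
    · rw [h5, h, H.invol]

variable [Finite D]

/-- Two nested inductions: on labels from the largest downwards, since the fans used belong to
reversed ascending arcs, whose labels are larger by one; and around the vertex, backwards from the
next descending arc. -/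
theorem fan (e : Down α l) : Fan σ a r e := by
  have : Nonempty (Down α l) := ⟨e⟩
  obtain ⟨M, hM⟩ := Finite.exists_max (fun x : Down α l => l x)
  generalize hN : (l M - l e).toNat = N
  induction N using Nat.strong_induction_on generalizing e with
  | _ N ih =>
    obtain ⟨k, hk, hk1, hk2⟩ := hr e
    have hlab : ∀ i, l ((σ ^ i) e) = l e := by
      intro i
      induction i with
      | zero => rfl
      | succ i ih => rw [pow_succ', Perm.mul_apply, H.vertex, ih]
    have key : ∀ t i, i + 1 + t = k → 0 < i → ∀ f : Down α l, (f : D) = α ((σ ^ i) e) →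
        Reach (a * r) (fun x => l x) e f := by
      intro t
      induction t with
      -- The last ascending arc before `r e`: its reverse `f` has `a f = r e`, so it is the image of
      -- `e` under `a * r`.
      | zero =>
        rintro i rfl hi f hf
        have h1 : σ (α f) = r e := by
          rw [hf, H.invol, ← Perm.mul_apply, ← pow_succ']
          exact hk1
        have h2 : (a * r) e = f := apply_rho (alpha_invol H ha) (alpha_of_one ha h1).symm
        have h3 : l (e : D) < l (f : D) := by
          have := f.2
          rw [hf, H.invol, hlab] at this
          rw [hf]
          omega
        have h4 := Reach.of_apply (ψ := a * r) (m := fun x => l x) (a := e) (by rw [h2]; exact h3)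
        rwa [h2] at h4
      | succ t iht =>
        intro i hik hi f hf
        have h1 : ¬ l (α ((σ ^ (i + 1)) e)) = l ((σ ^ (i + 1)) e) - 1 := fun h =>
          hk2 (i + 1) (by omega) (by omega) ⟨⟨_, h⟩, rfl⟩
        let g : Down α l := ⟨α ((σ ^ (i + 1)) e), H.down_alpha (H.up_of_not_down h1)⟩
        have h2 : Reach (a * r) (fun x => l x) e g := iht (i + 1) (by omega) (by omega) g rfl
        have h3 : σ (α f) = α g := by
          rw [hf, H.invol, ← Perm.mul_apply, ← pow_succ', H.invol]
        have h4 := h2.lt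
        have h5 := hM g
        obtain ⟨x, hx, hx'⟩ := exists_reach_of_phi H ha hr h3
          (ih (l M - l g).toNat (by omega) g rfl)
        have h6 : Reach (a * r) (fun x => l x) e x := by
          rcases hx with rfl | hx
          · exact h2
          · exact h2.trans hx
        have h7 : l (e : D) < l (f : D) := by
          have := f.2
          rw [hf, H.invol, hlab] at this
          rw [hf]
          omega
        rw [← hx']
        exact h6.step (by rw [hx']; exact h7)
    intro i hi hj f hf
    have hik : i < k := by
      by_contra hik
      apply hj k hk (by omega)
      rw [hk1]
      exact (r e).2
    exact key (k - 1 - i) i (by omega) hi f hf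

/-- At a local minimum every arc ascends, so consecutive arcs can be linked by
`exists_reach_of_phi`. -/
theorem sameCycle_of_target_eq (e : Down α l)
    (hs : ∀ x, σ.SameCycle (α e) x → l (α x) = l x + 1) (f : Down α l)
    (hf : σ.SameCycle (α e) (α f)) : (a * r).SameCycle e f := by
  obtain ⟨k, hk⟩ := hf.exists_nat_pow_eq
  clear hf
  induction k generalizing f with
  | zero =>
    obtain rfl : e = f := Subtype.ext (α.injective hk)
    exact Perm.SameCycle.rfl
  | succ k ih =>
    let g : Down α l := ⟨α ((σ ^ k) (α e)), H.down_alpha (hs _ ⟨k, by simp⟩)⟩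
    have hg : (σ ^ k) (α e) = α g := (H.invol _).symm
    refine (ih g hg).trans ?_
    rw [pow_succ', Perm.mul_apply, hg] at hk
    obtain ⟨x, hx, hx'⟩ := exists_reach_of_phi H ha hr hk (fan H ha hr f)
    have h1 : (a * r).SameCycle f x := by
      rcases hx with rfl | hx
      · exact Perm.SameCycle.rfl
      · exact hx.sameCycle
    rw [← hx']
    exact (Perm.sameCycle_apply_left.2 h1.symm)

/-- The last descending arc met before `α e` around the target of `e` has `e` in its fan. -/
theorem exists_sameCycle_lower (e : Down α l) (x : D) (hx : σ.SameCycle (α e) x)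
    (hd : l (α x) = l x - 1) : ∃ f : Down α l, (a * r).SameCycle e f ∧ l (f : D) < l (e : D) := by
  classical
  obtain ⟨k, hk⟩ := hx.symm.exists_nat_pow_eq
  have hex : ∃ k, ∃ f : Down α l, (σ ^ k) f = α e := ⟨k, ⟨x, hd⟩, hk⟩
  obtain ⟨f, hf⟩ := Nat.find_spec hex
  have hmin := fun j (hj : j < Nat.find hex) => Nat.find_min hex hj
  set m := Nat.find hex
  have hm : 0 < m := by
    by_contra h0
    obtain h0 : m = 0 := by omega
    rw [h0, pow_zero, Perm.one_apply] at hf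
    have h1 := f.2
    rw [hf] at h1
    have := H.up_alpha e.2
    omega
  have hreach := fan H ha hr f m hm (fun j hj hjm hd => by
    refine hmin (m - j) (by omega) ⟨⟨_, hd⟩, ?_⟩
    rw [← Perm.mul_apply, ← pow_add, Nat.sub_add_cancel hjm, hf]) e (by rw [hf, H.invol])
  exact ⟨f, hreach.sameCycle.symm, hreach.lt⟩

/-- Passing to lower and lower arcs ends with an arc into a local minimum, and there is only one.
Hence the opened map has a single face. -/
theorem sameCycle_psi (e f : Down α l) : (a * r).SameCycle e f := by
  have : Nonempty (Down α l) := ⟨e⟩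
  obtain ⟨M, hM⟩ := Finite.exists_min (fun x : Down α l => l x)
  have key : ∀ e : Down α l, ∃ f : Down α l, (a * r).SameCycle e f ∧
      ∀ x, σ.SameCycle (α f) x → l (α x) = l x + 1 := by
    intro e
    generalize hN : (l e - l M).toNat = N
    induction N using Nat.strong_induction_on generalizing e with
    | _ N ih =>
      by_cases h : ∀ x, σ.SameCycle (α e) x → l (α x) = l x + 1
      · exact ⟨e, Perm.SameCycle.rfl, h⟩
      · push Not at h
        obtain ⟨x, hx, hx'⟩ := h
        obtain ⟨f, hf, hlt⟩ := exists_sameCycle_lower H ha hr e x hx ((H.edge x).resolve_left hx')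
        have := hM f
        obtain ⟨g, hg, hg'⟩ := ih (l f - l M).toNat (by omega) f rfl
        exact ⟨g, hf.trans hg, hg'⟩
  obtain ⟨e', he, he'⟩ := key e
  obtain ⟨f', hf, hf'⟩ := key f
  exact he.trans ((sameCycle_of_target_eq H ha hr e' he' f' (H.sink _ _ he' hf')).trans hf.symm)

-- By `quadSigma_isFirstReturn` the vertex rotation of the gluing must be `r⁻¹`, which forces the
-- next-side permutation to be `r⁻¹ * a = (a * r)⁻¹`.
omit [Finite D] in
theorem isLabelledGluing : IsLabelledGluing (a * r)⁻¹ a (fun x : Down α l => l x) where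
  invol := alpha_invol H ha
  ne := alpha_ne H ha
  next e := by
    have h : (a * r) ((a * r)⁻¹ e) = e := perm_apply_inv_self _ _
    rw [Perm.mul_apply] at h
    have h1 := label_rho H hr ((a * r)⁻¹ e)
    have h2 : a e = r ((a * r)⁻¹ e) := by
      nth_rw 1 [← h]
      exact alpha_invol H ha _
    rw [h2]
    exact h1.symm
  edge := label_alpha H ha

end

/-- Opening a labelled quadrangulation and closing it again. -/
theorem exists_gluing [Finite D] (H : IsLabelledQuad σ α l) :
    ∃ (τ a : Perm (Down α l)) (G : IsLabelledGluing τ a (fun x : Down α l => l x))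
      (g : Down α l × Bool ≃ D), (∀ x y, τ.SameCycle x y) ∧ (∀ e, g (e, true) = e) ∧
      (∀ x, g (quadAlpha _ x) = α (g x)) ∧ ∀ x, g (quadSigma G x) = σ (g x) := by
  obtain ⟨a, ha⟩ := exists_isFirstReturn (σ * α) (fun d => l (α d) = l d - 1)
  obtain ⟨r, hr⟩ := exists_isFirstReturn σ (fun d => l (α d) = l d - 1)
  have G := isLabelledGluing H ha hr
  let g₀ : Down α l × Bool → D := fun x => if x.2 then x.1 else α x.1
  have hg : Function.Bijective g₀ := by
    constructor
    · rintro ⟨e, b⟩ ⟨f, c⟩ h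
      have he := e.2
      have hf := f.2
      cases b <;> cases c <;> simp only [g₀, if_true, if_false, Bool.false_eq_true] at h
      · rw [Subtype.ext (α.injective h)]
      · rw [← h, H.invol] at hf
        omega
      · rw [h, H.invol] at he
        omega
      · rw [Subtype.ext h]
    · intro d
      rcases H.edge d with hd | hd
      · exact ⟨(⟨α d, H.down_alpha hd⟩, false), by simp [g₀, H.invol]⟩
      · exact ⟨(⟨d, hd⟩, true), by simp [g₀]⟩
  have hα : ∀ x, g₀ (quadAlpha _ x) = α (g₀ x) := by
    rintro ⟨e, b⟩
    cases b <;> simp [g₀, quadAlpha, H.invol]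
  refine ⟨(a * r)⁻¹, a, G, Equiv.ofBijective g₀ hg,
    fun x y => Perm.sameCycle_inv.2 (sameCycle_psi H ha hr x y), fun e => by simp [g₀], hα, ?_⟩
  rintro ⟨e, b⟩
  rw [quadSigma_apply]
  simp only [Equiv.ofBijective_apply]
  have hnext := G.next e
  cases b with
  | false =>
    simp only [Bool.not_false, g₀, if_false, Bool.false_eq_true]
    rcases alpha_cases H ha e with ⟨h5, h6, h7⟩ | ⟨h5, h6, h7⟩ | ⟨h5, h6, -, h7⟩
    · rw [quadFace_of_lt (by omega)]
      simp [h5]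
    -- Here `σ (α e)` is the reverse of a descending arc `f` with the label of `e`. The iterates of
    -- `a * r` go from `f` to `e` through larger labels only, so `f` is the next side after `e`
    -- whose label is not larger.
    all_goals
      rw [quadFace_of_le (by omega)]
      have hup : l (α (σ (α e))) = l (σ (α e)) + 1 := by rw [h6, H.vertex]
      let f : Down α l := ⟨α (σ (α e)), H.down_alpha hup⟩
      have hf : σ (α e) = α f := (H.invol _).symm
      obtain ⟨x, hx, hx'⟩ := exists_reach_of_phi H ha hr hf (fan H ha hr f)
      have hlab : l (f : D) = l (e : D) := by
        have := e.2
        show l (α (σ (α e))) = _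
        omega
      have hN : IsNextLE (a * r) (fun x : Down α l => l x) f e := by
        rcases hx with rfl | hx
        · exact ⟨1, one_pos, by simpa using hx', hlab.ge, fun j _ _ => by omega⟩
        · rw [← hx']
          exact hx.isNextLE (by rw [hx']; exact hlab.ge)
      rw [(hN.inv hlab.symm).eq_nextLE]
      simp [hf]
  | true =>
    simp only [Bool.not_true, g₀, if_true]
    -- An ascending arc following `e` corresponds to an arc arriving at the corner `e`, which
    -- decides between the two branches of `quadFace`.
    by_cases hd : l (α (σ e)) = l (σ e) - 1
    · have h1 : r e = ⟨σ e, hd⟩ := rho_of_one hr rfl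
      have h2 : (a * r) e = a ⟨σ e, hd⟩ := by rw [Perm.mul_apply, h1]
      have h3 : l ((a * r) e : Down α l).1 ≤ l e := by
        rw [h2]
        have h8 := H.vertex e
        rcases alpha_cases H ha ⟨σ e, hd⟩ with ⟨h5, h6, h7⟩ | ⟨h5, h6, h7⟩ | ⟨h5, -, -, h7⟩
        · simp only at h7; omega
        · simp only at h7; omega
        · exfalso
          have h9 := (a ⟨σ e, hd⟩).2
          have h10 := H.phi_four (α e)
          rw [H.invol] at h10
          simp only at h5
          rw [h5, h10, H.invol] at h9
          have := e.2
          omega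
      rw [quadFace, inv_inv, if_pos h3, h2, alpha_invol H ha]
      simp
    -- Now `f` lies in the fan of `e`, and `(a * r) f` has the label of `e`; it is thus the last
    -- side before `e` whose label is not larger, and `f` comes right after it on the border.
    · let f : Down α l := ⟨α (σ e), H.down_alpha (H.up_of_not_down hd)⟩
      have hreach := fan H ha hr e 1 one_pos (fun j h1 h2 => by
        obtain rfl : j = 1 := by omega
        simpa using hd) f (by simp [f])
      have h3 : l (e : D) < l ((a * r) e : Down α l).1 := by
        obtain ⟨k, hk, -, hk2⟩ := hreach
        simpa using hk2 1 one_pos (by omega)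
      rw [quadFace, inv_inv, if_neg (not_le.2 h3)]
      have h10 := H.phi_four (α e)
      rw [H.invol] at h10
      have hup := H.up_of_not_down hd
      rw [H.vertex] at hup
      have he := e.2
      have hle := H.labels (α e)
      rw [H.invol] at hle
      obtain ⟨-, h2, h4, h5⟩ := hle
      have h6 : l (α (σ (α (σ e)))) = l (σ (α (σ e))) - 1 := by
        rw [H.vertex]; omega
      have h7 : r f = ⟨σ (α (σ e)), h6⟩ := rho_of_one hr rfl
      have h8 : l (α (σ (α (σ (α (σ e)))))) = l (σ (α (σ (α (σ e))))) - 1 := by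
        rw [H.vertex]; omega
      have h9 : (a * r) f = ⟨σ (α (σ (α (σ e)))), h8⟩ := by
        rw [Perm.mul_apply, h7]
        exact alpha_of_one ha rfl
      have hlab : l ((a * r) f : Down α l).1 = l (e : D) := by
        rw [h9]
        show l (σ (α (σ (α (σ e))))) = _
        rw [H.vertex]; omega
      have hN := hreach.isNextLE (show l ((a * r) f : Down α l).1 ≤ l (e : D) from hlab.le)
      rw [hN.eq_nextLE]
      have : (a * r)⁻¹ ((a * r) f) = f := by simp
      rw [this]
      simp [f, H.invol]

end IsLabelledQuad

end Opening

/-! ### Transport along renumberings -/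

section Transport

variable {E E' : Type*}

theorem IsNextLE.of_semiconj {τ : Perm E} {τ' : Perm E'} {l : E → ℤ} {l' : E' → ℤ} {a b : E}
    (h : IsNextLE τ l a b) (e : E ≃ E') (hτ : ∀ x, e (τ x) = τ' (e x)) (hl : ∀ x, l' (e x) = l x) :
    IsNextLE τ' l' (e a) (e b) := by
  have hp : ∀ (k : ℕ) d, e ((τ ^ k) d) = (τ' ^ k) (e d) := by
    intro k
    induction k with
    | zero => simp
    | succ k ih => intro d; rw [pow_succ', pow_succ', Perm.mul_apply, Perm.mul_apply, hτ, ih]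
  obtain ⟨k, hk, rfl, hk1, hk2⟩ := h
  refine ⟨k, hk, (hp k a).symm, by rwa [hl, hl], fun j h1 h2 => ?_⟩
  rw [← hp, hl, hl]
  exact hk2 j h1 h2

theorem quadSigma_semiconj [Finite E] [Finite E'] {τ α : Perm E} {τ' α' : Perm E'} {l : E → ℤ}
    {l' : E' → ℤ} (H : IsLabelledGluing τ α l) (H' : IsLabelledGluing τ' α' l') (e : E ≃ E')
    (hτ : ∀ x, e (τ x) = τ' (e x)) (hα : ∀ x, e (α x) = α' (e x)) (hl : ∀ x, l' (e x) = l x)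
    (x : E × Bool) : (e.prodCongr (Equiv.refl Bool)) (quadSigma H x) =
      quadSigma H' (e.prodCongr (Equiv.refl Bool) x) := by
  have hτi : ∀ x, e (τ⁻¹ x) = τ'⁻¹ (e x) := fun x => by
    rw [eq_comm, Perm.inv_eq_iff_eq, ← hτ, perm_apply_inv_self]
  obtain ⟨x, b⟩ := x
  simp only [quadSigma_apply, Equiv.prodCongr_apply, Prod.map, Equiv.refl_apply]
  cases b with
  | false =>
    simp only [Bool.not_false, quadFace]
    rw [← hτ, hl, hl, ((nextLE_spec τ l x).of_semiconj e hτ hl).eq_nextLE]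
    split_ifs <;> simp [hα]
  | true =>
    simp only [Bool.not_true, quadFace]
    rw [← hτi, hl, hl, ((nextLE_spec τ⁻¹ l x).of_semiconj e hτi hl).eq_nextLE, ← hα, ← hτ]
    split_ifs <;> simp

theorem IsLabelledQuad.of_semiconj {D D' : Type*} {σ α : Perm D} {σ' α' : Perm D'} {l : D → ℤ}
    {l' : D' → ℤ} (H : IsLabelledQuad σ α l) (e : D ≃ D') (hσ : ∀ x, e (σ x) = σ' (e x))
    (hα : ∀ x, e (α x) = α' (e x)) (hl : ∀ x, l' (e x) = l x) : IsLabelledQuad σ' α' l' := by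
  obtain rfl : e.permCongr σ = σ' := by
    ext1 x
    rw [Equiv.permCongr_apply, hσ, Equiv.apply_symm_apply]
  obtain rfl : e.permCongr α = α' := by
    ext1 x
    rw [Equiv.permCongr_apply, hα, Equiv.apply_symm_apply]
  obtain rfl : l ∘ e.symm = l' := by
    funext x
    rw [Function.comp_apply, ← hl, Equiv.apply_symm_apply]
  have hs : ∀ x y, (e.permCongr σ).SameCycle x y ↔ σ.SameCycle (e.symm x) (e.symm y) := by
    intro x y
    have hz : ∀ i : ℤ, (e.permCongr σ) ^ i = e.permCongr (σ ^ i) := fun i =>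
      (map_zpow (Equiv.permCongrHom e) σ i).symm
    simp only [Perm.SameCycle, hz, Equiv.permCongr_apply, ← Equiv.eq_symm_apply]
  constructor
  · intro d; simp [H.invol]
  · intro d; simp [H.vertex]
  · intro d; simpa using H.edge _
  · intro d
    have := H.face (e.symm d)
    simp only [Perm.mul_apply] at this
    simp [Perm.mul_apply, Equiv.permCongr_apply, this]
  · intro d h
    have := H.face_ne (e.symm d)
    simp only [Perm.mul_apply] at this
    simp only [Perm.mul_apply, Equiv.permCongr_apply, Equiv.symm_apply_apply] at h
    exact this ((Equiv.eq_symm_apply _).2 h)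
  · intro d d'
    obtain ⟨g, hg, hgd⟩ := H.connected (e.symm d) (e.symm d')
    refine ⟨e.permCongr g, ?_, by simp [hgd]⟩
    have h1 : e.permCongr g ∈ (Subgroup.closure {σ, α}).map (Equiv.permCongrHom e).toMonoidHom :=
      ⟨g, hg, rfl⟩
    rw [MonoidHom.map_closure, Set.image_pair] at h1
    exact h1
  · intro d d' h h'
    rw [hs]
    refine H.sink _ _ (fun x hx => ?_) (fun x hx => ?_)
    · simpa using h (e x) (by rw [hs, Equiv.symm_apply_apply]; exact hx)
    · simpa using h' (e x) (by rw [hs, Equiv.symm_apply_apply]; exact hx)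

end Transport

/-! ### The bijection between one-face maps and labelled quadrangulations -/

section LabelledQuadrangulations

variable {n : ℕ}

/-- Labelled quadrangulations of genus one with `n` faces, rooted at a descending arc. -/
def rootedQuads (n : ℕ) : Set ((Perm (Fin (2 * (2 * n))) × Perm (Fin (2 * (2 * n)))) ×
    (Fin (2 * (2 * n)) → ℤ) × Fin (2 * (2 * n))) :=
  {q | IsLabelledQuad q.1.1 q.1.2 q.2.1 ∧ q.2.1 q.2.2 = 1 ∧ q.2.1 (q.1.2 q.2.2) = 0 ∧
    cycleCount q.1.1 = n}

theorem pos_of_mem_oneTrees {p : Perm (Fin (2 * n)) × (Fin (2 * n) → ℤ)} (hp : p ∈ oneTrees n) :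
    0 < 2 * n := by
  have := hp.2.2
  omega

/-- The rooted quadrangulation built on a one-face map, with an arbitrary numbering. -/
noncomputable def closeTree (x : oneTrees n × (Fin (2 * n) × Bool ≃ Fin (2 * (2 * n)))) :
    rootedQuads n :=
  ⟨((x.2.permCongr (quadSigma x.1.2.1), x.2.permCongr (quadAlpha _)),
    quadLabel x.1.1.2 ∘ x.2.symm, x.2 (⟨0, pos_of_mem_oneTrees x.1.2⟩, true)), by
    obtain ⟨⟨⟨α, l⟩, hp⟩, g⟩ := x
    have hpos := pos_of_mem_oneTrees hp
    have : Nonempty (Fin (2 * n)) := ⟨⟨0, hpos⟩⟩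
    have h0 : l ⟨0, hpos⟩ = 1 := hp.2.1 _ rfl
    refine ⟨?_, ?_, ?_, ?_⟩
    · exact (isLabelledQuad_quadSigma hp.1 finRotate_sameCycle).of_semiconj g (by simp) (by simp)
        (by simp)
    · simp [quadLabel, h0]
    · simp [quadLabel, quadAlpha, h0]
    · rw [← cycleCount_eq_of_semiconj (f := quadSigma hp.1) g (by simp),
        cycleCount_quadSigma hp.1 finRotate_sameCycle]
      exact hp.2.2⟩

/-- The change of numbering `k` preserves labels, hence descending arcs. By uniqueness of
first-return maps it carries one gluing and its rotation to the other, and as it fixes the root it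
is the identity. -/
theorem closeTree_injective : Function.Injective (closeTree (n := n)) := by
  rintro ⟨⟨⟨α, l⟩, hp⟩, g⟩ ⟨⟨⟨α', l'⟩, hp'⟩, g'⟩ h
  have hpos := pos_of_mem_oneTrees hp
  simp only [closeTree, Subtype.mk.injEq, Prod.mk.injEq] at h
  obtain ⟨⟨hσ, hα⟩, hl, hr⟩ := h
  let k : Fin (2 * n) × Bool ≃ Fin (2 * n) × Bool := g.trans g'.symm
  have hg : ∀ x, g' (k x) = g x := fun x => by simp [k]
  have kσ : ∀ x, k (quadSigma hp.1 x) = quadSigma hp'.1 (k x) := fun x => by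
    apply g'.injective
    have := Equiv.congr_fun hσ (g x)
    rw [Equiv.permCongr_apply, Equiv.permCongr_apply, Equiv.symm_apply_apply] at this
    rw [hg, this]
    rfl
  have kα : ∀ x, k (quadAlpha _ x) = quadAlpha _ (k x) := fun x => by
    apply g'.injective
    have := Equiv.congr_fun hα (g x)
    rw [Equiv.permCongr_apply, Equiv.permCongr_apply, Equiv.symm_apply_apply] at this
    rw [hg, this]
    rfl
  have kl : ∀ x, quadLabel l' (k x) = quadLabel l x := fun x => by
    have := congr_fun hl (g x)
    simp only [Function.comp_apply, Equiv.symm_apply_apply] at this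
    rw [this]
    rfl
  have k0 : k (⟨0, hpos⟩, true) = (⟨0, hpos⟩, true) := g'.injective (by rw [hg, hr])
  have ktrue : ∀ e, (k (e, true)).2 = true := by
    intro e
    have h1 := kl (quadAlpha _ (e, true))
    have h2 := kl (e, true)
    rw [kα] at h1
    generalize k (e, true) = y at h1 h2
    obtain ⟨y, b⟩ := y
    cases b with
    | true => rfl
    | false =>
      simp only [quadLabel, quadAlpha, Equiv.coe_fn_mk, Bool.not_true, Bool.not_false] at h1 h2
      omega
  let f : Fin (2 * n) → Fin (2 * n) := fun e => (k (e, true)).1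
  have hf : ∀ e, k (e, true) = (f e, true) := fun e => Prod.ext rfl (ktrue e)
  have hfinj : Function.Injective f := fun a b hab => by
    have : k (a, true) = k (b, true) := by rw [hf, hf, hab]
    simpa using k.injective this
  let b : Fin (2 * n) ≃ Fin (2 * n) := Equiv.ofBijective f (Finite.injective_iff_bijective.1 hfinj)
  have eα : b.permCongr α = α' :=
    ((quadPhi_isFirstReturn hp.1).of_semiconj k b (fun d => by
      have : ∀ H : IsLabelledGluing (finRotate (2 * n)) α l, quadPhi H =
          quadSigma H * quadAlpha _ := fun H => by
        ext1 d; simp [quadSigma, quadAlpha]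
      have h2 : ∀ H : IsLabelledGluing (finRotate (2 * n)) α' l', quadPhi H =
          quadSigma H * quadAlpha _ := fun H => by
        ext1 d; simp [quadSigma, quadAlpha]
      rw [this hp.1, h2 hp'.1, Perm.mul_apply, Perm.mul_apply, kσ, kα]) hf).unique
      (quadPhi_isFirstReturn hp'.1) (fun a b h => (Prod.ext_iff.1 h).1)
  have eσ : b.permCongr (finRotate (2 * n) * α)⁻¹ = (finRotate (2 * n) * α')⁻¹ :=
    ((quadSigma_isFirstReturn hp.1).of_semiconj k b kσ hf).unique
      (quadSigma_isFirstReturn hp'.1) (fun a b h => (Prod.ext_iff.1 h).1)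
  have hbα : ∀ d, b (α d) = α' (b d) := fun d => by
    rw [← eα, Equiv.permCongr_apply, Equiv.symm_apply_apply]
  have hbτ : ∀ d, f (finRotate (2 * n) d) = finRotate (2 * n) (f d) := fun d => by
    have h1 : b ((finRotate (2 * n) * α)⁻¹ (finRotate (2 * n) d)) =
        (finRotate (2 * n) * α')⁻¹ (b (finRotate (2 * n) d)) := by
      rw [← eσ, Equiv.permCongr_apply, Equiv.symm_apply_apply]
    have h2 : (finRotate (2 * n) * α)⁻¹ (finRotate (2 * n) d) = α d := by
      rw [Perm.inv_eq_iff_eq, Perm.mul_apply, hp.1.invol]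
    rw [h2, hbα, eq_comm, Perm.inv_eq_iff_eq, Perm.mul_apply, hp'.1.invol] at h1
    exact h1
  have hid : f = id := eq_of_semiconj finRotate_sameCycle hbτ (fun d => rfl)
    (r := ⟨0, hpos⟩) (by simp [f, k0])
  have hb : b = Equiv.refl _ := by
    ext1 x
    exact congr_fun hid x
  have hk : ∀ x, k x = x := by
    have h1 : ∀ e, k (e, true) = (e, true) := fun e => by rw [hf, hid]; rfl
    rintro ⟨e, c⟩
    cases c with
    | true => exact h1 e
    | false =>
      have := kα (e, true)
      rw [h1] at this
      exact this
  have e1 : α = α' := by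
    ext1 d
    have := hbα d
    rwa [hb] at this
  have e2 : l = l' := by
    funext d
    have := kl (d, true)
    rw [hk] at this
    exact this.symm
  have e3 : g = g' := by
    ext1 x
    rw [← hg, hk]
  subst e1 e2 e3
  rfl

/-- The quadrangulation is opened, and the sides of the result are numbered from the root, which is
a descending arc and hence a side. -/
theorem closeTree_surjective : Function.Surjective (closeTree (n := n)) := by
  rintro ⟨⟨⟨σ, α⟩, l, r⟩, hq⟩
  obtain ⟨H, hr, hr', hc⟩ := hq
  simp only at H hr hr' hc
  obtain ⟨τ, a, G, g, hτ, hgt, hgα, hgσ⟩ := H.exists_gluing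
  have hpos : 0 < 2 * n := by
    have := r.2
    omega
  have hcard : Fintype.card (Down α l) = 2 * n := by
    have := Fintype.card_congr g
    simp only [Fintype.card_prod, Fintype.card_bool, Fintype.card_fin] at this
    omega
  let r' : Down α l := ⟨r, by omega⟩
  obtain ⟨e, he, he0⟩ := exists_equiv_finRotate τ hτ r' hcard hpos
  have hGα : ∀ d, e (e.symm.permCongr a d) = a (e d) := fun d => by
    simp [Equiv.permCongr_apply]
  have G' : IsLabelledGluing (finRotate (2 * n)) (e.symm.permCongr a) (fun d => l (e d)) :=
    G.of_semiconj e.symm (fun d => by rw [Equiv.symm_apply_eq, he, Equiv.apply_symm_apply])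
      (fun d => by rw [Equiv.symm_apply_eq, hGα, Equiv.apply_symm_apply]) 0 (fun d => by simp)
  let g' : Fin (2 * n) × Bool ≃ Fin (2 * (2 * n)) := (e.prodCongr (Equiv.refl Bool)).trans g
  have hg'σ : ∀ x, g' (quadSigma G' x) = σ (g' x) := fun x => by
    simp only [g', Equiv.trans_apply]
    rw [quadSigma_semiconj G' G e he hGα (fun _ => rfl), hgσ]
  have hg'α : ∀ x, g' (quadAlpha _ x) = α (g' x) := fun x => by
    simp only [g', Equiv.trans_apply]
    rw [← hgα]
    rfl
  have hg'l : ∀ x, l (g' x) = quadLabel (fun d => l (e d)) x := by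
    have h1 : ∀ d, l (g' (d, true)) = l (e d) := fun d => congrArg l (hgt (e d))
    rintro ⟨d, b⟩
    cases b with
    | true => exact h1 d
    | false =>
      have h2 : g' (d, false) = α (g' (d, true)) := hg'α (d, true)
      have h3 : g' (d, true) = e d := hgt (e d)
      rw [h2, h3, (e d).2]
      rfl
  have : Nonempty (Fin (2 * n)) := ⟨⟨0, hpos⟩⟩
  refine ⟨⟨⟨⟨e.symm.permCongr a, fun d => l (e d)⟩, G', fun d hd => ?_, ?_⟩, g'⟩, ?_⟩
  · have hd' : d = ⟨0, hpos⟩ := Fin.ext hd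
    rw [hd']
    simp only [he0]
    exact hr
  · exact (cycleCount_quadSigma G' finRotate_sameCycle).symm.trans
      ((cycleCount_eq_of_semiconj g' hg'σ).trans hc)
  · refine Subtype.ext (Prod.ext (Prod.ext ?_ ?_) (Prod.ext ?_ ?_))
    · ext1 x
      simp only [closeTree, Equiv.permCongr_apply]
      rw [hg'σ, Equiv.apply_symm_apply]
    · ext1 x
      simp only [closeTree, Equiv.permCongr_apply]
      rw [hg'α, Equiv.apply_symm_apply]
    · funext x
      simp only [closeTree, Function.comp_apply]
      rw [← hg'l, Equiv.apply_symm_apply]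
    · have h3 : g' (⟨0, hpos⟩, true) = e ⟨0, hpos⟩ := hgt _
      simp only [closeTree]
      rw [h3, he0]

/-- The factorial counts the numberings of the `4 n` arcs of the closed map. -/
theorem card_rootedQuads (n : ℕ) :
    Nat.card (rootedQuads n) = Nat.card (oneTrees n) * (2 * (2 * n)).factorial := by
  rw [← Nat.card_eq_of_bijective _ ⟨closeTree_injective (n := n), closeTree_surjective⟩,
    Nat.card_prod]
  congr 1
  have e : Fin (2 * n) × Bool ≃ Fin (2 * (2 * n)) :=
    Fintype.equivOfCardEq (by simp; ring)
  rw [Nat.card_eq_fintype_card, Fintype.card_equiv e]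
  simp
  ring_nf

end LabelledQuadrangulations

/-! ### Cycles of length four -/

section Degree

variable {D : Type*} [Finite D]

/-- A cycle has length four iff the fourth power, but not the square, fixes a point. -/
theorem card_sameCycle_eq_four_iff (f : Perm D) (d : D) :
    Nat.card {e // f.SameCycle d e} = 4 ↔ f (f (f (f d))) = d ∧ f (f d) ≠ d := by
  have h1 : Nat.card {e // f.SameCycle d e} = Function.minimalPeriod f d := by
    rw [← Nat.card_fin (Function.minimalPeriod f d)]
    have hpos : 0 < Function.minimalPeriod f d := by
      rw [Function.minimalPeriod_pos_iff_mem_periodicPts]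
      refine ⟨orderOf f, orderOf_pos f, ?_⟩
      rw [Function.IsPeriodicPt, ← Perm.coe_pow, pow_orderOf_eq_one]
      rfl
    refine (Nat.card_eq_of_bijective (fun i : Fin (Function.minimalPeriod f d) =>
      (⟨f^[i] d, i, by rw [zpow_natCast, Perm.coe_pow]⟩ : {e // f.SameCycle d e})) ⟨?_, ?_⟩).symm
    · intro i j h
      have h := congrArg Subtype.val h
      exact Fin.ext (Function.iterate_injOn_Iio_minimalPeriod i.2 j.2 h)
    · rintro ⟨e, he⟩
      obtain ⟨k, rfl⟩ := he.exists_nat_pow_eq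
      refine ⟨⟨k % Function.minimalPeriod f d, Nat.mod_lt _ hpos⟩, Subtype.ext ?_⟩
      simp only [Function.iterate_mod_minimalPeriod_eq, Perm.coe_pow]
  have h4 : f (f (f (f d))) = d ↔ Function.minimalPeriod f d ∣ 4 :=
    (Function.isPeriodicPt_iff_minimalPeriod_dvd (f := f) (x := d) (n := 4))
  have h2 : f (f d) = d ↔ Function.minimalPeriod f d ∣ 2 :=
    (Function.isPeriodicPt_iff_minimalPeriod_dvd (f := f) (x := d) (n := 2))
  rw [h1, Ne, h4, h2]
  constructor
  · intro h
    rw [h]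
    decide
  · rintro ⟨h, h'⟩
    have := Nat.le_of_dvd (by norm_num) h
    interval_cases Function.minimalPeriod f d <;> omega

theorem cycleCount_mul_of_card_eq (f : Perm D) (k : ℕ)
    (h : ∀ d, Nat.card {e // f.SameCycle d e} = k) : cycleCount f * k = Nat.card D := by
  have : Finite (Quotient (Perm.SameCycle.setoid f)) := Quotient.finite _
  have : Fintype (Quotient (Perm.SameCycle.setoid f)) := Fintype.ofFinite _
  rw [Nat.card_congr (Equiv.sigmaFiberEquiv (Quotient.mk (Perm.SameCycle.setoid f))).symm,
    Nat.card_sigma, Finset.sum_congr rfl (g := fun _ => k), Finset.sum_const, smul_eq_mul,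
    Finset.card_univ, cycleCount, Nat.card_eq_fintype_card]
  intro q _
  induction q using Quotient.inductionOn with
  | _ d =>
    rw [← h d]
    refine Nat.card_congr (Equiv.subtypeEquivRight fun e => ?_)
    rw [Quotient.eq]
    exact Perm.sameCycle_comm

end Degree

/-! ### Distance labellings -/

section Distance

theorem eq_of_sameCycle {D β : Type*} {f : Perm D} {c : D → β} (h : ∀ d, c (f d) = c d) {d e : D}
    (hde : f.SameCycle d e) : c d = c e := by
  obtain ⟨i, rfl⟩ := hde
  induction i with
  | zero => rfl
  | succ i ih => rw [add_comm, zpow_one_add, Perm.mul_apply, h, ih]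
  | pred i ih =>
    rw [ih, ← h ((f ^ (-(i : ℤ) - 1)) d), ← Perm.mul_apply, ← zpow_one_add]
    congr 3
    ring

variable {D : Type*}

/-- There is a walk with `k` edges from the origin of `d₀` to the origin of `d`. -/
def HasWalk (σ α : Perm D) (d₀ : D) : ℕ → D → Prop
  | 0, d => σ.SameCycle d₀ d
  | k + 1, d => ∃ x, σ.SameCycle d x ∧ HasWalk σ α d₀ k (α x)

variable {σ α : Perm D} {d₀ : D}

theorem HasWalk.congr {k : ℕ} {d e : D} (h : HasWalk σ α d₀ k d) (hde : σ.SameCycle d e) :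
    HasWalk σ α d₀ k e := by
  cases k with
  | zero => exact Perm.SameCycle.trans h hde
  | succ k =>
    obtain ⟨x, hx, hx'⟩ := h
    exact ⟨x, hde.symm.trans hx, hx'⟩

theorem HasWalk.alpha (hα : ∀ d, α (α d) = d) {k : ℕ} {d : D} (h : HasWalk σ α d₀ k d) :
    HasWalk σ α d₀ (k + 1) (α d) := ⟨α d, Perm.SameCycle.rfl, by rwa [hα]⟩

theorem exists_hasWalk (hα : ∀ d, α (α d) = d)
    (hc : ∀ d e, ∃ g ∈ Subgroup.closure {σ, α}, g d = e) (d : D) : ∃ k, HasWalk σ α d₀ k d := by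
  obtain ⟨g, hg, rfl⟩ := hc d₀ d
  have key : ∀ d, (∃ k, HasWalk σ α d₀ k d) ↔ ∃ k, HasWalk σ α d₀ k (g d) := by
    induction hg using Subgroup.closure_induction with
    | mem x hx =>
      intro d
      rcases hx with rfl | rfl
      · have h : x.SameCycle d (x d) := Perm.sameCycle_apply_right.2 Perm.SameCycle.rfl
        exact ⟨fun ⟨k, hk⟩ => ⟨k, hk.congr h⟩, fun ⟨k, hk⟩ => ⟨k, hk.congr h.symm⟩⟩
      · refine ⟨fun ⟨k, hk⟩ => ⟨k + 1, hk.alpha hα⟩, fun ⟨k, hk⟩ => ⟨k + 1, ?_⟩⟩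
        have := hk.alpha hα
        rwa [hα] at this
    | one => intro d; rfl
    | mul x y _ _ hx hy => intro d; rw [hy, hx]; rfl
    | inv x _ hx =>
      intro d
      rw [hx (x⁻¹ d), perm_apply_inv_self]
  exact (key d₀).1 ⟨0, Perm.SameCycle.rfl⟩

theorem HasWalk.parity {c : D → Bool} (hσ : ∀ d, c (σ d) = c d) (hα : ∀ d, c (α d) ≠ c d)
    {k : ℕ} {d : D} (h : HasWalk σ α d₀ k d) : Even k ↔ c d = c d₀ := by
  have hs : ∀ {d e}, σ.SameCycle d e → c d = c e := fun h => eq_of_sameCycle hσ h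
  induction k generalizing d with
  | zero => simpa using (hs h).symm
  | succ k ih =>
    obtain ⟨x, hx, hx'⟩ := h
    have h1 : Even k ↔ c (α x) = c d₀ := ih hx'
    have h2 := hα x
    rw [Nat.even_add_one, h1, hs hx]
    revert h2
    generalize c (α x) = u
    generalize c x = v
    generalize c d₀ = w
    revert u v w
    decide

/-- In a connected bipartite quadrangulation the distances to a vertex form a labelling. -/
theorem exists_isLabelledQuad (hα : ∀ d, α (α d) = d)
    (hc : ∀ d e, ∃ g ∈ Subgroup.closure {σ, α}, g d = e)
    (hface : ∀ d, (σ * α) ((σ * α) ((σ * α) ((σ * α) d))) = d)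
    (hface' : ∀ d, (σ * α) ((σ * α) d) ≠ d) {c : D → Bool} (hσc : ∀ d, c (σ d) = c d)
    (hαc : ∀ d, c (α d) ≠ c d) (d₀ : D) : ∃ l : D → ℤ, IsLabelledQuad σ α l ∧ ∀ d, l d₀ ≤ l d := by
  classical
  have hex := exists_hasWalk (d₀ := d₀) hα hc
  let m : D → ℕ := fun d => Nat.find (hex d)
  have hm : ∀ d, HasWalk σ α d₀ (m d) d := fun d => Nat.find_spec (hex d)
  have hmin : ∀ {d k}, HasWalk σ α d₀ k d → m d ≤ k := fun h => Nat.find_min' (hex _) h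
  have hm0 : m d₀ = 0 := Nat.le_zero.1 (hmin (k := 0) Perm.SameCycle.rfl)
  have hle : ∀ d, m (α d) ≤ m d + 1 := fun d => hmin ((hm d).alpha hα)
  have hsame : ∀ {d e}, σ.SameCycle d e → m d = m e := fun h =>
    le_antisymm (hmin ((hm _).congr h.symm)) (hmin ((hm _).congr h))
  have hsink : ∀ d, (∀ x, σ.SameCycle d x → (m (α x) : ℤ) = m x + 1) → σ.SameCycle d₀ d := by
    intro d hd
    have h := hm d
    cases hk : m d with
    | zero => rwa [hk] at h
    | succ k =>
      rw [hk] at h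
      obtain ⟨x, hx, hx'⟩ := h
      have h1 := hmin hx'
      have h2 := hd x hx
      have h3 := hsame hx
      omega
  refine ⟨fun d => m d, ⟨hα, fun d => ?_, fun d => ?_, hface, hface', hc, fun d e hd he => ?_⟩,
    fun d => by simp [hm0]⟩
  · rw [hsame (Perm.sameCycle_apply_left.2 (Perm.SameCycle.refl σ d))]
  · have h1 := hle d
    have h2 := hle (α d)
    rw [hα] at h2
    -- Bipartiteness: the parity of the distance is the colour, and the ends of an edge have
    -- different colours.
    have h3 : m (α d) ≠ m d := by
      intro h
      have h4 := (hm d).parity hσc hαc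
      have h5 := (hm (α d)).parity hσc hαc
      rw [h, h4] at h5
      have := hαc d
      revert this h5
      generalize c (α d) = u
      generalize c d = v
      generalize c d₀ = w
      revert u v w
      decide
    omega
  · exact (hsink d hd).symm.trans (hsink e he)

theorem IsLabelledQuad.label_congr {l : D → ℤ} (H : IsLabelledQuad σ α l) {d e : D}
    (h : σ.SameCycle d e) : l d = l e := eq_of_sameCycle H.vertex h

theorem IsLabelledQuad.up_of_isMin {l : D → ℤ} (H : IsLabelledQuad σ α l)
    (h₀ : ∀ d, l d₀ ≤ l d) (x : D) (hx : σ.SameCycle d₀ x) : l (α x) = l x + 1 := by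
  have := h₀ (α x)
  rw [H.label_congr hx] at this
  have := H.edge x
  omega

/-- Induction on the height above the minimum: except at the only local minimum of `l`, some
neighbour is one lower for `l`, and `l'` changes by one along that edge. -/
theorem IsLabelledQuad.sub_le {l l' : D → ℤ} (H : IsLabelledQuad σ α l)
    (H' : IsLabelledQuad σ α l') (h₀ : ∀ d, l d₀ ≤ l d) (d : D) : l' d - l' d₀ ≤ l d - l d₀ := by
  generalize hN : (l d - l d₀).toNat = N
  induction N using Nat.strong_induction_on generalizing d with
  | _ N ih =>
    by_cases h : ∀ x, σ.SameCycle d x → l (α x) = l x + 1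
    · have h1 := H.sink _ _ h (H.up_of_isMin h₀)
      rw [H.label_congr h1, H'.label_congr h1]
      simp
    · push Not at h
      obtain ⟨x, hx, hx'⟩ := h
      have h1 := (H.edge x).resolve_left hx'
      have h2 := h₀ (α x)
      have h3 := H.label_congr hx
      have h4 := H'.label_congr hx
      have h5 := ih (l (α x) - l d₀).toNat (by omega) (α x) rfl
      have h6 := H'.edge x
      omega

/-- Applied both ways, `IsLabelledQuad.sub_le` shows that the vertex of minimal label determines the
labelling up to a constant. -/
theorem IsLabelledQuad.sub_eq {l l' : D → ℤ} (H : IsLabelledQuad σ α l)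
    (H' : IsLabelledQuad σ α l') {d₁ : D} (h₀ : ∀ d, l d₀ ≤ l d) (h₁ : ∀ d, l' d₁ ≤ l' d)
    (h : σ.SameCycle d₀ d₁) (d : D) : l' d - l' d₀ = l d - l d₀ := by
  refine le_antisymm (H.sub_le H' h₀ d) (H'.sub_le H (fun d => ?_) d)
  rw [H'.label_congr h]
  exact h₁ d

theorem IsLabelledQuad.shift {l : D → ℤ} (H : IsLabelledQuad σ α l) (c : ℤ) :
    IsLabelledQuad σ α (fun d => l d + c) where
  invol := H.invol
  vertex d := by rw [H.vertex]
  edge d := by have := H.edge d; omega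
  face := H.face
  face_ne := H.face_ne
  connected := H.connected
  sink d e hd he := H.sink d e (fun x hx => by have := hd x hx; omega)
    (fun x hx => by have := he x hx; omega)

end Distance

/-! ### Counting pointed rooted quadrangulations -/

section Counting

variable {n : ℕ}

/-- The bipartite quadrangulations of the torus with `n` faces and numbered arcs. -/
def quadMaps (n : ℕ) : Set (CMap (2 * n)) :=
  {M | M.HasGenus 1 ∧ M.IsQuadrangulation ∧ M.IsBipartite ∧ Nat.card M.Face = n}

/-- The same, rooted. -/
def rootedQuadMaps (n : ℕ) : Set (RootedMap (2 * n)) :=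
  {M | M.HasGenus 1 ∧ M.IsQuadrangulation ∧ M.IsBipartite ∧ Nat.card M.Face = n}

theorem card_rootedQuadMaps (n : ℕ) :
    Nat.card (rootedQuadMaps n) = Nat.card (quadMaps n) * (2 * (2 * n)) := by
  let e : rootedQuadMaps n ≃ quadMaps n × Fin (2 * (2 * n)) :=
    { toFun := fun M => (⟨M.1.toCMap, M.2⟩, M.1.root)
      invFun := fun x => ⟨⟨x.1.1, x.2⟩, x.1.2⟩
      left_inv := fun M => rfl
      right_inv := fun x => rfl }
  rw [Nat.card_congr e, Nat.card_prod, Nat.card_fin]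

/-- The map underlying a labelled quadrangulation. -/
def toCMap (q : rootedQuads n) : CMap (2 * n) where
  σ := q.1.1.1
  α := q.1.1.2
  α_invol := q.2.1.invol
  α_ne d h := by
    have := q.2.1.edge d
    rw [h] at this
    omega
  connected := q.2.1.connected

theorem toCMap_mem (q : rootedQuads n) : toCMap q ∈ quadMaps n := by
  obtain ⟨⟨⟨σ, α⟩, l, r⟩, H, hr, hr', hc⟩ := q
  simp only at H hr hr' hc
  have hdeg : ∀ d, Nat.card {e // (σ * α).SameCycle d e} = 4 := fun d =>
    (card_sameCycle_eq_four_iff _ d).2 ⟨H.face d, H.face_ne d⟩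
  have hface : cycleCount (σ * α) = n := by
    have := cycleCount_mul_of_card_eq (σ * α) 4 hdeg
    rw [Nat.card_fin] at this
    omega
  refine ⟨?_, hdeg, ⟨fun d => decide (Even (l d)), fun d => ?_, fun d => ?_⟩, hface⟩
  · have h1 : (Nat.card (CMap.Vertex (toCMap ⟨((σ, α), l, r), H, hr, hr', hc⟩))) = n := hc
    have h2 : (Nat.card (CMap.Face (toCMap ⟨((σ, α), l, r), H, hr, hr', hc⟩))) = n := hface
    unfold CMap.HasGenus
    rw [h1, h2]
    push_cast
    ring
  · simp only [toCMap, H.vertex]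
  · have h2 : Even (l (α d)) ↔ ¬ Even (l d) := by
      rcases H.edge d with h | h <;> rw [h]
      · exact Int.even_add_one
      · exact Int.even_sub_one
    show decide (Even (l (α d))) ≠ decide (Even (l d))
    rw [Ne, decide_eq_decide, h2]
    tauto

theorem nonempty_of_rootedQuads (q : rootedQuads n) : Nonempty (Fin (2 * (2 * n))) := ⟨q.1.2.2⟩

/-- An arc at the vertex with the smallest label. -/
noncomputable def sinkArc (q : rootedQuads n) : Fin (2 * (2 * n)) :=
  haveI := nonempty_of_rootedQuads q
  (Finite.exists_min q.1.2.1).choose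

theorem sinkArc_spec (q : rootedQuads n) (d) : q.1.2.1 (sinkArc q) ≤ q.1.2.1 d :=
  haveI := nonempty_of_rootedQuads q
  (Finite.exists_min q.1.2.1).choose_spec d

/-- A labelled rooted quadrangulation with a choice of orientation of the root edge, as a pointed
rooted quadrangulation. -/
noncomputable def toPointed (x : rootedQuads n × Bool) :
    Σ M : quadMaps n, M.1.Vertex × Fin (2 * (2 * n)) :=
  ⟨⟨toCMap x.1, toCMap_mem x.1⟩, Quotient.mk _ (sinkArc x.1),
    if x.2 then x.1.1.2.2 else x.1.1.1.2 x.1.1.2.2⟩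

/-- The marked vertex determines the labelling up to a constant, which the label 1 at the root
fixes. The Boolean records whether the root arc descends. -/
theorem toPointed_injective : Function.Injective (toPointed (n := n)) := by
  rintro ⟨q, b⟩ ⟨q', b'⟩ h
  have h1 := sinkArc_spec q
  have h1' := sinkArc_spec q'
  unfold toPointed at h
  generalize sinkArc q = s at h h1
  generalize sinkArc q' = s' at h h1'
  obtain ⟨⟨⟨σ, α⟩, l, r⟩, H, hr, hr', hc⟩ := q
  obtain ⟨⟨⟨σ', α'⟩, l', r'⟩, H', hk, hk', hc'⟩ := q'
  simp only at H hr hr' hc h1 H' hk hk' hc' h1'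
  obtain ⟨hM, hv⟩ := Sigma.mk.inj h
  have hM := congrArg Subtype.val hM
  have eσ : σ = σ' := congrArg CMap.σ hM
  have eα : α = α' := congrArg CMap.α hM
  subst eσ eα
  obtain ⟨hv, hroot⟩ := Prod.ext_iff.1 (eq_of_heq hv)
  have hs : σ.SameCycle s s' := Quotient.exact hv
  have hsub := H.sub_eq H' h1 h1' hs
  simp only at hroot
  have hbb : b = b' ∧ r = r' := by
    have e1 := hsub r
    have e2 := hsub (α r)
    cases b <;> cases b' <;> simp only [if_true, if_false, Bool.false_eq_true] at hroot
    · exact ⟨rfl, α.injective hroot⟩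
    · exfalso
      rw [hroot] at e2 hr'
      have : α r' = r := by rw [← hroot, H.invol]
      rw [this] at hk'
      omega
    · have : α r = r' := by rw [hroot, H.invol]
      rw [this] at e2 hr'
      rw [← hroot] at hk'
      omega
    · exact ⟨rfl, hroot⟩
  obtain ⟨rfl, rfl⟩ := hbb
  have el : l = l' := by
    funext d
    have e1 := hsub r
    have e2 := hsub d
    omega
  subst el
  rfl

/-- The labels are distances to the marked vertex, shifted to be 1 and 0 at the two ends of the root
edge. -/
theorem toPointed_surjective : Function.Surjective (toPointed (n := n)) := by
  rintro ⟨⟨M, hg, hq, ⟨c, hc, hc'⟩, hf⟩, v, r⟩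
  induction v using Quotient.inductionOn with
  | _ d₀ =>
    have hface : ∀ d, (M.σ * M.α) ((M.σ * M.α) ((M.σ * M.α) ((M.σ * M.α) d))) = d ∧
        (M.σ * M.α) ((M.σ * M.α) d) ≠ d := fun d =>
      (card_sameCycle_eq_four_iff (M.σ * M.α) d).1 (hq d)
    obtain ⟨l, H, h0⟩ := exists_isLabelledQuad M.α_invol M.connected (fun d => (hface d).1)
      (fun d => (hface d).2) hc hc' d₀
    have hcount : cycleCount M.σ = n := by
      have h1 : cycleCount M.σ = Nat.card M.Vertex := rfl
      unfold CMap.HasGenus at hg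
      rw [hf] at hg
      push_cast at hg
      omega
    have key : ∀ (b : Bool) (s : Fin (2 * (2 * n))), l (M.α s) = l s - 1 →
        (if b then s else M.α s) = r → ∃ x, toPointed (n := n) x =
          ⟨⟨M, hg, hq, ⟨c, hc, hc'⟩, hf⟩, Quotient.mk _ d₀, r⟩ := by
      intro b s hs hb
      let q : rootedQuads n := ⟨((M.σ, M.α), fun d => l d + (1 - l s), s), H.shift _,
        by simp, by simp only; omega, hcount⟩
      have hmin : ∀ d, l (sinkArc q) ≤ l d := fun d => by
        have : l (sinkArc q) + (1 - l s) ≤ l d + (1 - l s) := sinkArc_spec q d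
        omega
      refine ⟨(q, b), ?_⟩
      have hv : M.σ.SameCycle (sinkArc q) d₀ := H.sink _ _ (H.up_of_isMin hmin) (H.up_of_isMin h0)
      unfold toPointed
      have hM : toCMap q = M := rfl
      refine Sigma.ext (Subtype.ext hM) (heq_of_eq (Prod.ext ?_ ?_))
      · exact Quotient.sound hv
      · exact hb
    rcases H.edge r with h | h
    · exact key false (M.α r) (H.down_alpha h) (by simp [M.α_invol])
    · exact key true r h (by simp)

instance : Finite (CMap n) :=
  Finite.of_injective (fun M : CMap n => (M.σ, M.α)) fun M N h => by
    cases M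
    cases N
    simp only [Prod.mk.injEq] at h
    obtain ⟨rfl, rfl⟩ := h
    rfl

/-- The 2 is the orientation of the root edge; the `n` is the number of vertices, equal to that of
faces by Euler's formula on the torus. -/
theorem two_mul_card_rootedQuads (n : ℕ) :
    2 * Nat.card (rootedQuads n) = n * Nat.card (rootedQuadMaps n) := by
  have h := Nat.card_eq_of_bijective _ ⟨toPointed_injective (n := n), toPointed_surjective⟩
  have : Fintype (quadMaps n) := Fintype.ofFinite _
  have hfin : ∀ M : CMap (2 * n), Finite M.Vertex := fun M => Quotient.finite _
  rw [Nat.card_prod, Nat.card_sigma, Finset.sum_congr rfl (g := fun _ => n * (2 * (2 * n))),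
    Finset.sum_const, smul_eq_mul, Finset.card_univ, ← Nat.card_eq_fintype_card,
    Nat.card_eq_fintype_card (α := Bool), Fintype.card_bool] at h
  · rw [card_rootedQuadMaps, mul_comm, h]
    ring
  · rintro ⟨M, hg, hq, hb, hf⟩ -
    rw [Nat.card_prod, Nat.card_fin]
    congr 1
    unfold CMap.HasGenus at hg
    rw [hf] at hg
    push_cast at hg
    simp only
    omega

/-- Renumbering of the arcs of a rooted map. -/
def RootedMap.renumber {m : ℕ} (M : RootedMap m) (π : Perm (Fin (2 * m))) : RootedMap m where
  σ := π * M.σ * π⁻¹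
  α := π * M.α * π⁻¹
  α_invol d := by simp [M.α_invol]
  α_ne d h := by
    simp only [Perm.mul_apply] at h
    exact M.α_ne (π⁻¹ d) (by rw [← π.injective.eq_iff, h, perm_apply_inv_self])
  connected d e := by
    obtain ⟨g, hg, hgd⟩ := M.connected (π⁻¹ d) (π⁻¹ e)
    refine ⟨π * g * π⁻¹, ?_, ?_⟩
    · have h1 : MulAut.conj π g ∈ (Subgroup.closure {M.σ, M.α}).map
        (MulAut.conj π).toMonoidHom := ⟨g, hg, rfl⟩
      rw [MonoidHom.map_closure, Set.image_pair] at h1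
      exact h1
    · rw [Perm.mul_apply, Perm.mul_apply, hgd, perm_apply_inv_self]
  root := π M.root

theorem RootedMap.isRootedIso_renumber {m : ℕ} (M : RootedMap m) (π : Perm (Fin (2 * m))) :
    IsRootedIso M (M.renumber π) π :=
  ⟨fun d => by simp [renumber], fun d => by simp [renumber], rfl⟩

theorem IsRootedIso.eq_renumber {m : ℕ} {M N : RootedMap m} {π : Perm (Fin (2 * m))}
    (h : IsRootedIso M N π) : N = M.renumber π := by
  obtain ⟨h1, h2, h3⟩ := h
  have e1 : N.σ = (M.renumber π).σ := by
    ext1 d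
    show N.σ d = π (M.σ (π⁻¹ d))
    rw [h1, perm_apply_inv_self]
  have e2 : N.α = (M.renumber π).α := by
    ext1 d
    show N.α d = π (M.α (π⁻¹ d))
    rw [h2, perm_apply_inv_self]
  have e3 : N.root = (M.renumber π).root := h3.symm
  generalize M.renumber π = M' at *
  obtain ⟨⟨σ, α, _, _, _⟩, r⟩ := N
  obtain ⟨⟨σ', α', _, _, _⟩, r'⟩ := M'
  simp only at e1 e2 e3
  subst e1 e2 e3
  rfl

theorem IsRootedIso.mem_rootedQuadMaps {M N : RootedMap (2 * n)} {π : Perm (Fin (2 * (2 * n)))}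
    (h : IsRootedIso M N π) (hM : M ∈ rootedQuadMaps n) : N ∈ rootedQuadMaps n := by
  obtain ⟨h1, h2, h3⟩ := h
  obtain ⟨hg, hq, ⟨c, hc, hc'⟩, hf⟩ := hM
  have hφ : ∀ d, π ((M.σ * M.α) d) = (N.σ * N.α) (π d) := fun d => by
    rw [Perm.mul_apply, Perm.mul_apply, h1, h2]
  have hF : Nat.card N.Face = Nat.card M.Face := (cycleCount_eq_of_semiconj π hφ).symm
  have hV : Nat.card N.Vertex = Nat.card M.Vertex := (cycleCount_eq_of_semiconj π h1).symm
  refine ⟨?_, ?_, ⟨c ∘ π.symm, fun d => ?_, fun d => ?_⟩, hF.trans hf⟩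
  · unfold CMap.HasGenus at hg ⊢
    rw [hF, hV]
    exact hg
  · intro d
    obtain ⟨d, rfl⟩ := π.surjective d
    refine (card_sameCycle_eq_four_iff (N.σ * N.α) (π d)).2 ?_
    have := (card_sameCycle_eq_four_iff (M.σ * M.α) d).1 (hq d)
    rw [← hφ, ← hφ, ← hφ, ← hφ, this.1]
    exact ⟨rfl, fun h => this.2 (π.injective h)⟩
  · obtain ⟨d, rfl⟩ := π.surjective d
    rw [← h1]
    simp [hc]
  · obtain ⟨d, rfl⟩ := π.surjective d
    rw [← h2]
    simpa using hc' d

/-- By rigidity, the renumberings of a rooted map are pairwise different, so every class has `(4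
n)!` members. -/
theorem card_rootedQuadMaps_eq (n : ℕ) :
    Nat.card (rootedQuadMaps n) = quadrangulationCount 1 n * (2 * (2 * n)).factorial := by
  let C := Quotient.mk (rootedSetoid (2 * n)) '' rootedQuadMaps n
  have hC : quadrangulationCount 1 n = Nat.card C := rfl
  let rep : C → RootedMap (2 * n) := fun c => c.2.choose
  have hrep : ∀ c, rep c ∈ rootedQuadMaps n ∧ Quotient.mk _ (rep c) = c.1 := fun c =>
    c.2.choose_spec
  let F : C × Perm (Fin (2 * (2 * n))) → rootedQuadMaps n := fun x =>
    ⟨(rep x.1).renumber x.2, ((rep x.1).isRootedIso_renumber x.2).mem_rootedQuadMaps (hrep x.1).1⟩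
  have hF : Function.Bijective F := by
    constructor
    · rintro ⟨c, π⟩ ⟨c', π'⟩ h
      have h := congrArg Subtype.val h
      simp only [F] at h
      have i1 := (rep c).isRootedIso_renumber π
      have i2 := (rep c').isRootedIso_renumber π'
      rw [← h] at i2
      have hc : c = c' := by
        apply Subtype.ext
        rw [← (hrep c).2, ← (hrep c').2]
        exact Quotient.sound ⟨_, i1.trans i2.symm⟩
      subst hc
      rw [i1.eq_of_apply_eq i2]
    · rintro ⟨M, hM⟩
      let c : C := ⟨Quotient.mk _ M, M, hM, rfl⟩
      obtain ⟨π, hπ⟩ := Quotient.exact (hrep c).2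
      exact ⟨(c, π), Subtype.ext hπ.eq_renumber.symm⟩
  rw [← Nat.card_eq_of_bijective F hF, Nat.card_prod, hC, Nat.card_eq_fintype_card (α := Perm _),
    Fintype.card_perm, Fintype.card_fin]

/-- The correspondence between quadrangulations and one-face maps. -/
theorem mul_quadrangulationCount (n : ℕ) :
    n * quadrangulationCount 1 n = 2 * (oneTreeFinset n).card := by
  have h1 := two_mul_card_rootedQuads n
  rw [card_rootedQuads, card_rootedQuadMaps_eq] at h1
  have h2 : Nat.card (oneTrees n) = (oneTreeFinset n).card := by
    rw [oneTreeFinset, ← Set.ncard_eq_toFinset_card _ (oneTrees_finite n), Nat.card_coe_set_eq]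
  rw [h2] at h1
  have h3 : 0 < (2 * (2 * n)).factorial := Nat.factorial_pos _
  apply Nat.eq_of_mul_eq_mul_right h3
  linarith

end Counting

/-! ### Vertices of degree at least three -/

section CycleFactors

variable {D : Type*} [Fintype D] [DecidableEq D] {f : Perm D}

theorem cycleCount_eq_card_cycleFactorsFinset (hf : ∀ d, f d ≠ d) :
    cycleCount f = f.cycleFactorsFinset.card := by
  rw [← Fintype.card_coe, ← Nat.card_eq_fintype_card, cycleCount]
  refine Nat.card_eq_of_bijective (Quotient.lift (fun d => (⟨f.cycleOf d,
    Perm.cycleOf_mem_cycleFactorsFinset_iff.2 (Perm.mem_support.2 (hf d))⟩ :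
    f.cycleFactorsFinset)) fun a b h => ?_) ⟨?_, ?_⟩
  · exact Subtype.ext (Perm.SameCycle.cycleOf_eq h)
  · intro a b
    induction a, b using Quotient.inductionOn₂ with
    | _ a b =>
      intro h
      refine Quotient.sound ?_
      have h : f.cycleOf a = f.cycleOf b := congrArg Subtype.val h
      have hb : f.SameCycle b a := by
        have h2 : a ∈ (f.cycleOf b).support := by
          rw [← h, Perm.mem_support, Perm.cycleOf_apply_self]
          exact hf a
        exact (Perm.mem_support_cycleOf_iff.1 h2).1
      exact hb.symm
  · rintro ⟨c, hc⟩
    obtain ⟨hc1, hc2⟩ := Perm.mem_cycleFactorsFinset_iff.1 hc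
    obtain ⟨x, hx⟩ := hc1.nonempty_support
    exact ⟨Quotient.mk _ x, Subtype.ext (Perm.cycle_is_cycleOf hx hc).symm⟩

theorem sum_cycleFactorsFinset {R : Type*} [AddCommMonoid R] (hf : ∀ d, f d ≠ d)
    (w : Perm D → R) :
    ∑ c ∈ f.cycleFactorsFinset, c.support.card • w c = ∑ d, w (f.cycleOf d) := by
  rw [← Finset.sum_fiberwise_of_maps_to (s := Finset.univ) (t := f.cycleFactorsFinset)
    (g := fun d => f.cycleOf d) fun d _ =>
    Perm.cycleOf_mem_cycleFactorsFinset_iff.2 (Perm.mem_support.2 (hf d))]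
  refine Finset.sum_congr rfl fun c hc => ?_
  rw [Finset.sum_congr rfl fun d hd => by rw [(Finset.mem_filter.1 hd).2], Finset.sum_const]
  congr 2
  ext d
  simp only [Finset.mem_filter, Finset.mem_univ, true_and]
  constructor
  · intro hd
    exact (Perm.cycle_is_cycleOf hd hc).symm
  · rintro rfl
    rw [Perm.mem_support, Perm.cycleOf_apply_self]
    exact hf d

theorem card_support_cycleOf_eq_two_iff (hf : ∀ d, f d ≠ d) (d : D) :
    (f.cycleOf d).support.card = 2 ↔ f (f d) = d := by
  have hc := Perm.isCycle_cycleOf f (hf d)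
  have h2 := hc.two_le_card_support
  have h : (f.cycleOf d).support.card ∣ 2 ↔ f (f d) = d := by
    rw [← hc.orderOf, orderOf_dvd_iff_pow_eq_one]
    constructor
    · intro h
      have := Perm.cycleOf_pow_apply_self f d 2
      rw [h] at this
      simpa [pow_two] using this.symm
    · intro h
      refine hc.pow_eq_one_iff.2 ⟨d, ?_, ?_⟩
      · rw [Perm.cycleOf_apply_self]
        exact hf d
      · rw [Perm.cycleOf_pow_apply_self]
        simpa [pow_two] using h
  rw [← h]
  exact ⟨fun h => h ▸ dvd_rfl, fun h => le_antisymm (Nat.le_of_dvd two_pos h) h2⟩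

/-- The elements on cycles of length at least three. -/
def branchSet (f : Perm D) : Finset D := Finset.univ.filter fun d => f (f d) ≠ d

/-- The cycles of length at least three of a permutation without fixed points. -/
theorem exists_card_branchSet (hf : ∀ d, f d ≠ d) : ∃ a, 3 * a ≤ (branchSet f).card ∧
    (a = 0 → (branchSet f).card = 0) ∧
    (branchSet f).card + 2 * cycleCount f = Fintype.card D + 2 * a := by
  have h2 : ∀ c ∈ f.cycleFactorsFinset, 2 ≤ c.support.card := fun c hc =>
    (Perm.mem_cycleFactorsFinset_iff.1 hc).1.two_le_card_support
  have hD := sum_cycleFactorsFinset hf (fun _ => 1)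
  have hS := sum_cycleFactorsFinset hf (fun c => if c.support.card = 2 then 0 else 1)
  simp only [card_support_cycleOf_eq_two_iff hf] at hS
  have hS' : ∑ d, (if f (f d) = d then 0 else 1) = (branchSet f).card := by
    rw [branchSet, Finset.card_filter]
    exact Finset.sum_congr rfl fun d _ => by split_ifs <;> simp_all
  rw [hS'] at hS
  -- The number of long cycles. In the last identity each cycle contributes the same to both sides:
  -- 2 if it is a transposition, its length plus 2 if it is longer.
  refine ⟨(f.cycleFactorsFinset.filter fun c => c.support.card ≠ 2).card, ?_, ?_, ?_⟩
  · rw [← hS, Finset.card_filter, Finset.mul_sum]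
    refine Finset.sum_le_sum fun c hc => ?_
    have := h2 c hc
    by_cases h : c.support.card = 2
    · simp [h]
    · simp only [ne_eq, h, not_false_eq_true, if_true, if_false, smul_eq_mul]
      omega
  · intro h
    rw [← hS]
    rw [Finset.card_eq_zero, Finset.filter_eq_empty_iff] at h
    refine Finset.sum_eq_zero fun c hc => ?_
    have := h hc
    simp_all
  · rw [← hS, cycleCount_eq_card_cycleFactorsFinset hf, Finset.card_filter, Finset.card_eq_sum_ones]
    rw [← Finset.card_univ, Finset.card_eq_sum_ones, ← hD, Finset.mul_sum, Finset.mul_sum,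
      ← Finset.sum_add_distrib,
      ← Finset.sum_add_distrib]
    refine Finset.sum_congr rfl fun c hc => ?_
    by_cases h : c.support.card = 2
    · simp [h]
    · simp [h, -Perm.card_support_eq_two]

theorem sign_eq_pow_of_no_fixedPoint (hf : ∀ d, f d ≠ d) :
    Perm.sign f = (-1) ^ (Fintype.card D + cycleCount f) := by
  rw [Perm.sign_of_cycleType, cycleCount_eq_card_cycleFactorsFinset hf, Perm.sum_cycleType]
  have h1 : f.support = Finset.univ := by
    ext d
    simp [hf d]
  rw [h1, Finset.card_univ, Perm.cycleType_def, Multiset.card_map]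
  rfl

theorem two_mul_cycleCount_of_invol (hf : ∀ d, f d ≠ d) (h : ∀ d, f (f d) = d) :
    2 * cycleCount f = Fintype.card D := by
  have h1 := sum_cycleFactorsFinset hf (fun _ => 1)
  rw [cycleCount_eq_card_cycleFactorsFinset hf, ← Finset.card_univ,
    Finset.card_eq_sum_ones Finset.univ, ← h1, mul_comm, Finset.card_eq_sum_ones, Finset.sum_mul]
  refine Finset.sum_congr rfl fun c hc => ?_
  obtain ⟨x, hx⟩ := (Perm.mem_cycleFactorsFinset_iff.1 hc).1.nonempty_support
  rw [Perm.cycle_is_cycleOf hx hc, (card_support_cycleOf_eq_two_iff hf x).2 (h x)]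
  rfl

end CycleFactors

/-- A gluing without leaves has genus 1 if and only if its vertices of degree at least three are
one vertex of degree four or two of degree three. -/
theorem cycleCount_iff_card_branchSet {n : ℕ} {α : Perm (Fin (2 * n))} (h2 : ∀ d, α (α d) = d)
    (h1 : ∀ d, α d ≠ d) (hσ : ∀ d, finRotate (2 * n) (α d) ≠ d) :
    cycleCount (finRotate (2 * n) * α) + 1 = n ↔
      (branchSet (finRotate (2 * n) * α)).card = 4 ∨
      (branchSet (finRotate (2 * n) * α)).card = 6 := by
  obtain ⟨a, ha3, ha0, ha⟩ := exists_card_branchSet (f := finRotate (2 * n) * α) hσ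
  have hα := two_mul_cycleCount_of_invol h1 h2
  have hsign := sign_eq_pow_of_no_fixedPoint (f := finRotate (2 * n) * α) hσ
  rw [Fintype.card_fin] at ha hα hsign
  constructor
  -- With `n - 1` vertices the branch set has `2 a + 2` elements; `3 a ≤ 2 a + 2` gives `a ≤ 2`, and
  -- `a = 0` is excluded.
  · intro h
    omega
  · intro h
    rcases Nat.eq_zero_or_pos n with hn | hn
    · subst hn
      omega
    obtain ⟨m, rfl⟩ : ∃ m, n = m + 1 := ⟨n - 1, by omega⟩
    rw [Perm.sign_mul, sign_eq_pow_of_no_fixedPoint h1] at hsign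
    have hτ : Perm.sign (finRotate (2 * (m + 1))) = (-1) ^ (2 * m + 1) :=
      sign_finRotate (2 * (m + 1))
    rw [hτ, ← pow_add, Fintype.card_fin] at hsign
    have hc : cycleCount α = m + 1 := by omega
    rw [hc] at hsign
    -- Signs give the parity of the number of vertices, which excludes a single vertex of degree
    -- six.
    have hpar : (2 * m + 1 + (2 * (m + 1) + (m + 1))) % 2 =
        (2 * (m + 1) + cycleCount (finRotate (2 * (m + 1)) * α)) % 2 := by
      have hp : ∀ k : ℕ, ((-1 : ℤˣ) ^ k = 1 ↔ k % 2 = 0) := fun k => by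
        rw [← Nat.even_iff]
        exact neg_one_pow_eq_one_iff_even (by decide)
      have e1 := hp (2 * m + 1 + (2 * (m + 1) + (m + 1)))
      have e2 := hp (2 * (m + 1) + cycleCount (finRotate (2 * (m + 1)) * α))
      rw [hsign] at e1
      have := e1.symm.trans e2
      omega
    omega

/-! ### Polygons cut at their branch corners -/

section Segments

/-- The sides of a `2 (i + j + k)`-gon are glued according to the word `A B C A⁻ B⁻ C⁻`, where `A`,
`B`, `C` have lengths `i`, `j`, `k`. -/
def hexagonGluing (i j k x : ℕ) : ℕ :=
  if x < i then i + j + k + i - 1 - x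
  else if x < i + j then i + j + k + 2 * i + j - 1 - x
  else if x < i + j + k then 2 * (i + j + k) + i + j - 1 - x
  else if x < i + j + k + i then i + j + k + i - 1 - x
  else if x < i + j + k + i + j then i + j + k + 2 * i + j - 1 - x
  else 2 * (i + j + k) + i + j - 1 - x

/-- On each pair of opposite segments the positions of two glued sides have a constant sum; this
linear form is what the later case distinctions use. -/
theorem hexagonGluing_spec {i j k x : ℕ} (hx : x < 2 * (i + j + k)) :
    (x < i ∨ i + j + k ≤ x ∧ x < i + j + k + i) ∧
      hexagonGluing i j k x + x + 1 = i + j + k + i ∨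
    (i ≤ x ∧ x < i + j ∨ i + j + k + i ≤ x ∧ x < i + j + k + i + j) ∧
      hexagonGluing i j k x + x + 1 = i + j + k + 2 * i + j ∨
    (i + j ≤ x ∧ x < i + j + k ∨ i + j + k + i + j ≤ x) ∧
      hexagonGluing i j k x + x + 1 = 2 * (i + j + k) + i + j := by
  unfold hexagonGluing
  split_ifs <;> omega

/-- An involution `a` of `{0, …, N - 1}` that reverses each of the segments between consecutive
points `s 0 = 0 < s 1 < … < s m = N`, and for which `y ↦ a y + 1` has no fixed point. -/
structure IsSegmented (N m : ℕ) (a s : ℕ → ℕ) : Prop where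
  lt : ∀ x < N, a x < N
  invol : ∀ x < N, a (a x) = x
  ne : ∀ x < N, a x ≠ x
  strictMono : ∀ i < m, s i < s (i + 1)
  zero : s 0 = 0
  last : s m = N
  pos : 0 < m
  -- At a corner of degree two the gluing continues backwards; at a branch corner it does not.
  -- `outer_last` and `outer_zero` are the versions of `outer` across the passage from `N - 1` to 0.
  inner : ∀ y, y + 1 < N → (∀ i < m, s i ≠ y + 1) → a y = a (y + 1) + 1
  outer : ∀ i < m, ∀ y, s i = y + 1 → a y ≠ a (y + 1) + 1
  outer_last : ∀ i < m, ∀ y, s i = y + 1 → a (y + 1) + 1 = N → a y ≠ 0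
  outer_zero : a (N - 1) ≠ a 0 + 1
  noleaf : ∀ y, y + 1 < N → a (y + 1) ≠ y
  noleaf_zero : a 0 + 1 ≠ N

namespace IsSegmented

variable {N m : ℕ} {a s : ℕ → ℕ}

theorem lt_of_lt (H : IsSegmented N m a s) {i j : ℕ} (h : i < j) (hj : j ≤ m) : s i < s j := by
  induction j with
  | zero => omega
  | succ j ih =>
    have h1 := H.strictMono j hj
    rcases Nat.lt_succ_iff_lt_or_eq.1 h with h2 | rfl
    · exact (ih h2 (by omega)).trans h1
    · exact h1

theorem le_of_le (H : IsSegmented N m a s) {i j : ℕ} (h : i ≤ j) (hj : j ≤ m) : s i ≤ s j := by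
  rcases h.lt_or_eq with h | rfl
  · exact (H.lt_of_lt h hj).le
  · exact le_rfl

theorem index_lt (H : IsSegmented N m a s) {i j : ℕ} (hi : i ≤ m) (h : s i < s j) : i < j := by
  by_contra hc
  have := H.le_of_le (not_lt.1 hc) hi
  omega

theorem index_eq (H : IsSegmented N m a s) {i j : ℕ} (hi : i ≤ m) (hj : j ≤ m) (h : s i = s j) :
    i = j := by
  by_contra hc
  rcases Nat.lt_or_gt_of_ne hc with h1 | h1
  · have := H.lt_of_lt h1 hj
    omega
  · have := H.lt_of_lt h1 hi
    omega

theorem apply_add (H : IsSegmented N m a s) {i t : ℕ} (hi : i < m) (ht : s i + t < s (i + 1)) :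
    a (s i + t) + t = a (s i) := by
  induction t with
  | zero => rfl
  | succ t ih =>
    have h1 := ih (by omega)
    have hN : s (i + 1) ≤ N := H.last ▸ H.le_of_le hi le_rfl
    have h2 := H.inner (s i + t) (by omega) fun j hj hs => by
      have h3 := H.index_lt (i := i) (j := j) (by omega) (by omega)
      have h4 := H.index_lt (i := j) (j := i + 1) (by omega) (by omega)
      omega
    rw [show s i + (t + 1) = s i + t + 1 from rfl]
    omega

/-- The first side of a segment is glued to the last side of some segment, since otherwise a branch
corner would be glued like an inner one. This defines `b`, and `apply_add` propagates the gluing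
along the segment. -/
theorem exists_pairing (H : IsSegmented N m a s) : ∃ b : ℕ → ℕ, ∀ i < m, b i < m ∧ b (b i) = i ∧
    s (b i + 1) + s i = s (i + 1) + s (b i) ∧
    ∀ t, s i + t < s (i + 1) → a (s i + t) + t + 1 = s (b i + 1) := by
  have h1 : ∀ i, ∃ j, i < m → j < m ∧ a (s i) + 1 = s (j + 1) := by
    intro i
    by_cases hi : i < m
    swap
    · exact ⟨0, fun h => absurd h hi⟩
    have hsN : s i < N := H.last ▸ H.lt_of_lt hi le_rfl
    have haN := H.lt _ hsN
    have hinv := H.invol _ hsN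
    by_cases hz : a (s i) + 1 = N
    · have := H.pos
      exact ⟨m - 1, fun _ => ⟨by omega, by rw [hz, Nat.sub_add_cancel this, H.last]⟩⟩
    · have h2 : ∃ j < m, s j = a (s i) + 1 := by
        by_contra hc
        push Not at hc
        have h3 := H.inner (a (s i)) (by omega) hc
        rw [hinv] at h3
        refine H.outer i hi _ h3 ?_
        rw [← h3, H.invol _ (by omega)]
      obtain ⟨j, hj, hj'⟩ := h2
      have hj0 : j ≠ 0 := by
        rintro rfl
        rw [H.zero] at hj'
        omega
      refine ⟨j - 1, fun _ => ⟨by omega, ?_⟩⟩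
      rw [Nat.sub_add_cancel (by omega), hj']
  choose b hb using h1
  have hsN : ∀ i < m, s i < N := fun i hi => H.last ▸ H.lt_of_lt hi le_rfl
  have hinj : ∀ i < m, ∀ j < m, b i = b j → i = j := by
    intro i hi j hj h
    have e1 := (hb i hi).2
    have e2 := (hb j hj).2
    rw [h] at e1
    have e3 : a (s i) = a (s j) := by omega
    have e4 : s i = s j := by rw [← H.invol _ (hsN i hi), e3, H.invol _ (hsN j hj)]
    exact H.index_eq hi.le hj.le e4
  have hlen : ∀ i < m, s (b (b i) + 1) + s (b i) = s i + s (b i + 1) := by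
    intro i hi
    have hbi := (hb i hi).1
    have e1 := (hb i hi).2
    have e2 := (hb (b i) hbi).2
    have e3 := H.strictMono (b i) hbi
    have e4 := H.apply_add (i := b i) (t := a (s i) - s (b i)) hbi (by omega)
    rw [show s (b i) + (a (s i) - s (b i)) = a (s i) by omega, H.invol _ (hsN i hi)] at e4
    omega
  have hge : ∀ i < m, i ≤ b (b i) := by
    intro i hi
    have hbi := (hb i hi).1
    have e3 := H.strictMono (b i) hbi
    have := H.index_lt (i := i) (j := b (b i) + 1) hi.le (by have := hlen i hi; omega)
    omega
  -- Induction from the last segment downwards: `b ∘ b` is injective and does not decrease the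
  -- index.
  have hbb : ∀ k, ∀ i < m, m ≤ i + k → b (b i) = i := by
    intro k
    induction k with
    | zero => intro i hi h; omega
    | succ k ih =>
      intro i hi h
      by_contra hc
      have h1 := hge i hi
      have hbi := (hb i hi).1
      have hbbi := (hb (b i) hbi).1
      have h2 := ih (b (b i)) hbbi (by omega)
      exact hc (hinj _ hbbi _ hi (hinj _ (hb _ hbbi).1 _ hbi h2))
  refine ⟨b, fun i hi => ⟨(hb i hi).1, hbb m i hi (by omega), ?_, fun t ht => ?_⟩⟩
  · have := hlen i hi
    rw [hbb m i hi (by omega)] at this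
    omega
  · rw [H.apply_add hi ht, (hb i hi).2]

/-- Forbidden patterns. A segment glued to itself has in its middle a fixed side or a leaf;
neighbours glued together create a leaf; two consecutive segments glued to two consecutive ones in
reverse order would give the branch corner between them degree two. The other clauses are these
patterns across corner 0 of the polygon. -/
theorem pairing_spec (H : IsSegmented N m a s) {b : ℕ → ℕ} (hb : ∀ i < m, b i < m ∧ b (b i) = i ∧
    s (b i + 1) + s i = s (i + 1) + s (b i) ∧
    ∀ t, s i + t < s (i + 1) → a (s i + t) + t + 1 = s (b i + 1)) :
    (∀ i < m, b i ≠ i) ∧ (∀ i, i + 1 < m → b i ≠ i + 1 ∧ b (i + 1) + 1 ≠ b i ∧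
      ¬ (b (i + 1) + 1 = m ∧ b i = 0)) ∧ b 0 + 1 ≠ m ∧ b 0 + 1 ≠ b (m - 1) := by
  have hsN : ∀ i < m, s i < N := fun i hi => H.last ▸ H.lt_of_lt hi le_rfl
  have hfirst : ∀ i < m, a (s i) + 1 = s (b i + 1) := fun i hi =>
    (hb i hi).2.2.2 0 (H.strictMono i hi)
  have hend : ∀ i < m, a (s (i + 1) - 1) = s (b i) := by
    intro i hi
    have h0 := H.strictMono i hi
    have h1 := (hb i hi).2.2.2 (s (i + 1) - 1 - s i) (by omega)
    rw [show s i + (s (i + 1) - 1 - s i) = s (i + 1) - 1 by omega] at h1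
    have h2 := (hb i hi).2.2.1
    omega
  refine ⟨fun i hi h => ?_, fun i hi => ⟨fun h => ?_, fun h => ?_, fun h => ?_⟩, fun h => ?_,
    fun h => ?_⟩
  · obtain ⟨-, -, -, h1⟩ := hb i hi
    rw [h] at h1
    have h0 := H.strictMono i hi
    have hN : s (i + 1) ≤ N := H.last ▸ H.le_of_le hi le_rfl
    obtain ⟨q, hq⟩ := Nat.even_or_odd' (s (i + 1) - s i)
    rcases hq with hq | hq
    · obtain ⟨r, rfl⟩ : ∃ r, q = r + 1 := ⟨q - 1, by omega⟩
      have h2 := h1 (r + 1) (by omega)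
      exact H.noleaf (s i + r) (by omega) (by rw [add_assoc]; omega)
    · have h2 := h1 q (by omega)
      exact H.ne (s i + q) (by omega) (by omega)
  · have h1 := hfirst (i + 1) hi
    have h2 := (hb i (by omega)).2.1
    rw [h] at h2
    rw [h2] at h1
    have h3 := H.strictMono i (by omega)
    have h4 := hsN (i + 1) hi
    obtain ⟨y, hy⟩ : ∃ y, s (i + 1) = y + 1 := ⟨s (i + 1) - 1, by omega⟩
    rw [hy] at h1 h4
    exact H.noleaf y h4 (by omega)
  · have h1 := hfirst (i + 1) hi
    have h2 := hend i (by omega)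
    have h3 := H.strictMono i (by omega)
    obtain ⟨y, hy⟩ : ∃ y, s (i + 1) = y + 1 := ⟨s (i + 1) - 1, by omega⟩
    rw [hy] at h1 h2
    exact H.outer (i + 1) hi y hy (by rw [h1, h, ← h2]; rfl)
  · have h1 := hfirst (i + 1) hi
    have h2 := hend i (by omega)
    have h3 := H.strictMono i (by omega)
    obtain ⟨y, hy⟩ : ∃ y, s (i + 1) = y + 1 := ⟨s (i + 1) - 1, by omega⟩
    rw [hy] at h1 h2
    rw [h.1, H.last] at h1
    rw [h.2, H.zero] at h2
    exact H.outer_last (i + 1) hi y hy h1 h2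
  · have h1 := hfirst 0 H.pos
    rw [h, H.zero, H.last] at h1
    exact H.noleaf_zero h1
  · have h0 := H.pos
    have h1 := hfirst 0 H.pos
    have h2 := hend (m - 1) (by omega)
    rw [Nat.sub_add_cancel h0, H.last] at h2
    rw [h, H.zero] at h1
    exact H.outer_zero (by rw [h1, h2])

/-- The forbidden patterns leave only the pairing of opposite segments. -/
theorem eq_of_four (H : IsSegmented N 4 a s) : N = 2 * (s 1 + (s 2 - s 1) + 0) ∧ 0 < s 1 ∧
    0 < s 2 - s 1 ∧ ∀ x < N, a x = hexagonGluing (s 1) (s 2 - s 1) 0 x := by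
  obtain ⟨b, hb⟩ := H.exists_pairing
  obtain ⟨c1, c2, c3, c4⟩ := H.pairing_spec hb
  have h0 := hb 0 (by omega)
  have h1 := hb 1 (by omega)
  have h2 := hb 2 (by omega)
  have h3 := hb 3 (by omega)
  have m0 := H.strictMono 0 (by omega)
  have m1 := H.strictMono 1 (by omega)
  have m2 := H.strictMono 2 (by omega)
  have m3 := H.strictMono 3 (by omega)
  have hz := H.zero
  have hl := H.last
  simp only [zero_add, Nat.reduceAdd] at *
  have b0 : b 0 = 2 := by
    have := c1 0 (by omega)
    have := (c2 0 (by omega)).1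
    omega
  rw [b0] at h0
  have b1 : b 1 = 3 := by
    have := c1 1 (by omega)
    have := (c2 1 (by omega)).1
    have : b 1 ≠ 0 := fun h => by
      rw [h] at h1
      omega
    omega
  rw [b1] at h1
  rw [h0.2.1] at h2
  rw [h1.2.1] at h3
  simp only [zero_add, Nat.reduceAdd] at *
  refine ⟨by omega, by omega, by omega, fun x hx => ?_⟩
  have key : ∀ i y z, s i ≤ x → x < y → (∀ t, s i + t < y → a (s i + t) + t + 1 = z) →
      a x + (x - s i) + 1 = z := fun i y z h1 h2 h => by
    have := h (x - s i) (by omega)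
    rwa [show s i + (x - s i) = x by omega] at this
  have k0 := fun h => key 0 _ _ (by omega) h h0.2.2.2
  have k1 := fun h h' => key 1 _ _ h h' h1.2.2.2
  have k2 := fun h h' => key 2 _ _ h h' h2.2.2.2
  have k3 := fun h h' => key 3 _ _ h h' h3.2.2.2
  unfold hexagonGluing
  split_ifs <;> omega

-- Exhaustive check on pairings of the sides of a hexagon. The conditions are interleaved with the
-- quantifiers so that partial choices are discarded early.
set_option synthInstance.maxHeartbeats 400000 in
set_option synthInstance.maxSize 4000 in
set_option maxRecDepth 100000 in
theorem pairing_eq_of_six : ∀ x₀ : Fin 6, x₀ ≠ 0 → x₀ ≠ 1 → x₀ ≠ 5 →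
    ∀ x₁ : Fin 6, x₁ ≠ 1 → x₁ ≠ 2 → x₁ ≠ x₀ → x₁.val + 1 ≠ x₀.val → (x₀ = 1 ↔ x₁ = 0) →
    ∀ x₂ : Fin 6, x₂ ≠ 2 → x₂ ≠ 3 → x₂.val + 1 ≠ x₁.val → (x₀ = 2 ↔ x₂ = 0) → (x₁ = 2 ↔ x₂ = 1) →
    ∀ x₃ : Fin 6, x₃ ≠ 3 → x₃ ≠ 4 → x₃.val + 1 ≠ x₂.val → (x₀ = 3 ↔ x₃ = 0) → (x₁ = 3 ↔ x₃ = 1) →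
      (x₂ = 3 ↔ x₃ = 2) →
    ∀ x₄ : Fin 6, x₄ ≠ 4 → x₄ ≠ 5 → x₄.val + 1 ≠ x₃.val → (x₀ = 4 ↔ x₄ = 0) → (x₁ = 4 ↔ x₄ = 1) →
      (x₂ = 4 ↔ x₄ = 2) → (x₃ = 4 ↔ x₄ = 3) →
    ∀ x₅ : Fin 6, x₅ ≠ 5 → x₅.val + 1 ≠ x₄.val → x₀.val + 1 ≠ x₅.val → (x₀ = 5 ↔ x₅ = 0) →
      (x₁ = 5 ↔ x₅ = 1) → (x₂ = 5 ↔ x₅ = 2) → (x₃ = 5 ↔ x₅ = 3) → (x₄ = 5 ↔ x₅ = 4) →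
    x₀ = 3 ∧ x₁ = 4 ∧ x₂ = 5 := by
  decide +kernel

theorem eq_of_six (H : IsSegmented N 6 a s) : N = 2 * (s 1 + (s 2 - s 1) + (s 3 - s 2)) ∧
    0 < s 1 ∧ 0 < s 2 - s 1 ∧ 0 < s 3 - s 2 ∧
    ∀ x < N, a x = hexagonGluing (s 1) (s 2 - s 1) (s 3 - s 2) x := by
  obtain ⟨b, hb⟩ := H.exists_pairing
  obtain ⟨c1, c2, c3, c4⟩ := H.pairing_spec hb
  have h0 := hb 0 (by omega)
  have h1 := hb 1 (by omega)
  have h2 := hb 2 (by omega)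
  have h3 := hb 3 (by omega)
  have h4 := hb 4 (by omega)
  have h5 := hb 5 (by omega)
  have m0 := H.strictMono 0 (by omega)
  have m1 := H.strictMono 1 (by omega)
  have m2 := H.strictMono 2 (by omega)
  have m3 := H.strictMono 3 (by omega)
  have m4 := H.strictMono 4 (by omega)
  have m5 := H.strictMono 5 (by omega)
  have hz := H.zero
  have hl := H.last
  have hb012 : b 0 = 3 ∧ b 1 = 4 ∧ b 2 = 5 := by
    have sym : ∀ i (hi : i < 6) j (hj : j < 6), (⟨b i, (hb i hi).1⟩ : Fin 6) = ⟨j, hj⟩ ↔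
        (⟨b j, (hb j hj).1⟩ : Fin 6) = ⟨i, hi⟩ := fun i hi j hj => by
      rw [Fin.mk.injEq, Fin.mk.injEq]
      exact ⟨fun h => h ▸ (hb i hi).2.1, fun h => h ▸ (hb j hj).2.1⟩
    have n : ∀ i (hi : i + 1 < 6), (⟨b i, (hb i (by omega)).1⟩ : Fin 6) ≠ ⟨i + 1, hi⟩ :=
      fun i hi h => (c2 i hi).1 (congrArg Fin.val h)
    have o : ∀ i (hi : i < 6), (⟨b i, (hb i hi).1⟩ : Fin 6) ≠ ⟨i, hi⟩ :=
      fun i hi h => c1 i hi (congrArg Fin.val h)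
    have h := pairing_eq_of_six ⟨b 0, h0.1⟩ (o 0 _) (n 0 _) (fun h => c3 (by
      have := congrArg Fin.val h
      simp only at this
      rw [this]
      rfl)) ⟨b 1, h1.1⟩ (o 1 _) (n 1 _) (fun h => by
        have h' := congrArg Fin.val h
        simp only at h'
        have e1 := h1.2.1
        rw [h', h0.2.1] at e1
        omega) (c2 0 (by omega)).2.1 (sym 0 _ 1 _)
      ⟨b 2, h2.1⟩ (o 2 _) (n 2 _) (c2 1 (by omega)).2.1 (sym 0 _ 2 _) (sym 1 _ 2 _)
      ⟨b 3, h3.1⟩ (o 3 _) (n 3 _) (c2 2 (by omega)).2.1 (sym 0 _ 3 _) (sym 1 _ 3 _) (sym 2 _ 3 _)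
      ⟨b 4, h4.1⟩ (o 4 _) (n 4 _) (c2 3 (by omega)).2.1 (sym 0 _ 4 _) (sym 1 _ 4 _) (sym 2 _ 4 _)
        (sym 3 _ 4 _)
      ⟨b 5, h5.1⟩ (o 5 _) (c2 4 (by omega)).2.1 c4 (sym 0 _ 5 _) (sym 1 _ 5 _) (sym 2 _ 5 _)
        (sym 3 _ 5 _) (sym 4 _ 5 _)
    exact ⟨congrArg Fin.val h.1, congrArg Fin.val h.2.1, congrArg Fin.val h.2.2⟩
  obtain ⟨b0, b1, b2⟩ := hb012
  rw [b0] at h0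
  rw [b1] at h1
  rw [b2] at h2
  rw [h0.2.1] at h3
  rw [h1.2.1] at h4
  rw [h2.2.1] at h5
  simp only [zero_add, Nat.reduceAdd] at *
  refine ⟨by omega, by omega, by omega, by omega, fun x hx => ?_⟩
  have key : ∀ i y z, s i ≤ x → x < y → (∀ t, s i + t < y → a (s i + t) + t + 1 = z) →
      a x + (x - s i) + 1 = z := fun i y z h1 h2 h => by
    have := h (x - s i) (by omega)
    rwa [show s i + (x - s i) = x by omega] at this
  have k0 := fun h => key 0 _ _ (by omega) h h0.2.2.2
  have k1 := fun h h' => key 1 _ _ h h' h1.2.2.2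
  have k2 := fun h h' => key 2 _ _ h h' h2.2.2.2
  have k3 := fun h h' => key 3 _ _ h h' h3.2.2.2
  have k4 := fun h h' => key 4 _ _ h h' h4.2.2.2
  have k5 := fun h h' => key 5 _ _ h h' h5.2.2.2
  unfold hexagonGluing
  split_ifs <;> omega

end IsSegmented

end Segments

theorem finRotate_eq_iff {N : ℕ} (d e : Fin N) : finRotate N d = e ↔
    d.val + 1 = e.val ∨ (d.val + 1 = N ∧ e.val = 0) := by
  obtain ⟨d, hd⟩ := d
  obtain ⟨e, he⟩ := e
  by_cases h : d + 1 < N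
  · rw [finRotate_mk h, Fin.mk.injEq]
    simp only
    omega
  · rw [finRotate_mk_last (by omega), Fin.mk.injEq]
    simp only
    omega

/-! ### Reduced one-face maps as glued hexagons -/

section Hexagon

variable {n : ℕ}

/-- `σ (σ d) = d` means that the two sides meeting at the corner `d` are glued to two consecutive
sides. -/
theorem finRotate_mem_branchSet_iff {α : Perm (Fin (2 * n))} (h2 : ∀ d, α (α d) = d)
    (d e : Fin (2 * n)) (hd : finRotate (2 * n) e = d) :
    d ∈ branchSet (finRotate (2 * n) * α) ↔ finRotate (2 * n) (α d) ≠ α e := by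
  subst hd
  have h : finRotate (2 * n) e ∈ branchSet (finRotate (2 * n) * α) ↔
      ¬ finRotate (2 * n) (α (finRotate (2 * n) (α (finRotate (2 * n) e)))) =
        finRotate (2 * n) e := by
    simp [branchSet]
  rw [h, Ne, not_iff_not, EmbeddingLike.apply_eq_iff_eq]
  exact ⟨fun h => by rw [← h2 (finRotate _ _), h], fun h => by rw [h, h2]⟩

/-- The cut points are the branch corners in increasing order, followed by the default value `2 n`;
the first is 0 because the root corner is a branch corner. -/
theorem isSegmented_of_card_branchSet {α : Perm (Fin (2 * n))} (h2 : ∀ d, α (α d) = d)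
    (h1 : ∀ d, α d ≠ d) (hσ : ∀ d, finRotate (2 * n) (α d) ≠ d) (hn : 0 < 2 * n)
    (h0 : ⟨0, hn⟩ ∈ branchSet (finRotate (2 * n) * α)) {m : ℕ}
    (hm : (branchSet (finRotate (2 * n) * α)).card = m) :
    ∃ s : ℕ → ℕ,
      IsSegmented (2 * n) m (fun x => if h : x < 2 * n then (α ⟨x, h⟩).val else x) s := by
  set S := branchSet (finRotate (2 * n) * α) with hS
  have hS0 : (finRotate (2 * n)) (α ⟨0, hn⟩) ≠ α ⟨2 * n - 1, by omega⟩ :=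
    (finRotate_mem_branchSet_iff h2 ⟨0, hn⟩ ⟨2 * n - 1, by omega⟩ (by
      rw [finRotate_eq_iff]
      exact Or.inr ⟨by simp only; omega, rfl⟩)).1 h0
  have hSs : ∀ y (hy : y + 1 < 2 * n), (⟨y + 1, hy⟩ ∈ S ↔
      finRotate (2 * n) (α ⟨y + 1, hy⟩) ≠ α ⟨y, by omega⟩) := fun y hy =>
    finRotate_mem_branchSet_iff h2 _ _ (finRotate_mk hy)
  have hpos : 0 < m := hm ▸ Finset.card_pos.2 ⟨_, h0⟩
  let s : ℕ → ℕ := fun i => if h : i < m then (S.orderEmbOfFin hm ⟨i, h⟩).val else 2 * n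
  have hs : ∀ i (h : i < m), s i = (S.orderEmbOfFin hm ⟨i, h⟩).val := fun i h => dif_pos h
  have hmem : ∀ i (h : i < m), ∃ h' : s i < 2 * n, (⟨s i, h'⟩ : Fin (2 * n)) ∈ S := fun i h =>
    ⟨hs i h ▸ Fin.is_lt _, by
      have := S.orderEmbOfFin_mem hm ⟨i, h⟩
      convert this
      exact hs i h⟩
  have hex : ∀ d ∈ S, ∃ i < m, s i = d.val := by
    intro d hd
    have h : d ∈ Set.range (S.orderEmbOfFin hm) := by
      rw [Finset.range_orderEmbOfFin]
      exact hd
    obtain ⟨i, rfl⟩ := h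
    exact ⟨i, i.2, hs i i.2⟩
  have hmono : ∀ i j, i < j → j < m → s i < s j := by
    intro i j hij hj
    rw [hs i (by omega), hs j hj]
    exact (S.orderEmbOfFin hm).strictMono (Fin.mk_lt_mk.2 hij)
  refine ⟨s, ?_⟩
  constructor
  · intro x hx
    rw [dif_pos hx]
    exact Fin.is_lt _
  · intro x hx
    simp only [dif_pos hx, Fin.is_lt, dite_true, Fin.eta, h2]
  · intro x hx
    rw [dif_pos hx]
    exact fun h => h1 ⟨x, hx⟩ (Fin.ext h)
  · intro i hi
    by_cases hi' : i + 1 < m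
    · exact hmono i (i + 1) (by omega) hi'
    · have : s (i + 1) = 2 * n := dif_neg hi'
      rw [this]
      exact (hmem i hi).1
  · obtain ⟨i, hi, h⟩ := hex _ h0
    rcases Nat.eq_zero_or_pos i with rfl | hi'
    · exact h
    · have := hmono 0 i hi' hi
      simp only at h
      omega
  · exact dif_neg (lt_irrefl m)
  · exact hpos
  · intro y hy hys
    have h3 : (⟨y + 1, hy⟩ : Fin (2 * n)) ∉ S := fun h => by
      obtain ⟨i, hi, h'⟩ := hex _ h
      exact hys i hi h'
    rw [hSs y hy, not_not] at h3
    have h3' := h3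
    rw [finRotate_eq_iff] at h3'
    rw [dif_pos hy, dif_pos (by omega)]
    rcases h3' with h4 | ⟨h4, h5⟩
    · exact h4.symm
    -- The gluing would continue backwards across the passage from `2 n - 1` to 0, making the root
    -- corner a non-branch corner.
    · exfalso
      apply hS0
      have e1 : α ⟨y + 1, hy⟩ = ⟨2 * n - 1, by omega⟩ := Fin.ext (by simp only; omega)
      have e2 : α ⟨y, by omega⟩ = ⟨0, hn⟩ := Fin.ext h5
      rw [← e1, ← e2, h2, h2]
      exact finRotate_mk hy
  · intro i hi y hy
    obtain ⟨h3, h4⟩ := hmem i hi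
    simp only [hy] at h3 h4
    rw [hSs y h3] at h4
    rw [dif_pos h3, dif_pos (by omega)]
    exact fun h => h4 ((finRotate_eq_iff _ _).2 (Or.inl h.symm))
  · intro i hi y hy
    obtain ⟨h3, h4⟩ := hmem i hi
    simp only [hy] at h3 h4
    rw [hSs y h3] at h4
    rw [dif_pos h3, dif_pos (by omega)]
    exact fun h h' => h4 ((finRotate_eq_iff _ _).2 (Or.inr ⟨h, h'⟩))
  · rw [dif_pos hn, dif_pos (by omega)]
    exact fun h => hS0 ((finRotate_eq_iff _ _).2 (Or.inl h.symm))
  · intro y hy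
    rw [dif_pos hy]
    exact fun h => hσ ⟨y + 1, hy⟩ ((finRotate_eq_iff _ _).2 (Or.inl (by rw [h])))
  · rw [dif_pos hn]
    exact fun h => hσ ⟨0, hn⟩ ((finRotate_eq_iff _ _).2 (Or.inr ⟨h, rfl⟩))

/-- The gluing `α` is given by the word `A B C A⁻ B⁻ C⁻`. -/
def IsHexagon (i j k : ℕ) (α : Perm (Fin (2 * n))) : Prop :=
  i + j + k = n ∧ ∀ x, (α x).val = hexagonGluing i j k x.val

theorem exists_isHexagon {α : Perm (Fin (2 * n))} (h2 : ∀ d, α (α d) = d)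
    (h1 : ∀ d, α d ≠ d) (hσ : ∀ d, finRotate (2 * n) (α d) ≠ d) (hn : 0 < 2 * n)
    (h0 : ⟨0, hn⟩ ∈ branchSet (finRotate (2 * n) * α)) :
    ((branchSet (finRotate (2 * n) * α)).card = 4 →
      ∃ i j, 0 < i ∧ 0 < j ∧ IsHexagon i j 0 α) ∧
    ((branchSet (finRotate (2 * n) * α)).card = 6 →
      ∃ i j k, 0 < i ∧ 0 < j ∧ 0 < k ∧ IsHexagon i j k α) := by
  constructor
  · intro hm
    obtain ⟨s, H⟩ := isSegmented_of_card_branchSet h2 h1 hσ hn h0 hm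
    obtain ⟨e1, e2, e3, e4⟩ := H.eq_of_four
    refine ⟨_, _, e2, e3, by omega, fun x => ?_⟩
    have := e4 x.val x.2
    rwa [dif_pos x.2] at this
  · intro hm
    obtain ⟨s, H⟩ := isSegmented_of_card_branchSet h2 h1 hσ hn h0 hm
    obtain ⟨e1, e2, e3, e3', e4⟩ := H.eq_of_six
    refine ⟨_, _, _, e2, e3, e3', by omega, fun x => ?_⟩
    have := e4 x.val x.2
    rwa [dif_pos x.2] at this

namespace IsHexagon

variable {i j k : ℕ} {α : Perm (Fin (2 * n))}

theorem invol (H : IsHexagon i j k α) (d) : α (α d) = d := by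
  obtain ⟨rfl, H⟩ := H
  apply Fin.ext
  have h1 := hexagonGluing_spec d.2
  have h2 := hexagonGluing_spec (α d).2
  rw [H] at h2
  rw [H, H]
  have := d.2
  omega

theorem ne (H : IsHexagon i j k α) (d) : α d ≠ d := by
  obtain ⟨rfl, H⟩ := H
  intro h
  have h := congrArg Fin.val h
  rw [H] at h
  have h1 := hexagonGluing_spec d.2
  omega

theorem no_leaf (H : IsHexagon i j k α) (hi : 0 < i) (hj : 0 < j) (d) :
    finRotate (2 * n) (α d) ≠ d := by
  obtain ⟨rfl, H⟩ := H
  rw [Ne, finRotate_eq_iff, H]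
  have h1 := hexagonGluing_spec d.2
  omega

theorem mem_branchSet (H : IsHexagon i j k α) (hi : 0 < i) (hj : 0 < j) (d) :
    d ∈ branchSet (finRotate (2 * n) * α) ↔ d.val = 0 ∨ d.val = i ∨ d.val = i + j ∨ d.val = n ∨
      d.val = n + i ∨ d.val = n + i + j := by
  obtain ⟨e, he⟩ := (finRotate (2 * n)).surjective d
  rw [finRotate_mem_branchSet_iff H.invol _ _ he, Ne, finRotate_eq_iff]
  rw [finRotate_eq_iff] at he
  obtain ⟨rfl, H⟩ := H
  rw [H, H]
  have h1 := hexagonGluing_spec d.2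
  have h2 := hexagonGluing_spec e.2
  have := d.2
  have := e.2
  generalize hexagonGluing i j k d.val = u at *
  generalize hexagonGluing i j k e.val = v at *
  generalize d.val = x at *
  generalize e.val = y at *
  rcases he with rfl | ⟨he, rfl⟩ <;> rcases h1 with ⟨h1, h3⟩ | ⟨h1, h3⟩ | ⟨h1, h3⟩ <;>
    rcases h2 with ⟨h2, h4⟩ | ⟨h2, h4⟩ | ⟨h2, h4⟩ <;> omega

/-- For `k = 0`, two of the six corners between segments coincide and one falls at `2 n`, out of
range; four remain. -/
theorem card_branchSet (H : IsHexagon i j k α) (hi : 0 < i) (hj : 0 < j) :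
    (branchSet (finRotate (2 * n) * α)).card = if k = 0 then 4 else 6 := by
  rw [← Finset.card_map Fin.valEmbedding]
  have hn := H.1
  split_ifs with hk
  · have h : (branchSet (finRotate (2 * n) * α)).map Fin.valEmbedding = {0, i, n, n + i} := by
      ext x
      simp only [Finset.mem_map, H.mem_branchSet hi hj, Fin.valEmbedding_apply, Finset.mem_insert,
        Finset.mem_singleton]
      constructor
      · rintro ⟨d, hd, rfl⟩
        have := d.2
        omega
      · intro hx
        refine ⟨⟨x, by omega⟩, ?_, rfl⟩
        simp only
        omega
    rw [h]
    repeat rw [Finset.card_insert_of_notMem (by simp; omega)]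
    rfl
  · have h : (branchSet (finRotate (2 * n) * α)).map Fin.valEmbedding =
        {0, i, i + j, n, n + i, n + i + j} := by
      ext x
      simp only [Finset.mem_map, H.mem_branchSet hi hj, Fin.valEmbedding_apply, Finset.mem_insert,
        Finset.mem_singleton]
      constructor
      · rintro ⟨d, hd, rfl⟩
        exact hd
      · intro hx
        exact ⟨⟨x, by omega⟩, hx, rfl⟩
    rw [h]
    repeat rw [Finset.card_insert_of_notMem (by simp; omega)]
    rfl

theorem unique {i' j' k' : ℕ} (H : IsHexagon i j k α) (H' : IsHexagon i' j' k' α) (hi : 0 < i)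
    (hj : 0 < j) (hi' : 0 < i') (hj' : 0 < j') : i = i' ∧ j = j' ∧ k = k' := by
  have hn := H.1
  have hn' := H'.1
  have h := fun d => (H.mem_branchSet hi hj d).symm.trans (H'.mem_branchSet hi' hj' d)
  have h1 := (h ⟨i, by omega⟩).1 (by simp)
  have h2 := (h ⟨i', by omega⟩).2 (by simp)
  have h3 := (h ⟨i + j, by omega⟩).1 (by simp)
  have h4 := (h ⟨i' + j', by omega⟩).2 (by simp)
  simp only at h1 h2 h3 h4
  omega

end IsHexagon

theorem exists_perm_isHexagon {i j k : ℕ} (h : i + j + k = n) :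
    ∃ α : Perm (Fin (2 * n)), IsHexagon i j k α := by
  subst h
  have hlt : ∀ x < 2 * (i + j + k), hexagonGluing i j k x < 2 * (i + j + k) := fun x hx => by
    unfold hexagonGluing
    split_ifs <;> omega
  refine ⟨Function.Involutive.toPerm (fun x => ⟨hexagonGluing i j k x.val, hlt _ x.2⟩) fun d => ?_,
    rfl, fun x => rfl⟩
  apply Fin.ext
  have h1 := hexagonGluing_spec d.2
  have h2 := hexagonGluing_spec (hlt _ d.2)
  have := d.2
  simp only
  omega

end Hexagon

/-! ### Walks with steps -1, 0, 1 -/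

section Walks

/-- The displacement of a walk with steps `-1`, `0`, `1`. -/
def stepSum {i : ℕ} (a : Fin i → Fin 3) : ℤ := ∑ x, (((a x : ℕ) : ℤ) - 1)

/-- The number of walks of length `i` with steps `-1`, `0`, `1` and displacement `h`. -/
def walkCount (i : ℕ) (h : ℤ) : ℕ :=
  (Finset.univ.filter fun a : Fin i → Fin 3 => stepSum a = h).card

theorem walkCount_zero (h : ℤ) : walkCount 0 h = if h = 0 then 1 else 0 := by
  unfold walkCount stepSum
  split_ifs with hh
  · subst hh
    simp
  · rw [Finset.card_eq_zero, Finset.filter_eq_empty_iff]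
    intro a _
    simpa using Ne.symm hh

theorem walkCount_succ (i : ℕ) (h : ℤ) :
    walkCount (i + 1) h = walkCount i (h - 1) + walkCount i h + walkCount i (h + 1) := by
  unfold walkCount
  simp only [Finset.card_filter]
  rw [← (Fin.consEquiv fun _ => Fin 3).sum_comp, Fintype.sum_prod_type, Fin.sum_univ_three]
  have hs : ∀ (s : Fin 3) (a : Fin i → Fin 3), stepSum (Fin.cons s a : Fin (i + 1) → Fin 3) =
      ((s : ℕ) : ℤ) - 1 + stepSum a := fun s a => by
    simp only [stepSum, Fin.sum_univ_succ, Fin.cons_zero, Fin.cons_succ]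
  have e : ∀ (s : Fin 3) (v : ℤ), h = ((s : ℕ) : ℤ) - 1 + v →
      (∑ a : Fin i → Fin 3, if stepSum ((Fin.consEquiv fun _ => Fin 3) (s, a)) = h then 1 else 0) =
      ∑ a : Fin i → Fin 3, if stepSum a = v then 1 else 0 := fun s v hv =>
    Finset.sum_congr rfl fun a _ => if_congr (by
      have := hs s a
      change stepSum (Fin.cons s a : Fin (i + 1) → Fin 3) = h ↔ _
      omega) rfl rfl
  rw [e 0 (h + 1) (by simp), e 1 h (by simp), e 2 (h - 1) (by simp)]
  ring

theorem abs_stepSum_le {i : ℕ} (a : Fin i → Fin 3) : |stepSum a| ≤ i := by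
  refine (Finset.abs_sum_le_sum_abs _ _).trans ?_
  refine (Finset.sum_le_card_nsmul _ _ 1 fun x _ => ?_).trans (by simp)
  have := (a x).2
  rw [abs_le]
  omega

theorem walkCount_neg (i : ℕ) (h : ℤ) : walkCount i (-h) = walkCount i h := by
  induction i generalizing h with
  | zero => simp [walkCount_zero]
  | succ i ih =>
    rw [walkCount_succ, walkCount_succ, ih h, show -h - 1 = -(h + 1) by ring, ih,
      show -h + 1 = -(h - 1) by ring, ih]
    ring

end Walks

/-! ### Labels along a glued hexagon -/

section Labels

variable {n i j k : ℕ}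

/-- The side among the first `n` to which the side `x` is glued, read at its other end. -/
def foldSide (i j k x : ℕ) : ℕ :=
  if x ≤ i + j + k then x
  else if x ≤ i + j + k + i then i + j + k + i - x
  else if x ≤ i + j + k + i + j then i + j + k + 2 * i + j - x
  else 2 * (i + j + k) + i + j - x

/-- Only at ends of segments do two representatives compete. They are then corners of one branch
vertex, where `h1` and `h2` make `f` agree. -/
theorem fold_spec {f : ℕ → ℤ} (hi : 0 < i) (hj : 0 < j) (h1 : f (i + j) = f 0)
    (h2 : f (i + j + k) = f i) {x y : ℕ}
    (h : x ≤ i + j + k ∧ y = x ∨ (i + j + k ≤ x ∧ x ≤ i + j + k + i) ∧ y + x = i + j + k + i ∨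
      (i + j + k + i ≤ x ∧ x ≤ i + j + k + i + j) ∧ y + x = i + j + k + 2 * i + j ∨
      (i + j + k + i + j ≤ x ∧ x ≤ 2 * (i + j + k)) ∧ y + x = 2 * (i + j + k) + i + j) :
    f (foldSide i j k x) = f y := by
  have key : foldSide i j k x = y ∨ (foldSide i j k x = i + j + k ∧ y = i) ∨
      (foldSide i j k x = 0 ∧ y = i + j) ∨ (foldSide i j k x = i ∧ y = i + j + k) := by
    unfold foldSide
    split_ifs <;> omega
  rcases key with e | ⟨e, rfl⟩ | ⟨e, rfl⟩ | ⟨e, rfl⟩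
  · rw [e]
  · rw [e, h2]
  · rw [e, h1]
  · rw [e, h2]

theorem fold_hexagonGluing {f : ℕ → ℤ} (hi : 0 < i) (hj : 0 < j) (h1 : f (i + j) = f 0)
    (h2 : f (i + j + k) = f i) {x : ℕ}
    (hx : x < 2 * (i + j + k)) :
    f (foldSide i j k (hexagonGluing i j k x)) = f (foldSide i j k (x + 1)) := by
  have hs := hexagonGluing_spec hx
  generalize hexagonGluing i j k x = u at *
  obtain ⟨y, hy⟩ : ∃ y, (x < i → y = x + 1) ∧ (i ≤ x → x < i + j → y = x + 1) ∧
    (i + j ≤ x → x < i + j + k → y = x + 1) ∧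
    (i + j + k ≤ x → x < i + j + k + i → y = u) ∧
    (i + j + k + i ≤ x → x < i + j + k + i + j → y = u) ∧ (i + j + k + i + j ≤ x → y = u) := by
    by_cases x < i + j + k
    · exact ⟨x + 1, by omega⟩
    · exact ⟨u, by omega⟩
  rw [fold_spec hi hj h1 h2 (x := u) (y := y), fold_spec hi hj h1 h2 (x := x + 1) (y := y)] <;>
  rcases hs with ⟨h | h, h'⟩ | ⟨h | h, h'⟩ | ⟨h | h, h'⟩ <;> omega

theorem abs_fold_sub_le {f : ℕ → ℤ} (hi : 0 < i) (hj : 0 < j) (h1 : f (i + j) = f 0)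
    (h2 : f (i + j + k) = f i)
    (hf : ∀ y, |f (y + 1) - f y| ≤ 1) {x : ℕ} (hx : x < 2 * (i + j + k)) :
    |f (foldSide i j k (x + 1)) - f (foldSide i j k x)| ≤ 1 := by
  by_cases c1 : x < i + j + k
  · rw [fold_spec hi hj h1 h2 (x := x) (y := x) (by omega),
      fold_spec hi hj h1 h2 (x := x + 1) (y := x + 1) (by omega)]
    exact hf x
  · obtain ⟨y, h3, h4⟩ : ∃ y, f (foldSide i j k (x + 1)) = f y ∧
        f (foldSide i j k x) = f (y + 1) := by
      by_cases c2 : x < i + j + k + i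
      · exact ⟨i + j + k + i - 1 - x, fold_spec hi hj h1 h2 (by omega),
          fold_spec hi hj h1 h2 (by omega)⟩
      by_cases c3 : x < i + j + k + i + j
      · exact ⟨i + j + k + 2 * i + j - 1 - x, fold_spec hi hj h1 h2 (by omega),
          fold_spec hi hj h1 h2 (by omega)⟩
      · exact ⟨2 * (i + j + k) + i + j - 1 - x, fold_spec hi hj h1 h2 (by omega),
          fold_spec hi hj h1 h2 (by omega)⟩
    rw [h3, h4, abs_sub_comm]
    exact hf y

/-- The concatenation of three walks, by steps. -/
def concatStep (a : Fin i → Fin 3) (b : Fin j → Fin 3) (c : Fin k → Fin 3) (x : ℕ) : ℤ :=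
  if h : x < i then ((a ⟨x, h⟩ : ℕ) : ℤ) - 1
  else if h' : x - i < j then ((b ⟨x - i, h'⟩ : ℕ) : ℤ) - 1
  else if h'' : x - i - j < k then ((c ⟨x - i - j, h''⟩ : ℕ) : ℤ) - 1 else 0

/-- The concatenation of three walks, starting at 1. -/
def concatWalk (a : Fin i → Fin 3) (b : Fin j → Fin 3) (c : Fin k → Fin 3) (y : ℕ) : ℤ :=
  1 + ∑ x ∈ Finset.range y, concatStep a b c x

theorem concatWalk_succ (a : Fin i → Fin 3) (b : Fin j → Fin 3) (c : Fin k → Fin 3) (y : ℕ) :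
    concatWalk a b c (y + 1) = concatWalk a b c y + concatStep a b c y := by
  rw [concatWalk, Finset.sum_range_succ, ← add_assoc]
  rfl

theorem abs_concatStep_le (a : Fin i → Fin 3) (b : Fin j → Fin 3) (c : Fin k → Fin 3) (y : ℕ) :
    |concatStep a b c y| ≤ 1 := by
  unfold concatStep
  have h : ∀ s : Fin 3, |((s : ℕ) : ℤ) - 1| ≤ 1 := by decide
  split_ifs
  · exact h _
  · exact h _
  · exact h _
  · simp

theorem concatWalk_left (a : Fin i → Fin 3) (b : Fin j → Fin 3) (c : Fin k → Fin 3) :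
    concatWalk a b c i = 1 + stepSum a := by
  rw [concatWalk, stepSum, Finset.sum_range]
  congr 1
  exact Finset.sum_congr rfl fun x _ => by simp [concatStep]

theorem concatWalk_mid (a : Fin i → Fin 3) (b : Fin j → Fin 3) (c : Fin k → Fin 3) :
    concatWalk a b c (i + j) = 1 + stepSum a + stepSum b := by
  rw [← concatWalk_left a b c, concatWalk, concatWalk, Finset.sum_range_add, add_assoc]
  congr 2
  rw [stepSum, Finset.sum_range]
  exact Finset.sum_congr rfl fun x _ => by simp [concatStep]

theorem concatWalk_right (a : Fin i → Fin 3) (b : Fin j → Fin 3) (c : Fin k → Fin 3) :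
    concatWalk a b c (i + j + k) = 1 + stepSum a + stepSum b + stepSum c := by
  rw [← concatWalk_mid a b c, concatWalk, concatWalk, Finset.sum_range_add, add_assoc]
  congr 2
  rw [stepSum, Finset.sum_range]
  refine Finset.sum_congr rfl fun x _ => ?_
  have h1 : ¬ i + j + x.val < i := by omega
  have h2 : ¬ i + j + x.val - i < j := by omega
  have h3 : i + j + x.val - i - j = x.val := by omega
  simp [concatStep, h1, h2, h3]

theorem concatStep_injective {a a' : Fin i → Fin 3} {b b' : Fin j → Fin 3} {c c' : Fin k → Fin 3}
    (h : ∀ y < i + j + k, concatStep a b c y = concatStep a' b' c' y) :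
    a = a' ∧ b = b' ∧ c = c' := by
  refine ⟨?_, ?_, ?_⟩
  · funext x
    have := h x (by omega)
    simp only [concatStep, x.2, dite_true] at this
    exact Fin.ext (by simpa using this)
  · funext x
    have := h (i + x) (by omega)
    simp only [concatStep, not_lt.2 (Nat.le_add_right i x.val), dite_false, Nat.add_sub_cancel_left,
      x.2, dite_true] at this
    exact Fin.ext (by simpa using this)
  · funext x
    have := h (i + j + x) (by omega)
    have h1 : ¬ i + j + x.val < i := by omega
    have h2 : ¬ i + j + x.val - i < j := by omega
    have h3 : i + j + x.val - i - j = x.val := by omega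
    simp only [concatStep, h1, h2, h3, dite_false, x.2, dite_true] at this
    exact Fin.ext (by simpa using this)

theorem exists_concatWalk_eq (L : ℕ → ℤ) (h0 : L 0 = 1) (h : ∀ y, |L (y + 1) - L y| ≤ 1) :
    ∃ (a : Fin i → Fin 3) (b : Fin j → Fin 3) (c : Fin k → Fin 3),
      ∀ y ≤ i + j + k, concatWalk a b c y = L y := by
  have h' : ∀ y, ∃ s : Fin 3, ((s : ℕ) : ℤ) - 1 = L (y + 1) - L y := fun y => by
    have := abs_le.1 (h y)
    exact ⟨⟨(L (y + 1) - L y + 1).toNat, by omega⟩, by simp only; omega⟩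
  choose s hs using h'
  refine ⟨fun x => s x, fun x => s (i + x), fun x => s (i + j + x), fun y hy => ?_⟩
  induction y with
  | zero => simp [concatWalk, h0]
  | succ y ih =>
    rw [concatWalk_succ, ih (by omega)]
    suffices concatStep (fun x : Fin i => s x) (fun x : Fin j => s (i + x))
        (fun x : Fin k => s (i + j + x)) y = ((s y : ℕ) : ℤ) - 1 by
      rw [this, hs]
      ring
    unfold concatStep
    split_ifs with c1 c2 c3
    · rfl
    · simp only [show i + (y - i) = y by omega]
    · simp only [show i + j + (y - i - j) = y by omega]
    · omega

end Labels

/-! ### Labellings of a glued hexagon as triples of walks -/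

section HexagonCount

variable {n i j k : ℕ}

theorem IsHexagon.cycleCount_eq {α : Perm (Fin (2 * n))} (H : IsHexagon i j k α) (hi : 0 < i)
    (hj : 0 < j) : cycleCount (finRotate (2 * n) * α) + 1 = n := by
  rw [cycleCount_iff_card_branchSet H.invol H.ne (H.no_leaf hi hj), H.card_branchSet hi hj]
  split_ifs <;> simp

theorem IsHexagon.perm_eq {α β : Perm (Fin (2 * n))} (H : IsHexagon i j k α)
    (H' : IsHexagon i j k β) : α = β :=
  Equiv.ext fun x => Fin.ext (by rw [H.2, H'.2])

theorem IsHexagon.isLabelledGluing {α : Perm (Fin (2 * n))} (H : IsHexagon i j k α) (hi : 0 < i)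
    (hj : 0 < j) {f : ℕ → ℤ} (h1 : f (i + j) = f 0) (h2 : f (i + j + k) = f i)
    (hf : ∀ y, |f (y + 1) - f y| ≤ 1) :
    IsLabelledGluing (finRotate (2 * n)) α fun x => f (foldSide i j k x) := by
  have hn := H.1
  have hnext : ∀ d, f (foldSide i j k (finRotate (2 * n) d)) = f (foldSide i j k (d.val + 1)) := by
    intro d
    rcases (finRotate_eq_iff d _).1 rfl with h | ⟨h, h'⟩
    · rw [h]
    · rw [h', fold_spec hi hj h1 h2 (x := d.val + 1) (y := i + j) (by omega), h1]
      rfl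
  have hα : ∀ d, f (foldSide i j k (α d)) = f (foldSide i j k (d.val + 1)) := fun d => by
    rw [H.2]
    exact fold_hexagonGluing hi hj h1 h2 (by omega)
  refine ⟨H.invol, H.ne, fun d => ?_, fun d => ?_⟩
  · rw [hnext, hα]
  · rw [hα]
    exact abs_fold_sub_le hi hj h1 h2 hf (by omega)

/-- The labels along the first half of the border are the three walks; the gluing at the ends of the
segments forces the relations between displacements, and folding gives the second half. -/
theorem IsHexagon.exists_walks {α : Perm (Fin (2 * n))} (H : IsHexagon i j k α) (hi : 0 < i)
    (hj : 0 < j) {l : Fin (2 * n) → ℤ} (hl : IsLabelledGluing (finRotate (2 * n)) α l)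
    (h0 : ∀ d, d.val = 0 → l d = 1) :
    ∃ (a : Fin i → Fin 3) (b : Fin j → Fin 3) (c : Fin k → Fin 3),
      stepSum a + stepSum b = 0 ∧ stepSum b + stepSum c = 0 ∧
      ∀ x, l x = concatWalk a b c (foldSide i j k x) := by
  have hn := H.1
  -- Beyond the border the value at corner 0 is repeated, so that the last side needs no separate
  -- treatment.
  let L : ℕ → ℤ := fun x => if h : x < 2 * n then l ⟨x, h⟩ else l ⟨0, by omega⟩
  have hL : ∀ x : Fin (2 * n), L x = l x := fun x => dif_pos x.2
  have hLn : ∀ x, 2 * n ≤ x → L x = 1 := fun x hx => (dif_neg (not_lt.2 hx)).trans (h0 _ rfl)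
  have hL0 : L 0 = 1 := by
    rw [← h0 ⟨0, by omega⟩ rfl, ← hL]
  have hnext : ∀ x : Fin (2 * n), L (x.val + 1) = l (α x) := by
    intro x
    rw [← hl.next]
    rcases (finRotate_eq_iff x _).1 rfl with h | ⟨h, h'⟩
    · rw [h, hL]
    · rw [h0 _ h', hLn _ h.ge]
  have hglue : ∀ x < 2 * n, L (hexagonGluing i j k x) = L (x + 1) := fun x hx => by
    have := hnext ⟨x, hx⟩
    rw [← hL, H.2] at this
    exact this.symm
  have hstep : ∀ x, |L (x + 1) - L x| ≤ 1 := by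
    intro x
    by_cases hx : x < 2 * n
    · rw [hnext ⟨x, hx⟩, show L x = l ⟨x, hx⟩ from hL ⟨x, hx⟩]
      exact hl.edge _
    · rw [hLn x (by omega), hLn (x + 1) (by omega)]
      simp
  have hg : ∀ x y z, x < 2 * n → y = x + 1 → hexagonGluing i j k x = z → L y = L z := by
    rintro x y z hx rfl rfl
    exact (hglue x hx).symm
  -- The corners `i + j`, `n + i`, `0` belong to one branch vertex, `i` and `n` to one as well.
  have e1 : L (i + j) = L (i + j + k + i) := by
    refine hg (i + j - 1) _ _ (by omega) (by omega) ?_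
    have := hexagonGluing_spec (i := i) (j := j) (k := k) (x := i + j - 1) (by omega)
    omega
  have e2 : L (i + j + k + i) = L 0 := by
    refine hg (i + j + k + i - 1) _ _ (by omega) (by omega) ?_
    have := hexagonGluing_spec (i := i) (j := j) (k := k) (x := i + j + k + i - 1) (by omega)
    omega
  have e3 : L i = L (i + j + k) := by
    refine hg (i - 1) _ _ (by omega) (by omega) ?_
    have := hexagonGluing_spec (i := i) (j := j) (k := k) (x := i - 1) (by omega)
    omega
  obtain ⟨a, b, c, habc⟩ := exists_concatWalk_eq (i := i) (j := j) (k := k) L hL0 hstep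
  have s1 := concatWalk_left a b c
  have s2 := concatWalk_mid a b c
  have s3 := concatWalk_right a b c
  rw [habc _ (by omega)] at s1 s2 s3
  refine ⟨a, b, c, by omega, by omega, fun x => ?_⟩
  have hx := x.2
  have hle : foldSide i j k x ≤ i + j + k := by
    unfold foldSide
    split_ifs <;> omega
  rw [habc _ hle, ← hL]
  by_cases hxn : x.val ≤ i + j + k
  · rw [foldSide, if_pos hxn]
  · refine hg (x.val - 1) _ _ (by omega) (by omega) ?_
    have := hexagonGluing_spec (i := i) (j := j) (k := k) (x := x.val - 1) (by omega)
    unfold foldSide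
    split_ifs <;> omega

/-- The number of triples of walks with the same displacement. -/
noncomputable def walkTriples (n i j k : ℕ) : ℕ :=
  ∑ h ∈ Finset.Icc (-(n : ℤ)) n, walkCount i h * walkCount j h * walkCount k h

/-- The displacements are `h`, `-h`, `h`, because the border runs along `B` in the sense opposite to
`A` and `C` between the branch vertices; `walkCount_neg` removes the sign. -/
theorem card_walks (hn : i ≤ n) : (Finset.univ.filter fun w : (Fin i → Fin 3) × (Fin j → Fin 3) ×
    (Fin k → Fin 3) => stepSum w.1 + stepSum w.2.1 = 0 ∧ stepSum w.2.1 + stepSum w.2.2 = 0).card =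
      walkTriples n i j k := by
  rw [walkTriples, Finset.card_eq_sum_card_fiberwise (f := fun w => stepSum w.1)
    (t := Finset.Icc (-(n : ℤ)) n)]
  · refine Finset.sum_congr rfl fun h _ => ?_
    rw [← walkCount_neg j, walkCount, walkCount, walkCount, mul_assoc, ← Finset.card_product,
      ← Finset.card_product]
    congr 1
    ext ⟨a, b, c⟩
    simp only [Finset.mem_filter, Finset.mem_univ, true_and, Finset.mem_product]
    omega
  · rintro ⟨a, b, c⟩ _
    have := abs_le.1 (abs_stepSum_le a)
    simp only [Finset.coe_Icc, Set.mem_Icc]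
    omega

open Classical in
theorem card_filter_isHexagon (hi : 0 < i) (hj : 0 < j) (h : i + j + k = n) :
    ((oneTreeFinset n).filter fun p => IsHexagon i j k p.1).card = walkTriples n i j k := by
  obtain ⟨α, H⟩ := exists_perm_isHexagon h
  rw [← card_walks (n := n) (i := i) (by omega)]
  symm
  have hsum : ∀ w : (Fin i → Fin 3) × (Fin j → Fin 3) × (Fin k → Fin 3),
      stepSum w.1 + stepSum w.2.1 = 0 → stepSum w.2.1 + stepSum w.2.2 = 0 →
      concatWalk w.1 w.2.1 w.2.2 (i + j) = concatWalk w.1 w.2.1 w.2.2 0 ∧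
      concatWalk w.1 w.2.1 w.2.2 (i + j + k) = concatWalk w.1 w.2.1 w.2.2 i := by
    intro w h1 h2
    rw [concatWalk_mid, concatWalk_right, concatWalk_left, concatWalk, Finset.sum_range_zero]
    omega
  refine Finset.card_bij (fun w _ => (α, fun x => concatWalk w.1 w.2.1 w.2.2 (foldSide i j k x)))
    ?_ ?_ ?_
  · intro w hw
    obtain ⟨-, h1, h2⟩ := Finset.mem_filter.1 hw
    obtain ⟨h1, h2⟩ := hsum w h1 h2
    refine Finset.mem_filter.2 ⟨mem_oneTreeFinset.2 ⟨?_, fun d hd => ?_, H.cycleCount_eq hi hj⟩, H⟩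
    · refine H.isLabelledGluing hi hj h1 h2 fun y => ?_
      rw [concatWalk_succ, add_sub_cancel_left]
      exact abs_concatStep_le _ _ _ _
    · simp only [hd]
      rfl
  · rintro ⟨a, b, c⟩ _ ⟨a', b', c'⟩ _ e
    have e : ∀ y ≤ i + j + k, concatWalk a b c y = concatWalk a' b' c' y := fun y hy => by
      have := congrFun (congrArg Prod.snd e) ⟨y, by omega⟩
      simpa only [foldSide, if_pos hy] using this
    obtain ⟨rfl, rfl, rfl⟩ := concatStep_injective (a := a) (b := b) (c := c) (a' := a') (b' := b')
      (c' := c') fun y hy => by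
        have e1 := e (y + 1) hy
        rw [concatWalk_succ, concatWalk_succ, e y hy.le] at e1
        exact add_left_cancel e1
    rfl
  · rintro ⟨β, l⟩ hp
    obtain ⟨hp, Hβ⟩ := Finset.mem_filter.1 hp
    obtain rfl := H.perm_eq Hβ
    obtain ⟨hl, h0, -⟩ := mem_oneTreeFinset.1 hp
    obtain ⟨a, b, c, h1, h2, h3⟩ := H.exists_walks hi hj hl h0
    exact ⟨(a, b, c), by simp [h1, h2], Prod.ext rfl (funext fun x => (h3 x).symm)⟩

open Classical in
theorem card_filter_exists_isHexagon (s : Finset (ℕ × ℕ × ℕ))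
    (hs : ∀ x ∈ s, 0 < x.1 ∧ 0 < x.2.1 ∧ x.1 + x.2.1 + x.2.2 = n) :
    ((oneTreeFinset n).filter fun p => ∃ x ∈ s, IsHexagon x.1 x.2.1 x.2.2 p.1).card =
      ∑ x ∈ s, walkTriples n x.1 x.2.1 x.2.2 := by
  rw [← Finset.sum_congr rfl fun x hx =>
    card_filter_isHexagon (n := n) (hs x hx).1 (hs x hx).2.1 (hs x hx).2.2, ← Finset.card_biUnion]
  · congr 1
    ext p
    simp only [Finset.mem_filter, Finset.mem_biUnion]
    tauto
  · intro x hx y hy hxy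
    rw [Function.onFun, Finset.disjoint_left]
    intro p hp hp'
    have := (Finset.mem_filter.1 hp).2.unique (Finset.mem_filter.1 hp').2 (hs x hx).1 (hs x hx).2.1
      (hs y hy).1 (hs y hy).2.1
    exact hxy (Prod.ext this.1 (Prod.ext this.2.1 this.2.2))

end HexagonCount

/-! ### Rerooting at a branch corner -/

section Rerooting

variable {n : ℕ}

theorem mem_branchSet_conj (i : ℤ) (α : Perm (Fin (2 * n))) (d : Fin (2 * n)) :
    d ∈ branchSet (finRotate (2 * n) * ((finRotate (2 * n) ^ i)⁻¹ * α * finRotate (2 * n) ^ i)) ↔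
      (finRotate (2 * n) ^ i) d ∈ branchSet (finRotate (2 * n) * α) := by
  have h : finRotate (2 * n) * ((finRotate (2 * n) ^ i)⁻¹ * α * finRotate (2 * n) ^ i) =
      (finRotate (2 * n) ^ i)⁻¹ * (finRotate (2 * n) * α) * finRotate (2 * n) ^ i := by
    group
  rw [h]
  simp only [branchSet, Finset.mem_filter, Finset.mem_univ, true_and, ne_eq, not_iff_not]
  rw [Perm.mul_apply, Perm.mul_apply, Perm.mul_apply _ _ d, Perm.mul_apply _ _ ((_ : Perm _) d),
    perm_apply_inv_self, Perm.inv_eq_iff_eq]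

theorem no_leaf_conj (i : ℤ) (α : Perm (Fin (2 * n))) :
    (∀ d, finRotate (2 * n) (((finRotate (2 * n) ^ i)⁻¹ * α * finRotate (2 * n) ^ i) d) ≠ d) ↔
      ∀ d, finRotate (2 * n) (α d) ≠ d := by
  exact (forall_congr' fun d => not_iff_not.2 (isLeaf_rotate_iff i α d)).trans
    ((finRotate (2 * n) ^ i).surjective.forall (p := fun d => finRotate (2 * n) (α d) ≠ d)).symm

/-- Rerooting of one-face maps without leaves at a vertex of degree at least three. -/
theorem mul_card_filter_branchSet (hn : 0 < 2 * n) (m : ℕ) :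
    m * ((oneTreeFinset n).filter fun p => (∀ d, finRotate (2 * n) (p.1 d) ≠ d) ∧
      (branchSet (finRotate (2 * n) * p.1)).card = m).card =
    2 * n * ((oneTreeFinset n).filter fun p => (∀ d, finRotate (2 * n) (p.1 d) ≠ d) ∧
      (branchSet (finRotate (2 * n) * p.1)).card = m ∧
      ⟨0, hn⟩ ∈ branchSet (finRotate (2 * n) * p.1)).card := by
  have h := sum_sum_rotate (n := n) (fun α d => if (∀ d, finRotate (2 * n) (α d) ≠ d) ∧
      (branchSet (finRotate (2 * n) * α)).card = m ∧ d ∈ branchSet (finRotate (2 * n) * α)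
        then 1 else 0) (fun i α d => by
      refine if_congr ?_ rfl rfl
      rw [no_leaf_conj, mem_branchSet_conj]
      have hc : (branchSet (finRotate (2 * n) * ((finRotate (2 * n) ^ i)⁻¹ * α *
          finRotate (2 * n) ^ i))).card = (branchSet (finRotate (2 * n) * α)).card := by
        rw [← Finset.card_map (finRotate (2 * n) ^ i).toEmbedding]
        congr 1
        ext x
        simp only [Finset.mem_map_equiv, mem_branchSet_conj, Equiv.apply_symm_apply]
      rw [hc]) ⟨0, hn⟩
  rw [smul_eq_mul, ← Finset.card_filter] at h
  rw [← h, Finset.card_filter, Finset.mul_sum]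
  refine Finset.sum_congr rfl fun p _ => ?_
  by_cases h1 : (∀ d, finRotate (2 * n) (p.1 d) ≠ d) ∧
      (branchSet (finRotate (2 * n) * p.1)).card = m
  · rw [if_pos h1]
    simp only [h1.1, h1.2, true_and, implies_true, ne_eq, not_false_eq_true]
    rw [← Finset.card_filter, Finset.filter_mem_eq_inter, Finset.univ_inter, h1.2, mul_one]
  · rw [if_neg h1, mul_zero]
    symm
    exact Finset.sum_eq_zero fun d _ => if_neg fun h2 => h1 ⟨h2.1, h2.2.1⟩

end Rerooting

/-! ### Counting reduced one-face maps -/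

section ReducedCount

open Finset.HasAntidiagonal (antidiagonal mem_antidiagonal)

variable {n : ℕ}

/-- The number of walks of positive length `i` with displacement `h`. -/
def posWalkCount (i : ℕ) (h : ℤ) : ℕ := if i = 0 then 0 else walkCount i h

theorem walkTriples_zero_right (i j : ℕ) : walkTriples n i j 0 = walkCount i 0 * walkCount j 0 := by
  rw [walkTriples, Finset.sum_eq_single 0]
  · simp [walkCount_zero]
  · intro h _ hh
    simp [walkCount_zero, hh]
  · intro h
    simp at h

-- The case `k = 0` of the hexagon: the empty third walk forces displacement 0 on the other two.
open Classical in
theorem card_filter_four (hn : 0 < 2 * n) :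
    ((oneTreeFinset n).filter fun p => (∀ d, finRotate (2 * n) (p.1 d) ≠ d) ∧
      (branchSet (finRotate (2 * n) * p.1)).card = 4 ∧
      ⟨0, hn⟩ ∈ branchSet (finRotate (2 * n) * p.1)).card =
    ∑ x ∈ antidiagonal n, posWalkCount x.1 0 * posWalkCount x.2 0 := by
  have h := card_filter_exists_isHexagon (n := n)
    (((antidiagonal n).filter fun x => 0 < x.1 ∧ 0 < x.2).image fun x => (x.1, x.2, 0)) (by
      simp only [Finset.mem_image, Finset.mem_filter, mem_antidiagonal]
      rintro _ ⟨⟨a, b⟩, h, rfl⟩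
      simp only at h ⊢
      omega)
  rw [Finset.sum_image fun x _ y _ e => by simpa [Prod.ext_iff] using e, Finset.sum_filter] at h
  refine Eq.trans ?_ (h.trans (Finset.sum_congr rfl fun x _ => ?_))
  · congr 1
    refine Finset.filter_congr fun p hp => ?_
    obtain ⟨hl, -, -⟩ := mem_oneTreeFinset.1 hp
    constructor
    · rintro ⟨h1, h2, h3⟩
      obtain ⟨i, j, hi, hj, H⟩ := (exists_isHexagon hl.invol hl.ne h1 hn h3).1 h2
      refine ⟨(i, j, 0), Finset.mem_image.2 ⟨(i, j), ?_, rfl⟩, H⟩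
      have := H.1
      exact Finset.mem_filter.2 ⟨mem_antidiagonal.2 this, hi, hj⟩
    · rintro ⟨⟨i, j, k⟩, hx, H⟩
      simp only [Finset.mem_image, Finset.mem_filter, mem_antidiagonal, Prod.mk.injEq] at hx
      obtain ⟨⟨i', j'⟩, ⟨-, hi, hj⟩, rfl, rfl, rfl⟩ := hx
      exact ⟨H.no_leaf hi hj, by rw [H.card_branchSet hi hj, if_pos rfl],
        (H.mem_branchSet hi hj _).2 (Or.inl rfl)⟩
  · simp only [walkTriples_zero_right, posWalkCount]
    split_ifs <;> first | rfl | omega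

open Classical in
theorem card_filter_six (hn : 0 < 2 * n) :
    ((oneTreeFinset n).filter fun p => (∀ d, finRotate (2 * n) (p.1 d) ≠ d) ∧
      (branchSet (finRotate (2 * n) * p.1)).card = 6 ∧
      ⟨0, hn⟩ ∈ branchSet (finRotate (2 * n) * p.1)).card =
    ∑ h ∈ Finset.Icc (-(n : ℤ)) n, ∑ x ∈ antidiagonal n, posWalkCount x.1 h *
      ∑ y ∈ antidiagonal x.2, posWalkCount y.1 h * posWalkCount y.2 h := by
  have h := card_filter_exists_isHexagon (n := n)
    ((((antidiagonal n).sigma fun x => antidiagonal x.2).filter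
      fun x => 0 < x.1.1 ∧ 0 < x.2.1 ∧ 0 < x.2.2).image fun x => (x.1.1, x.2.1, x.2.2)) (by
        simp only [Finset.mem_image, Finset.mem_filter, Finset.mem_sigma, mem_antidiagonal]
        rintro _ ⟨⟨⟨a, b⟩, c, d⟩, h, rfl⟩
        simp only at h ⊢
        omega)
  rw [Finset.sum_image, Finset.sum_filter, Finset.sum_sigma] at h
  · refine Eq.trans ?_ (h.trans ?_)
    · congr 1
      refine Finset.filter_congr fun p hp => ?_
      obtain ⟨hl, -, -⟩ := mem_oneTreeFinset.1 hp
      constructor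
      · rintro ⟨h1, h2, h3⟩
        obtain ⟨i, j, k, hi, hj, hk, H⟩ := (exists_isHexagon hl.invol hl.ne h1 hn h3).2 h2
        refine ⟨(i, j, k), Finset.mem_image.2 ⟨⟨(i, j + k), (j, k)⟩, ?_, rfl⟩, H⟩
        have := H.1
        exact Finset.mem_filter.2 ⟨Finset.mem_sigma.2 ⟨mem_antidiagonal.2 (by simp only; omega),
          mem_antidiagonal.2 rfl⟩, hi, hj, hk⟩
      · rintro ⟨⟨i, j, k⟩, hx, H⟩
        simp only [Finset.mem_image, Finset.mem_filter, Prod.mk.injEq] at hx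
        obtain ⟨x, ⟨-, hi, hj, hk⟩, rfl, rfl, rfl⟩ := hx
        exact ⟨H.no_leaf hi hj, by rw [H.card_branchSet hi hj, if_neg hk.ne'],
          (H.mem_branchSet hi hj _).2 (Or.inl rfl)⟩
    · rw [Finset.sum_comm]
      refine Finset.sum_congr rfl fun x _ => ?_
      simp only [Finset.mul_sum]
      rw [Finset.sum_comm]
      refine Finset.sum_congr rfl fun y _ => ?_
      simp only [walkTriples, posWalkCount]
      split_ifs <;> first | omega | simp [mul_assoc]
  · rintro ⟨⟨a, b⟩, c, d⟩ hx ⟨⟨a', b'⟩, c', d'⟩ hy e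
    simp only [Finset.coe_filter, Finset.mem_sigma, mem_antidiagonal, Set.mem_ofPred_eq,
      Prod.mk.injEq] at hx hy e
    obtain ⟨rfl, rfl, rfl⟩ := e
    obtain rfl : b = b' := by omega
    rfl

/-- Out of `2 n` corners, 4 or 6 are branch corners, so rerooting multiplies the two counts by `2 n
/ 4` and `2 n / 6`. -/
theorem reducedTreeCount_div (n : ℕ) : (reducedTreeCount 1 n : ℚ) / n =
    1 / 2 * ((∑ x ∈ antidiagonal n, posWalkCount x.1 0 * posWalkCount x.2 0 : ℕ) : ℚ) +
    1 / 3 * ((∑ h ∈ Finset.Icc (-(n : ℤ)) n, ∑ x ∈ antidiagonal n, posWalkCount x.1 h *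
      ∑ y ∈ antidiagonal x.2, posWalkCount y.1 h * posWalkCount y.2 h : ℕ) : ℚ) := by
  classical
  rcases Nat.eq_zero_or_pos n with rfl | hpos
  · simp [posWalkCount]
  have hn : 0 < 2 * n := by omega
  rw [← card_filter_four hn, ← card_filter_six hn]
  have h4 := mul_card_filter_branchSet hn 4
  have h6 := mul_card_filter_branchSet hn 6
  have h : reducedTreeCount 1 n = ((oneTreeFinset n).filter fun p =>
      (∀ d, finRotate (2 * n) (p.1 d) ≠ d) ∧
      (branchSet (finRotate (2 * n) * p.1)).card = 4).card + ((oneTreeFinset n).filter fun p =>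
      (∀ d, finRotate (2 * n) (p.1 d) ≠ d) ∧
      (branchSet (finRotate (2 * n) * p.1)).card = 6).card := by
    rw [← Finset.card_union_of_disjoint, ← Finset.filter_or, reducedTreeCount_eq_card]
    · congr 1
      refine Finset.filter_congr fun p hp => ?_
      obtain ⟨hl, -, hc⟩ := mem_oneTreeFinset.1 hp
      rw [← and_or_left, iff_self_and]
      exact fun h1 => (cycleCount_iff_card_branchSet hl.invol hl.ne h1).1 hc
    · rw [Finset.disjoint_filter]
      rintro p _ ⟨-, h⟩ ⟨-, h'⟩
      omega
  have h4' := congrArg (Nat.cast : ℕ → ℚ) h4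
  have h6' := congrArg (Nat.cast : ℕ → ℚ) h6
  have hn' : (n : ℚ) ≠ 0 := by positivity
  rw [h, div_eq_iff hn']
  push_cast at h4' h6' ⊢
  linear_combination h4' / 4 + h6' / 6

end ReducedCount

end TorusMaps

namespace TorusMaps

open PowerSeries

/-! ### Fixed points in the ring of power series -/

section FixedPoint

/-- A contraction of the ring of power series has a unique fixed point. -/
theorem existsUnique_eq_of_dvd (F : ℚ⟦X⟧ → ℚ⟦X⟧) (hF : ∀ f g, X * (f - g) ∣ F f - F g) :
    ∃! f, f = F f := by
  have hF' : ∀ k f g, (X : ℚ⟦X⟧) ^ k ∣ f - g → X ^ (k + 1) ∣ F f - F g := fun k f g h => by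
    rw [pow_succ']
    exact (mul_dvd_mul_left X h).trans (hF f g)
  let a : ℕ → ℚ⟦X⟧ := fun n => F^[n] 0
  have ha : ∀ n, a (n + 1) = F (a n) := fun n => Function.iterate_succ_apply' F n 0
  have h1 : ∀ n, (X : ℚ⟦X⟧) ^ n ∣ a (n + 1) - a n := by
    intro n
    induction n with
    | zero => simp
    | succ n ih =>
      rw [ha (n + 1), ha n]
      exact hF' _ _ _ (ha n ▸ ih)
  have h2 : ∀ m n, m < n → coeff m (a n) = coeff m (a (m + 1)) := by
    intro m n hmn
    induction n, hmn using Nat.le_induction with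
    | base => rfl
    | succ n hn ih =>
      have := X_pow_dvd_iff.1 (h1 n) m (by omega)
      rw [map_sub, sub_eq_zero] at this
      rw [this, ih]
  -- The coefficient of index `n` is stationary from the iterate `n + 1` on.
  let f : ℚ⟦X⟧ := PowerSeries.mk fun n => coeff n (a (n + 1))
  have h3 : ∀ n, X ^ n ∣ f - a n := fun n => X_pow_dvd_iff.2 fun m hm => by
    rw [map_sub, coeff_mk, h2 m n hm, sub_self]
  refine ⟨f, ?_, fun g hg => ?_⟩
  · ext n
    have e1 := X_pow_dvd_iff.1 (h3 (n + 1)) n (by omega)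
    have e2 := X_pow_dvd_iff.1 (hF' n _ _ (h3 n)) n (by omega)
    rw [map_sub, sub_eq_zero] at e1 e2
    rw [e1, e2, ha]
  · have h4 : ∀ n, X ^ n ∣ g - a n := by
      intro n
      induction n with
      | zero => simp
      | succ n ih =>
        rw [ha, hg]
        exact hF' n _ _ ih
    ext n
    have e1 := X_pow_dvd_iff.1 (h3 (n + 1)) n (by omega)
    have e2 := X_pow_dvd_iff.1 (h4 (n + 1)) n (by omega)
    rw [map_sub, sub_eq_zero] at e1 e2
    rw [e1, e2]

end FixedPoint

/-! ### Generating series of walks and of reduced maps -/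

section WalkSeries

/-- The generating series of walks by displacement; the series `u` counts first passages at `-1`,
and `B` walks that end where they start. -/
theorem exists_walkSeries : ∃ u B : ℚ⟦X⟧, u = X * (1 + u + u ^ 2) ∧
    B * (1 - u ^ 2) = 1 + u + u ^ 2 ∧
    ∀ (i : ℕ) (h : ℤ), (walkCount i h : ℚ) = coeff i (B * u ^ h.natAbs) := by
  obtain ⟨u, hu, -⟩ := existsUnique_eq_of_dvd (fun u => X * (1 + u + u ^ 2)) fun f g =>
    ⟨1 + f + g, by ring⟩
  have hu0 : constantCoeff u = 0 := by
    rw [hu]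
    simp
  have hB : (1 + u + u ^ 2) * (1 - u ^ 2)⁻¹ * (1 - u ^ 2) = 1 + u + u ^ 2 := by
    rw [mul_assoc, PowerSeries.inv_mul_cancel _ (by simp [hu0]), mul_one]
  generalize (1 + u + u ^ 2) * (1 - u ^ 2)⁻¹ = B at hB
  have hB0 : constantCoeff B = 1 := by
    have := congrArg constantCoeff hB
    simpa [hu0] using this
  refine ⟨u, B, hu, hB, fun i => ?_⟩
  -- The step recursion at displacement 0, obtained after multiplication by the nonzero series `1 +
  -- u + u ^ 2`. At other displacements the recursion is the equation of `u` multiplied by `B * u ^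
  -- m`.
  have hB' : B = 1 + X * (B * u + B + B * u) := by
    have hq : 1 + u + u ^ 2 ≠ 0 := fun h => by
      have := congrArg constantCoeff h
      simp [hu0] at this
    apply mul_right_cancel₀ hq
    linear_combination hB + (B + 2 * B * u) * hu
  have hpos : ∀ m : ℕ, B * u ^ (m + 1) = X * (B * u ^ m + B * u ^ (m + 1) + B * u ^ (m + 2)) :=
    fun m => by linear_combination B * u ^ m * hu
  induction i with
  | zero =>
    intro h
    rw [walkCount_zero, coeff_zero_eq_constantCoeff_apply, map_mul, map_pow, hB0, hu0, one_mul]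
    split_ifs with hh
    · simp [hh]
    · rw [zero_pow (by omega)]
      rfl
  | succ i ih =>
    intro h
    rw [walkCount_succ]
    push_cast
    rw [ih, ih, ih, ← map_add, ← map_add, ← coeff_succ_X_mul]
    rcases lt_trichotomy h 0 with hh | rfl | hh
    · obtain ⟨m, hm⟩ : ∃ m, h.natAbs = m + 1 := ⟨h.natAbs - 1, by omega⟩
      rw [hm, show (h - 1).natAbs = m + 2 by omega, show (h + 1).natAbs = m by omega]
      conv_rhs => rw [hpos m]
      exact congrArg _ (by ring)
    · have e : coeff (i + 1) (1 : ℚ⟦X⟧) = 0 := by simp [coeff_one]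
      simp only [zero_sub, Int.natAbs_neg, Int.natAbs_one, Int.natAbs_zero, pow_one, pow_zero,
        mul_one, zero_add]
      nth_rw 4 [hB']
      rw [map_add, e, zero_add]
    · obtain ⟨m, hm⟩ : ∃ m, h.natAbs = m + 1 := ⟨h.natAbs - 1, by omega⟩
      rw [hm, show (h - 1).natAbs = m by omega, show (h + 1).natAbs = m + 2 by omega]
      conv_rhs => rw [hpos m]

/-- `G m` is the series of nonempty walks of displacement `m` or, equally, `-m`; this symmetry folds
the sum over `[-n, n]`. -/
theorem coeff_Rhat (n : ℕ) (G : ℕ → ℚ⟦X⟧)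
    (hG : ∀ (i : ℕ) (h : ℤ), coeff i (G h.natAbs) = posWalkCount i h) :
    coeff n (Rhat 1) = coeff n (C (1 / 2) * G 0 ^ 2 + C (1 / 3) * (G 0 ^ 3 +
      2 * ∑ m ∈ Finset.range n, G (m + 1) ^ 3)) := by
  have h1 : ∀ m, coeff n (G m ^ 3) = ((∑ x ∈ Finset.HasAntidiagonal.antidiagonal n,
      posWalkCount x.1 m * ∑ y ∈ Finset.HasAntidiagonal.antidiagonal x.2,
        posWalkCount y.1 m * posWalkCount y.2 m : ℕ) : ℚ) := by
    intro m
    have h := fun i => hG i (m : ℤ)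
    simp only [Int.natAbs_natCast] at h
    rw [show G m ^ 3 = G m * (G m * G m) by ring, coeff_mul]
    simp only [coeff_mul, h]
    push_cast
    rfl
  have h2 : coeff n (G 0 ^ 2) = ((∑ x ∈ Finset.HasAntidiagonal.antidiagonal n,
      posWalkCount x.1 0 * posWalkCount x.2 0 : ℕ) : ℚ) := by
    have h := fun i => hG i 0
    simp only [Int.natAbs_zero] at h
    rw [pow_two, coeff_mul]
    simp only [h]
    push_cast
    rfl
  have hev : ∀ i (h : ℤ), posWalkCount i (-h) = posWalkCount i h := fun i h => by
    rw [posWalkCount, posWalkCount, walkCount_neg]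
  rw [Rhat, coeff_mk, reducedTreeCount_div, ← h2, Nat.cast_sum,
    Finset.sum_Icc_of_even_eq_range fun h => by
    simp only [hev], Finset.sum_range_succ', map_add, coeff_C_mul, coeff_C_mul, map_add, two_mul,
    map_add, map_sum]
  simp only [h1]
  push_cast
  simp only [nsmul_eq_mul]
  push_cast
  ring

/-- The sum over displacements is geometric of ratio `u ^ 3`. As `X = u / (1 + u + u ^ 2)`, both
sides become rational functions of `u`, compared in the fraction field. -/
theorem Rhat_eq : Rhat 1 = X ^ 2 * (1 + 3 * X) * (2 * (1 - 3 * X) ^ 2 * (1 + X))⁻¹ := by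
  obtain ⟨u, B, hu, hB, hw⟩ := exists_walkSeries
  have hu0 : constantCoeff u = 0 := by
    rw [hu]
    simp
  have hI : (1 - u ^ 3) * (1 - u ^ 3)⁻¹ = 1 := PowerSeries.mul_inv_cancel _ (by simp [hu0])
  generalize (1 - u ^ 3)⁻¹ = I at hI
  have hR : Rhat 1 = C (1 / 2) * (B - 1) ^ 2 +
      C (1 / 3) * ((B - 1) ^ 3 + 2 * (B ^ 3 * u ^ 3 * I)) := by
    ext n
    -- Only displacement 0 admits the empty walk, which has to be removed.
    rw [coeff_Rhat n (fun m => if m = 0 then B - 1 else B * u ^ m)]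
    · have hs : ∀ N, ∑ m ∈ Finset.range N, (B * u ^ (m + 1)) ^ 3 =
          B ^ 3 * u ^ 3 * I - u ^ (3 * N) * (B ^ 3 * u ^ 3 * I) := by
        intro N
        induction N with
        | zero => simp
        | succ N ih =>
          rw [Finset.sum_range_succ, ih]
          linear_combination - B ^ 3 * u ^ 3 * u ^ (3 * N) * hI
      -- The remainder of the geometric series does not reach the coefficient of index `n`.
      have hX : X ^ (n + 1) ∣ u ^ (3 * n) * (B ^ 3 * u ^ 3 * I) := by
        have h1 : X ∣ u := X_dvd_iff.2 hu0
        have h2 : X ^ (n + 1) ∣ u ^ (n + 1) := pow_dvd_pow_of_dvd h1 _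
        exact h2.trans ⟨u ^ (2 * n + 2) * (B ^ 3 * I), by ring⟩
      simp only [if_true, Nat.succ_ne_zero, if_false, hs]
      have h0 := X_pow_dvd_iff.1 hX n (by omega)
      simp only [two_mul, map_add, coeff_C_mul, map_sub, h0, sub_zero]
    · intro i h
      simp only [Int.natAbs_eq_zero]
      by_cases hh : h = 0
      · subst hh
        have := hw i 0
        rw [if_pos rfl, posWalkCount, map_sub, coeff_one]
        simp only [Int.natAbs_zero, pow_zero, mul_one] at this
        rw [← this]
        split_ifs with hi
        · subst hi
          simp [walkCount_zero]
        · simp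
      · rw [if_neg hh, ← hw, posWalkCount]
        split_ifs with hi
        · subst hi
          simp [walkCount_zero, hh]
        · rfl
  have hD : constantCoeff (2 * (1 - 3 * X) ^ 2 * (1 + X) : ℚ⟦X⟧) ≠ 0 := by
    simp [map_ofNat]
  rw [eq_mul_inv_iff_mul_eq hD, hR]
  have hinj := IsFractionRing.injective ℚ⟦X⟧ (FractionRing ℚ⟦X⟧)
  have hne : ∀ f : ℚ⟦X⟧, constantCoeff f ≠ 0 → algebraMap ℚ⟦X⟧ (FractionRing ℚ⟦X⟧) f ≠ 0 := by
    intro f hf h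
    rw [map_eq_zero_iff _ hinj] at h
    exact hf (by rw [h, map_zero])
  have n1 := hne (1 + u + u ^ 2) (by simp [hu0])
  have n2 := hne (1 - u ^ 2) (by simp [hu0])
  have n3 := hne (1 - u ^ 3) (by simp [hu0])
  have c2 : (C (1 / 2) : ℚ⟦X⟧) * 2 = 1 := by
    rw [← map_ofNat C 2, ← map_mul]
    norm_num
  have c3 : (C (1 / 3) : ℚ⟦X⟧) * 3 = 1 := by
    rw [← map_ofNat C 3, ← map_mul]
    norm_num
  apply hinj
  replace hu := congrArg (algebraMap ℚ⟦X⟧ (FractionRing ℚ⟦X⟧)) hu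
  replace hB := congrArg (algebraMap ℚ⟦X⟧ (FractionRing ℚ⟦X⟧)) hB
  replace hI := congrArg (algebraMap ℚ⟦X⟧ (FractionRing ℚ⟦X⟧)) hI
  replace c2 := congrArg (algebraMap ℚ⟦X⟧ (FractionRing ℚ⟦X⟧)) c2
  replace c3 := congrArg (algebraMap ℚ⟦X⟧ (FractionRing ℚ⟦X⟧)) c3
  simp only [map_mul, map_add, map_sub, map_pow, map_one, map_ofNat] at *
  generalize algebraMap ℚ⟦X⟧ (FractionRing ℚ⟦X⟧) u = u' at *
  generalize algebraMap ℚ⟦X⟧ (FractionRing ℚ⟦X⟧) B = B' at *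
  generalize algebraMap ℚ⟦X⟧ (FractionRing ℚ⟦X⟧) I = I' at *
  generalize algebraMap ℚ⟦X⟧ (FractionRing ℚ⟦X⟧) X = x at *
  generalize algebraMap ℚ⟦X⟧ (FractionRing ℚ⟦X⟧) (C (1 / 2)) = a at *
  generalize algebraMap ℚ⟦X⟧ (FractionRing ℚ⟦X⟧) (C (1 / 3)) = b at *
  have hx : x = u' / (1 + u' + u' ^ 2) := by rw [eq_div_iff n1, ← hu]
  have hB'' : B' = (1 + u' + u' ^ 2) / (1 - u' ^ 2) := by rw [eq_div_iff n2, hB]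
  have hI'' : I' = 1 / (1 - u' ^ 3) := by rw [eq_div_iff n3, mul_comm, hI]
  have n4 : (2 : FractionRing ℚ⟦X⟧) ≠ 0 := fun h => by simp [h] at c2
  have n5 : (3 : FractionRing ℚ⟦X⟧) ≠ 0 := fun h => by simp [h] at c3
  have ha : a = 1 / 2 := by rw [eq_div_iff n4, c2]
  have hb : b = 1 / 3 := by rw [eq_div_iff n5, c3]
  have n6 : 1 - u' ≠ 0 := fun h => n2 (by linear_combination (1 + u') * h)
  have n7 : 1 + u' ≠ 0 := fun h => n2 (by linear_combination (1 - u') * h)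
  have e2 : 1 - u' ^ 2 = (1 - u') * (1 + u') := by ring
  have e3 : 1 - u' ^ 3 = (1 - u') * (1 + u' + u' ^ 2) := by ring
  rw [hx, hB'', hI'', ha, hb, e2, e3]
  field_simp
  ring

end WalkSeries

/-! ### Passage from reduced to all one-face maps -/

section Substitution

/-- Deleting leaves one by one leads to maps with at most one edge, and none of these has genus one.
-/
theorem leafMoment_eq_zero {n j : ℕ} (h : n ≤ j) : leafMoment n j = 0 := by
  induction n using Nat.twoStepInduction generalizing j with
  | zero => simp [leafMoment, oneTreeFinset_eq_empty]
  | one => simp [leafMoment, oneTreeFinset_eq_empty]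
  | more k _ ih =>
    obtain ⟨i, rfl⟩ : ∃ i, j = i + 1 := ⟨j - 1, by omega⟩
    have h1 := leafMoment_succ_succ k i
    rw [ih (by omega), Nat.cast_zero, mul_zero] at h1
    have h2 : ((k : ℚ) + 1) * (i + 1) ≠ 0 := by positivity
    exact_mod_cast (mul_eq_zero.1 h1).resolve_left h2

/-- One-face maps counted by edges, with each map weighted by the inverse of its number of edges. -/
noncomputable def unrootedSeries : ℚ⟦X⟧ :=
  PowerSeries.mk fun n => ((oneTreeFinset n).card : ℚ) / n

theorem coeff_Rhat_eq_sum (n : ℕ) : coeff n (Rhat 1) = ∑ j ∈ Finset.range n,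
    (-3) ^ j * ((2 * (n - j) - 1 + j).choose j : ℚ) * coeff (n - j) unrootedSeries := by
  rw [Rhat, coeff_mk]
  have h := congrArg (Int.cast : ℤ → ℚ) (reducedTreeCount_eq_sum n)
  push_cast at h
  rw [h, Finset.sum_div]
  symm
  refine Finset.sum_subset_zero_on_sdiff (Finset.range_mono (by omega)) ?_ ?_
  · intro j hj
    simp only [Finset.mem_sdiff, Finset.mem_range] at hj
    rw [leafMoment_eq_zero (by omega)]
    simp
  · intro j hj
    obtain ⟨m, rfl⟩ : ∃ m, n = m + 1 + j := ⟨n - 1 - j, by have := Finset.mem_range.1 hj; omega⟩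
    have h1 := leafMoment_eq m j
    rw [show m + 1 + j - j = m + 1 by omega, show 2 * (m + 1) - 1 + j = 2 * m + 1 + j by omega,
      unrootedSeries, coeff_mk]
    push_cast
    rw [mul_div_assoc, h1]
    have h0 : leafMoment (m + 1) 0 = (oneTreeFinset (m + 1)).card := by simp [leafMoment]
    rw [h0, show (-3 : ℚ) = -1 * 3 by norm_num, mul_pow]
    ring

theorem coeff_inv_pow (d n : ℕ) : coeff n (((1 + 3 * X : ℚ⟦X⟧)⁻¹) ^ (d + 1)) =
    (-3) ^ n * ((d + n).choose n : ℚ) := by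
  have h := congrArg (rescale (-3 : ℚ)) (mk_add_choose_mul_one_sub_pow_eq_one ℚ d)
  have hc : (C (-3 : ℚ) : ℚ⟦X⟧) = -3 := by
    rw [map_neg, map_ofNat]
  rw [map_mul, map_pow, map_sub, map_one, rescale_X, hc] at h
  have h1 : (1 + 3 * X : ℚ⟦X⟧) * (1 + 3 * X : ℚ⟦X⟧)⁻¹ = 1 :=
    PowerSeries.mul_inv_cancel _ (by simp)
  have h2 : ((1 + 3 * X : ℚ⟦X⟧)⁻¹) ^ (d + 1) =
      rescale (-3 : ℚ) (PowerSeries.mk fun n => ((d + n).choose d : ℚ)) := by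
    have h3 : ((1 + 3 * X : ℚ⟦X⟧) * (1 + 3 * X : ℚ⟦X⟧)⁻¹) ^ (d + 1) = 1 := by rw [h1, one_pow]
    rw [mul_pow] at h3
    have h4 : (1 - -3 * X : ℚ⟦X⟧) = 1 + 3 * X := by ring
    rw [h4] at h
    exact (left_inv_eq_right_inv h h3).symm
  rw [h2, coeff_rescale, coeff_mk, Nat.choose_symm_add]

theorem hasSubst_inv : HasSubst (X * ((1 + 3 * X : ℚ⟦X⟧)⁻¹) ^ 2) :=
  HasSubst.of_constantCoeff_zero' (by simp)

/-- The signed binomial coefficients of `coeff_Rhat_eq_sum` are the coefficients of negative even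
powers of `1 + 3 * X`, so the inclusion–exclusion sum is a composition of series. -/
theorem Rhat_eq_subst : Rhat 1 = subst (X * ((1 + 3 * X : ℚ⟦X⟧)⁻¹) ^ 2) unrootedSeries := by
  ext n
  have hz : ∀ m, coeff n ((X * ((1 + 3 * X : ℚ⟦X⟧)⁻¹) ^ 2) ^ m) =
      if m ≤ n then coeff (n - m) (((1 + 3 * X : ℚ⟦X⟧)⁻¹) ^ (2 * m)) else 0 := fun m => by
    rw [mul_pow, ← pow_mul, coeff_X_pow_mul']
  rw [coeff_subst' hasSubst_inv, finsum_eq_sum_of_support_subset (s := Finset.range (n + 1)),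
    Finset.sum_range_succ', coeff_Rhat_eq_sum, ← Finset.sum_range_reflect]
  · have h0 : coeff 0 unrootedSeries = 0 := by simp [unrootedSeries]
    rw [h0, zero_smul, add_zero]
    refine Finset.sum_congr rfl fun m hm => ?_
    have := Finset.mem_range.1 hm
    rw [hz, if_pos (by omega), show 2 * (m + 1) = 2 * m + 1 + 1 by ring, coeff_inv_pow, smul_eq_mul,
      show n - (n - 1 - m) = m + 1 by omega, show n - 1 - m = n - (m + 1) by omega,
      show 2 * (m + 1) - 1 = 2 * m + 1 by omega]
    ring
  · intro m hm
    rw [Finset.coe_range, Set.mem_Iio]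
    by_contra hc
    exact hm (by simp only [hz, if_neg (show ¬ m ≤ n by omega), smul_zero])

theorem Q_eq : Q 1 = 2 * unrootedSeries := by
  ext n
  rw [Q, unrootedSeries, two_mul, map_add, coeff_mk, coeff_mk]
  rcases Nat.eq_zero_or_pos n with rfl | hn
  · have h : IsEmpty (RootedMap (2 * 0)) := ⟨fun M => M.root.elim0⟩
    simp [quadrangulationCount, Set.eq_empty_of_isEmpty]
  · have h := congrArg (Nat.cast : ℕ → ℚ) (mul_quadrangulationCount n)
    push_cast at h
    have hn' : (n : ℚ) ≠ 0 := by positivity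
    field_simp
    linarith

end Substitution

end TorusMaps

theorem mainTheorem8 :
    TorusMaps.Rhat 1 =
      PowerSeries.X ^ 2 * (1 + 3 * PowerSeries.X) *
        (2 * (1 - 3 * PowerSeries.X) ^ 2 * (1 + PowerSeries.X))⁻¹ ∧
    (∃! T : ℚ⟦X⟧, T = 1 + 3 * PowerSeries.X * T ^ 2) ∧
    ∀ T : ℚ⟦X⟧, T = 1 + 3 * PowerSeries.X * T ^ 2 →
      TorusMaps.Q 1 = (T - 1) ^ 2 * T * (3 * (2 - T) ^ 2 * (2 + T))⁻¹ := by
  refine ⟨TorusMaps.Rhat_eq, TorusMaps.existsUnique_eq_of_dvd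
    (fun T => 1 + 3 * PowerSeries.X * T ^ 2) fun f g => ⟨3 * (f + g), by ring⟩, fun T hT => ?_⟩
  have hT1 : PowerSeries.constantCoeff T = 1 := by
    rw [hT]
    simp
  have hT0 : T ≠ 0 := fun h => by simp [h] at hT1
  have hv : PowerSeries.HasSubst (PowerSeries.X * T ^ 2) :=
    PowerSeries.HasSubst.of_constantCoeff_zero' (by simp)
  -- Substitution of `v = X * T ^ 2` inverts that of `X / (1 + 3 * X) ^ 2`, because `1 + 3 * v = T`.
  let φ : ℚ⟦X⟧ →ₐ[ℚ] ℚ⟦X⟧ := PowerSeries.substAlgHom hv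
  have hφ : ∀ f, φ f = PowerSeries.subst (PowerSeries.X * T ^ 2) f := fun f => by
    rw [PowerSeries.coe_substAlgHom]
  have hX : φ PowerSeries.X = PowerSeries.X * T ^ 2 := by rw [hφ, PowerSeries.subst_X hv]
  have hg : PowerSeries.X * ((1 + 3 * PowerSeries.X : ℚ⟦X⟧)⁻¹) ^ 2 *
      (1 + 3 * PowerSeries.X : ℚ⟦X⟧) ^ 2 = PowerSeries.X := by
    rw [mul_assoc, ← mul_pow, PowerSeries.inv_mul_cancel _ (by simp), one_pow, mul_one]
  have hinv : φ (PowerSeries.X * ((1 + 3 * PowerSeries.X : ℚ⟦X⟧)⁻¹) ^ 2) = PowerSeries.X := by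
    have h := congrArg φ hg
    rw [map_mul, map_pow, map_add, map_mul φ 3, map_one, map_ofNat, hX,
      show 1 + 3 * (PowerSeries.X * T ^ 2) = T by linear_combination -hT] at h
    exact mul_right_cancel₀ (pow_ne_zero 2 hT0) h
  have hR : φ (TorusMaps.Rhat 1) = TorusMaps.unrootedSeries := by
    rw [TorusMaps.Rhat_eq_subst, hφ,
      PowerSeries.subst_comp_subst_apply TorusMaps.hasSubst_inv hv, ← hφ, hinv,
      PowerSeries.X_subst]
  have hD : PowerSeries.constantCoeff
      (2 * (1 - 3 * PowerSeries.X) ^ 2 * (1 + PowerSeries.X) : ℚ⟦X⟧) ≠ 0 := by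
    simp [map_ofNat]
  have h1 := congrArg φ ((PowerSeries.eq_mul_inv_iff_mul_eq hD).1 TorusMaps.Rhat_eq)
  simp only [map_mul, map_add, map_sub, map_pow, map_one, map_ofNat, hX, hR] at h1
  rw [TorusMaps.Q_eq, PowerSeries.eq_mul_inv_iff_mul_eq (by
    simp only [map_mul, map_add, map_sub, map_pow, map_ofNat, hT1]
    norm_num)]
  -- With `S = 1 + 3 * v` one has `2 - S = 1 - 3 * v`, `2 + S = 3 * (1 + v)` and `S - 1 = 3 * v`,
  -- hence the factor 9.
  have key : ∀ v Y S : ℚ⟦X⟧, Y * (2 * (1 - 3 * v) ^ 2 * (1 + v)) = v ^ 2 * (1 + 3 * v) →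
      S = 1 + 3 * v → 2 * Y * (3 * (2 - S) ^ 2 * (2 + S)) = (S - 1) ^ 2 * S := by
    rintro v Y _ h rfl
    linear_combination 9 * h
  exact key _ _ _ h1 (by rwa [← mul_assoc])
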